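/- **Setting.** Let $K:\mathbb R\to\mathbb R$ satisfy $K(z)=K(|z|)$, $K\in C^0(\mathbb R)\cap C^2(\mathbb R\setminus\{0\})$, $K,K'\in L^\infty(\mathbb R)$, $K''\in L^\infty(\mathbb R\setminus\{0\})$ and $K'\in L^1(\mathbb R)$. Let $\phi(r)=rW'(r)-W(r)$ be a strictly increasing $C^1$ function on $[0,\infty)$ with $W\ge 0$, $\phi(0)=0$, $r\phi'(r)\le c_0\phi(r)$, $\phi(r)\le\max\{r,c_0W(r)\}$ for some $c_0>0$, $\phi(r)\le c_1r$ for $0\le r\le\hat\rho$ and $\phi(r)\ge c_2r$ for $r\ge\bar\rho$, for some $c_1,c_2>0$ and $0<\hat\rho<1<\bar\rho$. Let $T>0$. Consider $$\partial_t\rho=\partial_x\big(\rho\,\partial_x(K*\rho)+\partial_x\phi(\rho)\big),\qquad (t,x)\in[0,T]\times\mathbb R.\tag{1}$$ A *weak solution* of (1) starting from $\rho_0$ is a bounded, nonnegative $\rho\in L^1([0,T]\times\mathbb R)$ such that, for all $\psi\in C_c^\infty([0,T)\times\mathbb R)$, $$\int_0^T\!\!\int_{\mathbb R}\big(\rho\,\partial_t\psi-\rho\,(K'*\rho)\,\partial_x\psi+\phi(\rho)\,\partial_{xx}\psi\big)\,dx\,dt+\int_{\mathbb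 R}\rho_0\,\psi(0,\cdot)\,dx=0.$$ **Particle scheme.** Let $\rho_0>0$ be a density in $L^1\cap L^\infty(\mathbb R)$ with finite first moment, $L>0$, $c_L=\int_{-L/2}^{L/2}\rho_0$, $N\ge1$. Put $x_0(0)=-L/2$ and $x_k(0)=\sup\{x\in[-L/2,L/2]:\int_{x_{k-1}(0)}^x\rho_0<c_L/N\}$ for $1\le k<N$, and on the torus $\mathbb T_L=\mathbb R/L\mathbb Z$ (lifted to $\mathbb R$, with $x_{k+N}=x_k+L$) let, for $0\le k<N$, $$\dot x_k=-\frac{c_L}{N}\sum_{0\le j<N,\,j\ne k}K'(x_k-x_j)-\frac N{c_L}\big[\phi(\rho_k)-\phi(\rho_{k-1})\big],\qquad \rho_k=\frac{c_L}{N(x_{k+1}-x_k)},$$ where $K$ on $\mathbb T_L$ is evaluated at the torus distance, $x_k(\cdot)$ is absolutely continuous, the equation holds for a.e. $t$, and, for antipodal pairs (where the kernel on $\mathbb T_L$ has a corner), $K'(x_k-x_j)=-K'(x_j-x_k)$ may be any number between the one-sided derivatives $\pm K'(L/2)$ (Filippov solutions). The scheme is well defined on $[0,T]$ if $x_k(t)<x_{k+1}(t)$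 for all $k$ and $t\in[0,T]$; then $\rho_L^N(t,\cdot)=\rho_k(t)$ on $[x_k(t),x_{k+1}(t))$. A function $\rho\in L^1([0,T]\times\mathbb R)$ is called a *scheme limit* from $\rho_0$ if, for some sequence $L\to\infty$, it is the limit in $L^1([0,T]\times\mathbb R)$ of $\rho_L\chi_{[-L/2,L/2)}$, where each $\rho_L$ is a limit in $L^1([0,T]\times\mathbb T_L)$, along some subsequence $N\to\infty$, of well-defined particle approximations $\rho^N_L$. **Theorem.** Let $\rho_0\ge0$, $\rho_0\in L^1\cap L^\infty(\mathbb R)$, $\int|x|\rho_0\,dx<\infty$, and let $(\rho_0^\lambda)_{\lambda\in\mathbb N}$ be strictly positive, uniformly bounded, integrable functions with uniformly bounded first moments and $\rho_0^\lambda\to\rho_0$ in $L^1(\mathbb R)$. Then for every $\lambda$ there is a scheme limit from $\rho_0^\lambda$; and whenever $\rho^\lambda$ is, for each $\lambda$, a scheme limit from $\rho_0^\lambda$, every $\rho^\lambda$ is a weak solution of (1) starting from $\rho_0^\lambda$, and there is a subsequence of $(\rho^\lambda)_\lambda$ that converges in $L^1([0,T]\times\mathbb R)$ to a weak solution of (1)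 starting from $\rho_0$. -/

import Mathlib

open Set Filter Topology MeasureTheory
open scoped ContDiff ENNReal

noncomputable section

namespace AggDiff

/-- The standing assumptions on the interaction kernel `K`: even, continuous on `ℝ`, of class `C²`
away from `0`, with `K`, `K'` bounded, `K''` bounded away from the origin and `K'` integrable.
(For an even function the value of Mathlib's `deriv K` at `0` is always `0`.) -/
structure AdmissibleKernel (K : ℝ → ℝ) : Prop where
  even : ∀ z, K z = K |z|
  continuous : Continuous K
  contDiffOn : ContDiffOn ℝ 2 K {0}ᶜ
  bounded : ∃ C, ∀ z, |K z| ≤ C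
  deriv_bounded : ∃ C, ∀ z, z ≠ 0 → |deriv K z| ≤ C
  deriv_two_bounded : ∃ C, ∀ z, z ≠ 0 → |deriv (deriv K) z| ≤ C
  deriv_integrable : Integrable (deriv K)

/-- The standing assumptions on the energy density `W` and on the nonlinear diffusion
`φ(r) = r W'(r) - W(r)`, both regarded as functions on `[0, ∞)`. -/
structure AdmissibleDiffusion (W φ : ℝ → ℝ) : Prop where
  differentiable : ∀ r, 0 < r → DifferentiableAt ℝ W r
  eq : ∀ r, 0 < r → φ r = r * deriv W r - W r
  contDiffOn : ContDiffOn ℝ 1 φ (Ici 0)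
  energy_nonneg : ∀ r, 0 ≤ r → 0 ≤ W r
  zero : φ 0 = 0
  strictMono : StrictMonoOn φ (Ici 0)
  growth : ∃ c₀ : ℝ, 0 < c₀ ∧ (∀ r, 0 < r → deriv φ r * r ≤ c₀ * φ r) ∧
    (∀ r, 0 ≤ r → φ r ≤ max r (c₀ * W r))
  small : ∃ c₁ r₁ : ℝ, 0 < c₁ ∧ 0 < r₁ ∧ r₁ < 1 ∧ ∀ r, 0 ≤ r → r ≤ r₁ → φ r ≤ c₁ * r
  large : ∃ c₂ r₂ : ℝ, 0 < c₂ ∧ 1 < r₂ ∧ ∀ r, r₂ ≤ r → c₂ * r ≤ φ r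

/-! ### Weak solutions on the line -/

/-- Lebesgue measure on the space-time strip `[0,T] × ℝ`. -/
def stripMeasure (T : ℝ) : Measure (ℝ × ℝ) :=
  (volume : Measure (ℝ × ℝ)).restrict (Icc 0 T ×ˢ univ)

/-- Bounded nonnegative integrable weak solutions on `[0,T] × ℝ`, starting from `ρ₀`, of
`∂ₜρ = ∂ₓ(ρ ∂ₓ(K ∗ ρ) + ∂ₓ φ(ρ))`.  Points of space-time are pairs `(t, x)`; the test functions
are smooth with compact support in `(-∞, T) × ℝ`, i.e. their restrictions to `[0, T) × ℝ` need not
vanish at time `0`, so that the weak formulation contains the initial condition. -/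
structure IsWeakSolution (K φ : ℝ → ℝ) (T : ℝ) (ρ₀ : ℝ → ℝ) (ρ : ℝ × ℝ → ℝ) : Prop where
  integrable : Integrable ρ (stripMeasure T)
  bounded : MemLp ρ ∞ (stripMeasure T)
  nonneg : ∀ᵐ p ∂(stripMeasure T), 0 ≤ ρ p
  weak : ∀ ψ : ℝ × ℝ → ℝ, ContDiff ℝ ∞ ψ → HasCompactSupport ψ →
    tsupport ψ ⊆ Iio T ×ˢ univ →
    (∫ p, (ρ p * deriv (fun s => ψ (s, p.2)) p.1
        - ρ p * (∫ y, deriv K (p.2 - y) * ρ (p.1, y)) * deriv (fun x => ψ (p.1, x)) p.2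
        + φ (ρ p) * iteratedDeriv 2 (fun x => ψ (p.1, x)) p.2) ∂(stripMeasure T))
      + ∫ x, ρ₀ x * ψ (0, x) = 0

/-! ### Deterministic particle approximations on the torus of length `L` -/

/-- The representative in `[-L/2, L/2)` of `z` modulo `L`. -/
def torusRep (L z : ℝ) : ℝ := z - L * (round (z / L) : ℝ)

/-- The derivative at `z` of the kernel `K(|z|)` on the torus `ℝ / Lℤ`, where `|z|` is the distance
of `z` to `0` on the torus.  This kernel is of class `C¹` away from `0` and the antipodal point
`L/2`; there it has left derivative `K'(L/2)` and right derivative `-K'(L/2)`, and all the slopes in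
between are admitted (Filippov convention).  Away from the antipode this is the one-point set of the
usual derivative. -/
def torusSlope (K : ℝ → ℝ) (L z : ℝ) : Set ℝ :=
  {s | (torusRep L z ≠ -(L / 2) → s = deriv K (torusRep L z)) ∧
    (torusRep L z = -(L / 2) → |s| ≤ |deriv K (L / 2)|)}

/-- The mass `c_L` of the initial density on the fundamental domain of the torus. -/
def cellMass (ρ₀ : ℝ → ℝ) (L : ℝ) : ℝ := ∫ y in (-(L / 2))..(L / 2), ρ₀ y

/-- The density `ρ_k = c / (N (x_{k+1} - x_k))` of the `k`-th cell. -/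
def cellDensity (c : ℝ) (N : ℕ) (x : ℤ → ℝ → ℝ) (k : ℤ) (t : ℝ) : ℝ :=
  c / (N * (x (k + 1) t - x k t))

/-- The `N` particles on the torus of length `L`, evolving on `[0,T]` from the initial density
`ρ₀ χ_[-L/2,L/2)` (extended periodically).  Positions are lifted to `ℝ`, and indices are extended to
`ℤ` by `x_{k+N} = x_k + L`. -/
structure IsParticleEvolution (K φ : ℝ → ℝ) (T L : ℝ) (ρ₀ : ℝ → ℝ) (N : ℕ)
    (x : ℤ → ℝ → ℝ) : Prop where
  periodic : ∀ k, ∀ t ∈ Icc 0 T, x (k + N) t = x k t + L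
  ordered : ∀ k, ∀ t ∈ Icc 0 T, x k t < x (k + 1) t
  initial_zero : x 0 0 = -(L / 2)
  initial : ∀ k : ℤ, 1 ≤ k → k < N →
    IsLUB {y | y ∈ Icc (-(L / 2)) (L / 2) ∧ ∫ u in (x (k - 1) 0)..y, ρ₀ u < cellMass ρ₀ L / N}
      (x k 0)
  absolutelyContinuous : ∀ k, AbsolutelyContinuousOnInterval (x k) 0 T
  ode : ∀ᵐ t ∂(volume.restrict (Icc 0 T)), ∃ κ : ℤ → ℤ → ℝ,
    (∀ k j, κ k j ∈ torusSlope K L (x k t - x j t)) ∧ (∀ k j, κ j k = -κ k j) ∧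
    ∀ k ∈ Finset.Ico (0 : ℤ) N, HasDerivAt (x k)
      (-(cellMass ρ₀ L / N) * (∑ j ∈ (Finset.Ico (0 : ℤ) N).erase k, κ k j)
        - (N / cellMass ρ₀ L) * (φ (cellDensity (cellMass ρ₀ L) N x k t)
            - φ (cellDensity (cellMass ρ₀ L) N x (k - 1) t))) t

/-- The deterministic particle approximation: the `L`-periodic piecewise constant density equal to
`ρ_k(t)` on `[x_k(t), x_{k+1}(t))`.  At each point at most one summand is nonzero. -/
def particleDensity (c : ℝ) (N : ℕ) (x : ℤ → ℝ → ℝ) (p : ℝ × ℝ) : ℝ :=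
  ∑' k : ℤ, (Ico (x k p.1) (x (k + 1) p.1)).indicator (fun _ => cellDensity c N x k p.1) p.2

/-- Lebesgue measure on `[0,T]` times the fundamental domain `[-L/2, L/2)` of the torus. -/
def torusStripMeasure (T L : ℝ) : Measure (ℝ × ℝ) :=
  (volume : Measure (ℝ × ℝ)).restrict (Icc 0 T ×ˢ Ico (-(L / 2)) (L / 2))

/-- `ρL` is a limit in `L¹([0,T] × 𝕋_L)`, along some subsequence `N → ∞`, of the deterministic
particle approximations starting from `ρ₀` cut on `[-L/2, L/2)`. -/
def IsTorusLimit (K φ : ℝ → ℝ) (T L : ℝ) (ρ₀ : ℝ → ℝ) (ρL : ℝ × ℝ → ℝ) : Prop :=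
  Integrable ρL (torusStripMeasure T L) ∧
  ∃ (N : ℕ → ℕ) (x : ℕ → ℤ → ℝ → ℝ), StrictMono N ∧
    (∀ i, IsParticleEvolution K φ T L ρ₀ (N i) (x i)) ∧
    Tendsto (fun i => eLpNorm (fun p => particleDensity (cellMass ρ₀ L) (N i) (x i) p - ρL p) 1
      (torusStripMeasure T L)) atTop (𝓝 0)

/-- `ρ` is a limit in `L¹([0,T] × ℝ)`, along some sequence of lengths `L → ∞`, of functions
`ρ_L χ_[-L/2,L/2)`, where `ρ_L` is a limit as `N → ∞` of the deterministic particle approximations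
on the torus of length `L` starting from `ρ₀` cut on `[-L/2, L/2)`. -/
def IsSchemeLimit (K φ : ℝ → ℝ) (T : ℝ) (ρ₀ : ℝ → ℝ) (ρ : ℝ × ℝ → ℝ) : Prop :=
  Integrable ρ (stripMeasure T) ∧
  ∃ (L : ℕ → ℝ) (ρL : ℕ → ℝ × ℝ → ℝ), (∀ n, 0 < L n) ∧ Tendsto L atTop atTop ∧
    (∀ n, IsTorusLimit K φ T (L n) ρ₀ (ρL n)) ∧
    Tendsto (fun n => eLpNorm
      (fun p => (univ ×ˢ Ico (-(L n / 2)) (L n / 2)).indicator (ρL n) p - ρ p) 1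
      (stripMeasure T)) atTop (𝓝 0)

end AggDiff

end

/-! The theorem rests on three estimates for the particles that do not depend on the number `N`, the
length `L`, or the datum except through bounds on its mass and its supremum. What follows them is
compactness and consistency.

Energy: `∑ (x_{k+1} - x_k) W(ρ_k)` decreases along the scheme up to a bounded contribution of the
interaction. With `D_k = (N/c)(φ(ρ_k) - φ(ρ_{k-1}))`, the dissipation `(c/N) ∑ D_k²` therefore has a
bounded time integral (`integral_dissipation_le`), and by Young's inequality the total variation of
`φ(ρ)` in space is integrable in time.

Maximum: the narrowest cell is opened by the diffusion, and the interaction closes it, on a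
logarithmic scale, at rate at most `c C + 8 B ρ_max`. The second term is due to the jumps of `K'` at
the origin and at the antipode, which at most four particles produce inside the cell. As `ρ_max` is
at most affine in the dissipation, this rate is integrable in time and the density stays bounded
(`cell_le_exp`).

Displacement: on average, particles move little in a short time (`sum_abs_displacement_le`).

Existence of the evolutions: the field is truncated and mollified, the mollification is removed in
the limit (which produces the Filippov slopes at the antipode), and the bound for the density shows
that the truncation is never felt (`exists_particleEvolution`).

Compactness: `φ` is invertible on `[0, R]`, so small oscillation of `φ(ρ)` in space and small
displacement in time place the densities near step functions on a fixed grid (`exists_grid_net`).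
Propagation of the first moment (`moment_le`) gives tightness on the line (`exists_line_net`).

Consistency: the time derivative of `(c/N) ∑ ψ(t, x_k)` is the weak form of the equation for the
particle density, up to errors that vanish as `L → ∞` and `L/N → 0` (`abs_weak_le`), and the weak
form is continuous in `L¹` on bounded densities. The two limits may thus be taken jointly: a scheme
limit, or a limit of scheme limits, is the limit of one diagonal sequence of particle densities, and
no equation on the torus is needed for the intermediate limits. -/

noncomputable section

namespace AggDiff

/-! ### The slope of the kernel -/

/-- An odd bounded function that is Lipschitz on the positive half line. -/
structure SlopeBound (k : ℝ → ℝ) (B C : ℝ) : Prop where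
  bound_nonneg : 0 ≤ B
  lip_nonneg : 0 ≤ C
  odd : ∀ z, k (-z) = -k z
  bound : ∀ z, |k z| ≤ B
  lip : ∀ z w, 0 < z → 0 < w → |k z - k w| ≤ C * |z - w|

theorem AdmissibleKernel.exists_slopeBound {K : ℝ → ℝ} (hK : AdmissibleKernel K) :
    ∃ B C, SlopeBound (deriv K) B C := by
  obtain ⟨B, hB⟩ := hK.deriv_bounded
  obtain ⟨C, hC⟩ := hK.deriv_two_bounded
  have hodd : ∀ z, deriv K (-z) = -deriv K z := by
    intro z
    have h : (fun y => K (-y)) = K := by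
      funext y; rw [hK.even (-y), abs_neg, ← hK.even]
    have := deriv_comp_neg K z
    rw [h] at this; linarith
  -- `K` may have a corner at the origin; oddness alone forces the value there, so the bound of `K'`
  -- extends to every point.
  have h0 : deriv K 0 = 0 := by have := hodd 0; simp at this; linarith
  have hB0 : 0 ≤ B := (abs_nonneg _).trans (hB 1 one_ne_zero)
  have hC0 : 0 ≤ C := (abs_nonneg _).trans (hC 1 one_ne_zero)
  refine ⟨B, C, hB0, hC0, hodd, fun z => ?_, fun z w hz hw => ?_⟩
  · by_cases hz : z = 0
    · rw [hz, h0]; simpa using hB0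
    · exact hB z hz
  · have hd : ∀ y ∈ Ioi (0 : ℝ), DifferentiableAt ℝ (deriv K) y := by
      intro y hy
      have h2 : ContDiffOn ℝ 1 (deriv K) {0}ᶜ :=
        ((contDiffOn_succ_iff_deriv_of_isOpen (n := 1) isOpen_compl_singleton).1
          (by rw [one_add_one_eq_two]; exact hK.contDiffOn)).2.2
      exact (h2.differentiableOn (by norm_num)).differentiableAt
        (isOpen_compl_singleton.mem_nhds (ne_of_gt hy))
    have := Convex.norm_image_sub_le_of_norm_deriv_le (f := deriv K) (s := Ioi 0) (C := C) hd
      (fun y hy => hC y (ne_of_gt hy)) (convex_Ioi 0) (mem_Ioi.2 hw) (mem_Ioi.2 hz)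
    simpa [Real.norm_eq_abs] using this

namespace SlopeBound

variable {k : ℝ → ℝ} {B C : ℝ}

theorem zero (h : SlopeBound k B C) : k 0 = 0 := by
  have := h.odd 0; simp at this; linarith

theorem lip_neg (h : SlopeBound k B C) {z w : ℝ} (hz : z < 0) (hw : w < 0) :
    |k z - k w| ≤ C * |z - w| := by
  have := h.lip (-z) (-w) (by linarith) (by linarith)
  rw [h.odd, h.odd, show -k z - -k w = -(k z - k w) by ring, abs_neg,
    show -z - -w = -(z - w) by ring, abs_neg] at this
  exact this

theorem sub_le (h : SlopeBound k B C) (z w : ℝ) : |k z - k w| ≤ 2 * B := by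
  have := abs_sub (k z) (k w)
  have := h.bound z; have := h.bound w; linarith

end SlopeBound

/-! ### Representatives on the torus -/

section TorusRep

variable {L : ℝ}

theorem torusRep_mem (hL : 0 < L) (z : ℝ) : torusRep L z ∈ Ico (-(L / 2)) (L / 2) := by
  unfold torusRep
  rw [round_eq]
  have h1 := Int.floor_le (z / L + 1 / 2)
  have h2 := Int.lt_floor_add_one (z / L + 1 / 2)
  have hz : z = L * (z / L) := by field_simp
  constructor
  · nlinarith
  · nlinarith

theorem torusRep_eq_sub (hL : 0 < L) {z : ℝ} {m : ℤ} (h : z - m * L ∈ Ico (-(L / 2)) (L / 2)) :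
    torusRep L z = z - m * L := by
  unfold torusRep
  have : round (z / L) = m := by
    rw [round_eq, Int.floor_eq_iff]
    have hz : z = L * (z / L) := by field_simp
    obtain ⟨h1, h2⟩ := h
    constructor
    · by_contra hc
      push Not at hc
      nlinarith
    · by_contra hc
      push Not at hc
      nlinarith
  rw [this]; ring

theorem torusRep_eq_self (hL : 0 < L) {z : ℝ} (h : z ∈ Ico (-(L / 2)) (L / 2)) :
    torusRep L z = z := by
  have := torusRep_eq_sub hL (m := 0) (z := z) (by simpa using h)
  simpa using this

theorem exists_torusRep_eq (L z : ℝ) : ∃ m : ℤ, torusRep L z = z - m * L :=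
  ⟨round (z / L), by unfold torusRep; ring⟩

theorem torusRep_sub_mul (hL : 0 < L) (z : ℝ) (m : ℤ) :
    torusRep L (z - m * L) = torusRep L z := by
  obtain ⟨n, hn⟩ := exists_torusRep_eq L z
  have h := torusRep_mem hL z
  rw [hn] at h ⊢
  have := torusRep_eq_sub hL (z := z - m * L) (m := n - m) (by
    push_cast; convert h using 1; ring)
  rw [this]; push_cast; ring

theorem torusRep_add_mul (hL : 0 < L) (z : ℝ) (m : ℤ) :
    torusRep L (z + m * L) = torusRep L z := by
  have := torusRep_sub_mul hL z (-m)
  simpa using this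

theorem torusRep_periodic (hL : 0 < L) : Function.Periodic (torusRep L) L := fun z => by
  simpa using torusRep_add_mul hL z 1

theorem torusRep_neg (hL : 0 < L) {z : ℝ} (h : torusRep L z ≠ -(L / 2)) :
    torusRep L (-z) = -torusRep L z := by
  obtain ⟨n, hn⟩ := exists_torusRep_eq L z
  have hm := torusRep_mem hL z
  have := torusRep_eq_sub hL (z := -z) (m := -n) (by
    have h1 : -(L / 2) < torusRep L z := lt_of_le_of_ne hm.1 (Ne.symm h)
    have h2 := hm.2
    push_cast
    constructor <;> linarith)
  rw [this, hn]; push_cast; ring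

theorem torusRep_neg_of_eq (hL : 0 < L) {z : ℝ} (h : torusRep L z = -(L / 2)) :
    torusRep L (-z) = -(L / 2) := by
  obtain ⟨n, hn⟩ := exists_torusRep_eq L z
  have := torusRep_eq_sub hL (z := -z) (m := -n + 1) (by
    push_cast; constructor <;> linarith)
  rw [this]; push_cast; linarith

theorem measurable_torusRep (L : ℝ) : Measurable (torusRep L) := by
  unfold torusRep
  have : Measurable fun z : ℝ => (round (z / L) : ℝ) := by
    simp_rw [round_eq]
    exact measurable_from_top.comp (Int.measurable_floor.comp (by fun_prop))
  fun_prop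

/-- A Lipschitz function on the fundamental domain with equal boundary values extends periodically
to a Lipschitz function. -/
theorem abs_comp_torusRep_sub_le (hL : 0 < L) {g : ℝ → ℝ} {A : ℝ} 
    (hg : ∀ u ∈ Icc (-(L / 2)) (L / 2), ∀ v ∈ Icc (-(L / 2)) (L / 2), |g u - g v| ≤ A * |u - v|)
    (hb : g (-(L / 2)) = g (L / 2)) (x y : ℝ) :
    |g (torusRep L x) - g (torusRep L y)| ≤ A * |x - y| := by
  -- If `x` and `y` lie in the periods centred at `mL` and `nL`, this condition says `m ≤ n`.
  wlog hxy : torusRep L y + (x - torusRep L x - (y - torusRep L y)) ≤ torusRep L y generalizing x y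
  · rw [abs_sub_comm, abs_sub_comm x]
    exact this y x (by push Not at hxy; linarith)
  have hA : 0 ≤ A := by
    have := (abs_nonneg _).trans (hg (-(L / 2)) ⟨le_rfl, by linarith⟩ (L / 2) ⟨by linarith, le_rfl⟩)
    by_contra hc
    have : 0 < |-(L / 2) - L / 2| := abs_pos.2 (by linarith)
    nlinarith
  obtain ⟨m, hm⟩ := exists_torusRep_eq L x
  obtain ⟨n, hn⟩ := exists_torusRep_eq L y
  have hx := torusRep_mem hL x
  have hy := torusRep_mem hL y
  set u := torusRep L x
  set v := torusRep L y
  have hmn : (m : ℝ) ≤ n := by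
    by_contra hc
    push Not at hc
    nlinarith
  rcases eq_or_lt_of_le hmn with h | h
  · have : x - y = u - v := by rw [hm, hn, h]; ring
    rw [this]
    exact hg u ⟨hx.1, hx.2.le⟩ v ⟨hy.1, hy.2.le⟩
  -- In different periods, the way from `x` to `y` passes the right end of one period and the left
  -- end of another, where `g` takes the same value.
  · have h1 : (m : ℝ) + 1 ≤ n := by exact_mod_cast h
    have h2 : (L / 2 - u) + (v + L / 2) ≤ |x - y| := by
      rw [abs_sub_comm]
      refine le_trans ?_ (le_abs_self _)
      have : y - x = v - u + (n - m) * L := by rw [hm, hn]; ring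
      rw [this]; nlinarith
    have h3 := hg u ⟨hx.1, hx.2.le⟩ (L / 2) ⟨by linarith, le_rfl⟩
    have h4 := hg (-(L / 2)) ⟨le_rfl, by linarith⟩ v ⟨hy.1, hy.2.le⟩
    have h5 : |u - L / 2| = L / 2 - u := by rw [abs_sub_comm, abs_of_nonneg]; linarith [hx.2]
    have h6 : |-(L / 2) - v| = v + L / 2 := by rw [abs_sub_comm, abs_of_nonneg] <;> linarith [hy.1]
    have h7 := abs_sub_le (g u) (g (L / 2)) (g v)
    rw [h5] at h3; rw [h6, hb] at h4
    calc |g u - g v| ≤ A * ((L / 2 - u) + (v + L / 2)) := by linarith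
      _ ≤ _ := by gcongr

end TorusRep

/-! ### The slopes of the kernel on the torus -/

section TorusSlope

variable {K : ℝ → ℝ} {L B C : ℝ}

theorem abs_le_of_mem_torusSlope (hk : SlopeBound (deriv K) B C) {z s : ℝ}
    (h : s ∈ torusSlope K L z) : |s| ≤ B := by
  by_cases hz : torusRep L z = -(L / 2)
  · exact (h.2 hz).trans (hk.bound _)
  · rw [h.1 hz]; exact hk.bound _

theorem torusSlope_congr (hL : 0 < L) (z : ℝ) (m : ℤ) :
    torusSlope K L (z + m * L) = torusSlope K L z := by
  unfold torusSlope; rw [torusRep_add_mul hL]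

/-- Two slopes on the same side of both singularities of the kernel. -/
theorem torusSlope_sub_le (hk : SlopeBound (deriv K) B C) (hL : 0 < L) {z w s r : ℝ}
    (hs : s ∈ torusSlope K L z) (hr : r ∈ torusSlope K L w)
    (h : (0 < z ∧ z < L / 2 ∧ 0 < w ∧ w < L / 2) ∨ (L / 2 < z ∧ z < L ∧ L / 2 < w ∧ w < L)) :
    |s - r| ≤ C * |z - w| := by
  rcases h with ⟨h1, h2, h3, h4⟩ | ⟨h1, h2, h3, h4⟩
  · have ez := torusRep_eq_self hL (z := z) ⟨by linarith, h2⟩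
    have ew := torusRep_eq_self hL (z := w) ⟨by linarith, h4⟩
    have e1 := hs.1 (by rw [ez]; intro; linarith)
    have e2 := hr.1 (by rw [ew]; intro; linarith)
    rw [e1, e2, ez, ew]
    exact hk.lip z w h1 h3
  -- Beyond the antipode the representative is `z - L`, on the negative half line, where oddness
  -- gives the same Lipschitz constant.
  · have ez := torusRep_eq_sub hL (z := z) (m := 1) (by push_cast; constructor <;> linarith)
    have ew := torusRep_eq_sub hL (z := w) (m := 1) (by push_cast; constructor <;> linarith)
    push_cast at ez ew
    have e1 := hs.1 (by rw [ez]; intro; linarith)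
    have e2 := hr.1 (by rw [ew]; intro; linarith)
    rw [e1, e2, ez, ew]
    have := hk.lip_neg (z := z - 1 * L) (w := w - 1 * L) (by linarith) (by linarith)
    simpa using this

end TorusSlope

/-! ### Sums over a period -/

theorem sum_Ico_int_shift {N : ℕ} {f : ℤ → ℝ} (hf : ∀ k, f (k + N) = f k) (a : ℤ) :
    ∑ k ∈ Finset.Ico a (a + N), f k = ∑ k ∈ Finset.Ico (0 : ℤ) N, f k := by
  have step : ∀ b : ℤ, ∑ k ∈ Finset.Ico (b + 1) (b + 1 + N), f k =
      ∑ k ∈ Finset.Ico b (b + N), f k := by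
    intro b
    rcases Nat.eq_zero_or_pos N with h | h
    · subst h; simp
    have h1 : Finset.Ico b (b + N) = insert b (Finset.Ico (b + 1) (b + N)) := by
      ext k; simp; omega
    have h2 : Finset.Ico (b + 1) (b + 1 + N) = insert (b + N) (Finset.Ico (b + 1) (b + N)) := by
      ext k; simp; omega
    rw [h1, h2, Finset.sum_insert (by simp), Finset.sum_insert (by simp), hf]
  induction a using Int.induction_on with
  | zero => simp
  | succ i ih => rw [step]; exact ih
  | pred i ih => rw [← ih, ← step]; congr 2 <;> ring

theorem sum_Ico_int_add_one {N : ℕ} {f : ℤ → ℝ} (hf : ∀ k, f (k + N) = f k) :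
    ∑ k ∈ Finset.Ico (0 : ℤ) N, f (k + 1) = ∑ k ∈ Finset.Ico (0 : ℤ) N, f k := by
  rw [← sum_Ico_int_shift hf 1, Finset.sum_bij (fun k _ => k + 1)] 
  · intro k hk; simp at hk ⊢; omega
  · intro a _ b _ h; omega
  · intro b hb; simp at hb; exact ⟨b - 1, by simp; omega, by ring⟩
  · intro k _; rfl

theorem sum_Ico_int_eq_sum_add {N : ℕ} {f : ℤ → ℝ} (hf : ∀ k, f (k + N) = f k) (a : ℤ) :
    ∑ k ∈ Finset.Ico (0 : ℤ) N, f k = ∑ i ∈ Finset.range N, f (a + i) := by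
  rw [← sum_Ico_int_shift hf a]
  symm
  refine Finset.sum_bij (fun i _ => a + (i : ℤ)) ?_ ?_ ?_ ?_
  · intro i hi; simp at hi ⊢; omega
  · intro i _ j _ h; simpa using h
  · intro b hb; simp at hb
    exact ⟨(b - a).toNat, by simp; omega, by omega⟩
  · intro i _; rfl

theorem periodic_add_mul {N : ℕ} {α : Type*} {f : ℤ → α} (hf : ∀ k, f (k + N) = f k) (k m : ℤ) :
    f (k + m * N) = f k := by
  have : Function.Periodic f (N : ℤ) := hf
  simpa using this.int_mul m k

theorem sum_Ico_int_const {N : ℕ} (a : ℝ) : ∑ _k ∈ Finset.Ico (0 : ℤ) N, a = N * a := by simp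

/-! ### Absolutely continuous functions -/

/-- Absolute continuity is the convergence to zero of sums of increments along a filter, so it
passes to any function whose increments are dominated by finitely many absolutely continuous ones.
Energies, maxima and empirical integrals of the positions are all treated in this way. -/
theorem absolutelyContinuous_of_le_sum {ι : Type*} {s : Finset ι} {f : ι → ℝ → ℝ} {a b : ℝ}
    (hf : ∀ i ∈ s, AbsolutelyContinuousOnInterval (f i) a b) {F : ℝ → ℝ} (A : ℝ)
    (h : ∀ t ∈ uIcc a b, ∀ u ∈ uIcc a b, |F t - F u| ≤ A * ∑ i ∈ s, |f i t - f i u|) :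
    AbsolutelyContinuousOnInterval F a b := by
  have h0 : Tendsto (fun E : ℕ × (ℕ → ℝ × ℝ) => A * ∑ i ∈ s, ∑ j ∈ Finset.range E.1,
      dist (f i (E.2 j).1) (f i (E.2 j).2))
      (AbsolutelyContinuousOnInterval.totalLengthFilter ⊓
        𝓟 (AbsolutelyContinuousOnInterval.disjWithin a b)) (𝓝 0) := by
    have := (tendsto_finsetSum s fun i hi => hf i hi).const_mul A
    simpa using this
  refine squeeze_zero' (Eventually.of_forall fun E => Finset.sum_nonneg fun i _ => dist_nonneg) ?_ h0
  refine Filter.Eventually.filter_mono inf_le_right ?_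
  rw [eventually_principal]
  rintro ⟨n, I⟩ hE
  rw [Finset.sum_comm, Finset.mul_sum]
  refine Finset.sum_le_sum fun j hj => ?_
  have := hE.1 j (by simpa using hj)
  simpa [Real.dist_eq] using h _ this.1 _ this.2

theorem AbsolutelyContinuousOnInterval.sub_le_integral {f g : ℝ → ℝ} {a b : ℝ} (hab : a ≤ b)
    (hf : AbsolutelyContinuousOnInterval f a b) (hg : IntervalIntegrable g volume a b)
    (h : ∀ᵐ t ∂volume.restrict (Icc a b), deriv f t ≤ g t) : f b - f a ≤ ∫ t in a..b, g t := by
  rw [← hf.integral_deriv_eq_sub]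
  exact intervalIntegral.integral_mono_ae_restrict hab hf.intervalIntegrable_deriv hg h

theorem AbsolutelyContinuousOnInterval.abs_sub_le_integral {f g : ℝ → ℝ} {a b : ℝ} (hab : a ≤ b)
    (hf : AbsolutelyContinuousOnInterval f a b) (hg : IntervalIntegrable g volume a b)
    (h : ∀ᵐ t ∂volume.restrict (Icc a b), |deriv f t| ≤ g t) :
    |f b - f a| ≤ ∫ t in a..b, g t := by
  rw [abs_le]
  constructor
  · rw [neg_le, ← hf.integral_deriv_eq_sub, ← intervalIntegral.integral_neg]
    exact intervalIntegral.integral_mono_ae_restrict hab hf.intervalIntegrable_deriv.neg hg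
      (h.mono fun t ht => (neg_le_abs _).trans ht)
  · exact AbsolutelyContinuousOnInterval.sub_le_integral hab hf hg
      (h.mono fun t ht => (le_abs_self _).trans ht)

end AggDiff

end

noncomputable section

namespace AggDiff

/-! ### Configurations of particles on the torus -/

/-- A lifted configuration of `N` ordered particles on the torus of length `L`. -/
structure IsConfig (N : ℕ) (L : ℝ) (x : ℤ → ℝ) : Prop where
  pos : 0 < N
  length_pos : 0 < L
  periodic : ∀ k, x (k + N) = x k + L
  lt : ∀ k, x k < x (k + 1)

/-- The density of the `k`-th cell of a configuration. -/
def configCell (c : ℝ) (N : ℕ) (x : ℤ → ℝ) (k : ℤ) : ℝ := c / (N * (x (k + 1) - x k))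

/-- The piecewise constant density of a configuration. -/
def configDensity (c : ℝ) (N : ℕ) (x : ℤ → ℝ) (y : ℝ) : ℝ :=
  ∑' k : ℤ, (Ico (x k) (x (k + 1))).indicator (fun _ => configCell c N x k) y

theorem particleDensity_eq (c : ℝ) (N : ℕ) (x : ℤ → ℝ → ℝ) (p : ℝ × ℝ) :
    particleDensity c N x p = configDensity c N (fun k => x k p.1) p.2 := rfl

theorem cellDensity_eq (c : ℝ) (N : ℕ) (x : ℤ → ℝ → ℝ) (k : ℤ) (t : ℝ) :
    cellDensity c N x k t = configCell c N (fun k => x k t) k := rfl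

namespace IsConfig

variable {N : ℕ} {L c : ℝ} {x : ℤ → ℝ} (hx : IsConfig N L x)
include hx

theorem strictMono : StrictMono x := strictMono_int_of_lt_succ hx.lt

theorem add_mul (k m : ℤ) : x (k + m * N) = x k + m * L := by
  -- The function `k ↦ x_k - kL/N` is `N`-periodic.
  have := periodic_add_mul (N := N) (f := fun k => x k - k / N * L) (fun k => by
    have : (N : ℝ) ≠ 0 := by have := hx.pos; positivity
    change x (k + N) - ((k + N : ℤ) : ℝ) / N * L = x k - (k : ℝ) / N * L
    rw [hx.periodic]; push_cast; field_simp; ring) k m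
  have hN : (N : ℝ) ≠ 0 := by have := hx.pos; positivity
  push_cast at this
  have h2 : ((k : ℝ) + m * N) / N * L = k / N * L + m * L := by field_simp
  linarith

theorem natCast_pos : (0 : ℝ) < N := by exact_mod_cast hx.pos

theorem gap_pos (k : ℤ) : 0 < x (k + 1) - x k := by linarith [hx.lt k]

theorem gap_periodic (k : ℤ) : x (k + N + 1) - x (k + N) = x (k + 1) - x k := by
  rw [show k + N + 1 = k + 1 + N by ring, hx.periodic, hx.periodic]; ring

theorem sum_gap : ∑ k ∈ Finset.Ico (0 : ℤ) N, (x (k + 1) - x k) = L := by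
  rw [sum_Ico_int_eq_sum_add hx.gap_periodic 0]
  have := Finset.sum_range_sub (fun i : ℕ => x (0 + i)) N
  have e : x (0 + (N : ℤ)) = x 0 + L := hx.periodic 0
  simp only [Nat.cast_add, Nat.cast_one, Nat.cast_zero, add_zero, e] at this
  simp only [add_assoc]
  linarith

theorem cell_periodic (k : ℤ) : configCell c N x (k + N) = configCell c N x k := by
  unfold configCell; rw [hx.gap_periodic]

theorem cell_pos (hc : 0 < c) (k : ℤ) : 0 < configCell c N x k := by
  unfold configCell
  have := hx.gap_pos k; have := hx.natCast_pos
  positivity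

theorem cell_mul_gap (k : ℤ) : configCell c N x k * (x (k + 1) - x k) = c / N := by
  unfold configCell
  have := hx.gap_pos k; have := hx.natCast_pos
  field_simp

theorem gap_eq (hc : 0 < c) (k : ℤ) : x (k + 1) - x k = c / (N * configCell c N x k) := by
  have h := hx.cell_mul_gap (c := c) k
  have := hx.cell_pos hc k; have := hx.natCast_pos
  rw [eq_div_iff (by positivity)]
  field_simp at h
  linarith

theorem exists_mem_cell (y : ℝ) : ∃ k, y ∈ Ico (x k) (x (k + 1)) := by
  have hL := hx.length_pos
  have hN := hx.natCast_pos
  obtain ⟨a, ha⟩ : ∃ a : ℤ, x a ≤ y := by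
    refine ⟨0 + ⌊(y - x 0) / L⌋ * N, ?_⟩
    rw [hx.add_mul]
    have := Int.floor_le ((y - x 0) / L)
    rw [le_div_iff₀ hL] at this
    linarith
  obtain ⟨b, hb⟩ : ∃ b : ℤ, y < x b := by
    refine ⟨0 + (⌊(y - x 0) / L⌋ + 1) * N, ?_⟩
    rw [hx.add_mul]
    have := Int.lt_floor_add_one ((y - x 0) / L)
    rw [div_lt_iff₀ hL] at this
    push_cast
    linarith
  obtain ⟨k, hk, hmax⟩ := Int.exists_greatest_of_bdd (P := fun k => x k ≤ y)
    ⟨b, fun z hz => (hx.strictMono.lt_iff_lt.1 (lt_of_le_of_lt hz hb)).le⟩ ⟨a, ha⟩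
  refine ⟨k, hk, ?_⟩
  by_contra hc
  have := hmax (k + 1) (not_lt.1 hc)
  omega

theorem cell_unique {y : ℝ} {k l : ℤ} (hk : y ∈ Ico (x k) (x (k + 1)))
    (hl : y ∈ Ico (x l) (x (l + 1))) : k = l := by
  have h1 := hx.strictMono.lt_iff_lt.1 (lt_of_le_of_lt hk.1 hl.2)
  have h2 := hx.strictMono.lt_iff_lt.1 (lt_of_le_of_lt hl.1 hk.2)
  omega

theorem density_eq {y : ℝ} {k : ℤ} (hk : y ∈ Ico (x k) (x (k + 1))) :
    configDensity c N x y = configCell c N x k := by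
  unfold configDensity
  rw [tsum_eq_single k, indicator_of_mem hk]
  intro l hl
  exact indicator_of_notMem (fun h => hl (hx.cell_unique h hk)) _

theorem density_periodic : Function.Periodic (configDensity c N x) L := fun y => by
  obtain ⟨k, hk⟩ := hx.exists_mem_cell y
  rw [hx.density_eq hk, hx.density_eq (k := k + N), hx.cell_periodic]
  rw [show k + N + 1 = k + 1 + N by ring, hx.periodic, hx.periodic]
  exact ⟨by linarith [hk.1], by linarith [hk.2]⟩

theorem density_pos (hc : 0 < c) (y : ℝ) : 0 < configDensity c N x y := by
  obtain ⟨k, hk⟩ := hx.exists_mem_cell y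
  rw [hx.density_eq hk]; exact hx.cell_pos hc k

theorem density_le {M : ℝ} (hM : ∀ k, configCell c N x k ≤ M) (y : ℝ) :
    configDensity c N x y ≤ M := by
  obtain ⟨k, hk⟩ := hx.exists_mem_cell y
  rw [hx.density_eq hk]; exact hM k

theorem measurable_density : Measurable (configDensity c N x) := by
  refine measurable_of_Iio fun a => ?_
  have : configDensity c N x ⁻¹' Iio a =
      ⋃ k : {k : ℤ // configCell c N x k < a}, Ico (x k) (x (k + 1)) := by
    ext y
    simp only [mem_preimage, mem_Iio, mem_iUnion, Subtype.exists, exists_prop]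
    constructor
    · intro h
      obtain ⟨k, hk⟩ := hx.exists_mem_cell y
      exact ⟨k, by rwa [hx.density_eq hk] at h, hk⟩
    · rintro ⟨k, h, hk⟩
      rwa [hx.density_eq hk]
  rw [this]
  exact MeasurableSet.iUnion fun k => measurableSet_Ico

theorem cell_integral_periodic (h : ℝ → ℝ) {G : ℝ → ℝ} (hGp : Function.Periodic G L) (k : ℤ) :
    h (configCell c N x (k + N)) * ∫ y in (x (k + N))..(x (k + N + 1)), G y =
      h (configCell c N x k) * ∫ y in (x k)..(x (k + 1)), G y := by
  rw [hx.cell_periodic, show k + N + 1 = k + 1 + N by ring, hx.periodic, hx.periodic]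
  congr 1
  have := intervalIntegral.integral_comp_add_right (a := x k) (b := x (k + 1)) G L
  rw [← this]
  exact intervalIntegral.integral_congr fun y _ => (hGp y)

/-- Integrals over a period split into the cells. -/
theorem integral_comp_density (h : ℝ → ℝ) {G : ℝ → ℝ}
    (hG : ∀ a b, IntervalIntegrable G volume a b)
    (hGp : Function.Periodic G L) :
    ∫ y in (-(L / 2))..(L / 2), h (configDensity c N x y) * G y =
      ∑ k ∈ Finset.Ico (0 : ℤ) N, h (configCell c N x k) * ∫ y in (x k)..(x (k + 1)), G y := by
  have hper : Function.Periodic (fun y => h (configDensity c N x y) * G y) L := fun y => by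
    simp only [hx.density_periodic y, hGp y]
  -- The period is moved to start at `x_0`, so that it consists of whole cells.
  have e1 := hper.intervalIntegral_add_eq (-(L / 2)) (x 0)
  rw [show -(L / 2) + L = L / 2 by ring] at e1
  rw [e1]
  have hcongr : ∀ k, ∀ y ∈ Ioo (x k) (x (k + 1)),
      h (configDensity c N x y) * G y = h (configCell c N x k) * G y := fun k y hy => by
    rw [hx.density_eq (Ioo_subset_Ico_self hy)]
  have hae : ∀ k, ∀ᵐ y, y ∈ uIoc (x k) (x (k + 1)) →
      h (configCell c N x k) * G y = h (configDensity c N x y) * G y := fun k => by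
    filter_upwards [Measure.ae_ne volume (x (k + 1))] with y hy hy2
    rw [uIoc_of_le (hx.lt k).le] at hy2
    exact (hcongr k y ⟨hy2.1, lt_of_le_of_ne hy2.2 hy⟩).symm
  have hint : ∀ k, IntervalIntegrable (fun y => h (configDensity c N x y) * G y) volume
      (x k) (x (k + 1)) := fun k => by
    have : IntervalIntegrable (fun y => h (configCell c N x k) * G y) volume (x k) (x (k + 1)) :=
      (hG _ _).const_mul _
    refine this.congr_ae ?_
    rw [EventuallyEq, ae_restrict_iff' measurableSet_uIoc]
    exact hae k
  have hsum := intervalIntegral.sum_integral_adjacent_intervals (μ := volume) (n := N)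
    (f := fun y => h (configDensity c N x y) * G y) (a := fun i : ℕ => x (0 + (i : ℤ)))
    (fun i _ => by
      have := hint (0 + (i : ℤ))
      rw [add_assoc] at this
      exact_mod_cast this)
  have e0 : x (0 + ((0 : ℕ) : ℤ)) = x 0 := by simp
  rw [e0, hx.periodic 0] at hsum
  rw [← hsum, sum_Ico_int_eq_sum_add _ 0]
  · refine Finset.sum_congr rfl fun i _ => ?_
    rw [← intervalIntegral.integral_const_mul, intervalIntegral.integral_congr_ae (hae _)]
    push_cast [add_assoc]
    rfl
  · exact hx.cell_integral_periodic h hGp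

theorem intervalIntegrable_mul_density {M : ℝ} (hc : 0 < c) (hM : ∀ k, configCell c N x k ≤ M)
    {G : ℝ → ℝ} (hG : Continuous G) (a b : ℝ) :
    IntervalIntegrable (fun y => configDensity c N x y * G y) volume a b := by
  refine (intervalIntegrable_const (c := M) |>.mono_fun
    (hx.measurable_density.aestronglyMeasurable) ?_).mul_continuousOn hG.continuousOn
  refine Eventually.of_forall fun y => ?_
  have h1 := hx.density_pos hc y; have h2 := hx.density_le hM y
  change ‖configDensity c N x y‖ ≤ ‖M‖
  rw [Real.norm_of_nonneg h1.le, Real.norm_of_nonneg (h1.le.trans h2)]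
  exact h2

theorem integral_density_mul {G : ℝ → ℝ} (hG : Continuous G) (hGp : Function.Periodic G L) :
    ∫ y in (-(L / 2))..(L / 2), configDensity c N x y * G y =
      ∑ k ∈ Finset.Ico (0 : ℤ) N, configCell c N x k * ∫ y in (x k)..(x (k + 1)), G y :=
  hx.integral_comp_density (fun r => r) (fun _ _ => hG.intervalIntegrable _ _) hGp

theorem integral_density : ∫ y in (-(L / 2))..(L / 2), configDensity c N x y = c := by
  have := hx.integral_density_mul (c := c) (G := fun _ => 1) continuous_const (fun _ => rfl)
  simp only [mul_one, intervalIntegral.integral_const, smul_eq_mul, hx.cell_mul_gap] at this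
  rw [this, sum_Ico_int_const]
  have := hx.natCast_pos
  field_simp

/-- A particle has the mass `c/N` of the cell to its right; spreading this mass over the cell moves
it by at most the width. -/
theorem abs_cell_integral_sub_le (hc : 0 < c) {G : ℝ → ℝ} {A : ℝ}
    (hG : ∀ y z, |G y - G z| ≤ A * |y - z|) (hGc : Continuous G) (k : ℤ) :
    |c / N * G (x k) - configCell c N x k * ∫ y in (x k)..(x (k + 1)), G y| ≤
      c / N * A * (x (k + 1) - x k) := by
  have hg := hx.gap_pos k
  have e : c / N * G (x k) - configCell c N x k * ∫ y in (x k)..(x (k + 1)), G y =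
      configCell c N x k * ∫ y in (x k)..(x (k + 1)), (G (x k) - G y) := by
    rw [intervalIntegral.integral_sub (by simp) (hGc.intervalIntegrable _ _), ← hx.cell_mul_gap k]
    simp only [intervalIntegral.integral_const, smul_eq_mul]
    ring
  have hA : 0 ≤ A := by
    have := (abs_nonneg _).trans (hG 1 0)
    simpa using this
  rw [e, abs_mul, abs_of_pos (hx.cell_pos hc k), ← hx.cell_mul_gap k]
  have := intervalIntegral.norm_integral_le_of_norm_le_const (a := x k) (b := x (k + 1))
    (f := fun y => G (x k) - G y) (C := A * (x (k + 1) - x k)) (fun y hy => by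
      rw [uIoc_of_le (hx.lt k).le] at hy
      refine (hG _ _).trans ?_
      gcongr
      rw [abs_sub_comm, abs_of_pos (by linarith [hy.1])]
      linarith [hy.2])
  rw [abs_of_pos hg, Real.norm_eq_abs] at this
  calc _ ≤ configCell c N x k * (A * (x (k + 1) - x k) * (x (k + 1) - x k)) :=
        mul_le_mul_of_nonneg_left this (hx.cell_pos hc k).le
    _ = _ := by ring

/-- The empirical measure is close to the piecewise constant density. -/
theorem abs_quadrature_le (hc : 0 < c) {G : ℝ → ℝ} {A : ℝ}
    (hG : ∀ y z, |G y - G z| ≤ A * |y - z|) (hGc : Continuous G) (hGp : Function.Periodic G L) :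
    |c / N * ∑ k ∈ Finset.Ico (0 : ℤ) N, G (x k) -
      ∫ y in (-(L / 2))..(L / 2), configDensity c N x y * G y| ≤ c / N * A * L := by
  rw [hx.integral_density_mul hGc hGp, Finset.mul_sum, ← Finset.sum_sub_distrib]
  calc _ ≤ ∑ k ∈ Finset.Ico (0 : ℤ) N, c / N * A * (x (k + 1) - x k) :=
        (Finset.abs_sum_le_sum_abs _ _).trans
          (Finset.sum_le_sum fun k _ => hx.abs_cell_integral_sub_le hc hG hGc k)
    _ = _ := by rw [← Finset.mul_sum, hx.sum_gap]

/-- The oscillation of cell values over an interval is controlled by the jumps in it. -/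
theorem abs_cell_sub_le_of_lt {a : ℤ → ℝ} (ha : ∀ k, a (k + N) = a k) {I : Set ℝ}
    (hI : I.OrdConnected) (hIL : I ⊆ Ico (-(L / 2)) (L / 2)) {y z : ℝ} (hy : y ∈ I) (hz : z ∈ I)
    {k l : ℤ} (hk : y ∈ Ico (x k) (x (k + 1))) (hl : z ∈ Ico (x l) (x (l + 1))) (hkl : k ≤ l) :
    |a l - a k| ≤ ∑ j ∈ Finset.Ico (0 : ℤ) N,
      I.indicator (fun _ => |a j - a (j - 1)|) (torusRep L (x j)) := by
  -- The particles with index in `(k, l]` lie between `y` and `z`, hence in `I`; the difference of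
  -- the two values telescopes over the jumps at these particles.
  have hmem : ∀ j, k < j → j ≤ l → x j ∈ I := fun j h1 h2 => by
    refine hI.out hy hz ⟨hk.2.le.trans (hx.strictMono.monotone ?_),
      (hx.strictMono.monotone h2).trans hl.1⟩
    omega
  -- Since `I` is no longer than a period, at most `N` consecutive jumps occur and each is counted
  -- once in the sum over a period.
  have hln : l < k + 1 + N := by
    by_contra hc
    push Not at hc
    have h1 := hx.strictMono.monotone hc
    rw [hx.periodic] at h1
    have := (hIL hy).1; have := (hIL hz).2
    linarith [hk.2, hl.1]
  have tele : ∀ m : ℕ, a (k + m) - a k = ∑ j ∈ Finset.Ico (k + 1) (k + 1 + m), (a j - a (j - 1)) := by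
    intro m
    induction m with
    | zero => simp
    | succ m ih =>
      have : Finset.Ico (k + 1) (k + 1 + ((m + 1 : ℕ) : ℤ)) =
          insert (k + 1 + (m : ℤ)) (Finset.Ico (k + 1) (k + 1 + m)) := by
        ext j; simp; omega
      rw [this, Finset.sum_insert (by simp), ← ih]
      push_cast
      rw [show k + ((m : ℤ) + 1) = k + 1 + m by ring, show k + 1 + (m : ℤ) - 1 = k + m by ring]
      ring
  have hm := tele (l - k).toNat
  rw [show k + ((l - k).toNat : ℤ) = l by omega] at hm
  rw [hm]
  have hp : ∀ j, I.indicator (fun _ => |a (j + N) - a (j + N - 1)|) (torusRep L (x (j + N))) =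
      I.indicator (fun _ => |a j - a (j - 1)|) (torusRep L (x j)) := fun j => by
    rw [hx.periodic, torusRep_periodic hx.length_pos, ha, show j + N - 1 = j - 1 + N by ring, ha]
  have := sum_Ico_int_shift (N := N)
    (f := fun j => I.indicator (fun _ => |a j - a (j - 1)|) (torusRep L (x j))) hp (k + 1)
  rw [← this]
  refine (Finset.abs_sum_le_sum_abs _ _).trans ?_
  have hsub : Finset.Ico (k + 1) (k + 1 + ((l - k).toNat : ℤ)) ⊆
      Finset.Ico (k + 1) (k + 1 + (N : ℤ)) := by
    intro j hj; simp at hj ⊢; omega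
  refine (Finset.sum_le_sum fun j hj => ?_).trans
    (Finset.sum_le_sum_of_subset_of_nonneg hsub fun j _ _ => indicator_nonneg (by simp) _)
  simp only [Finset.mem_Ico] at hj
  have hj2 := hmem j (by omega) (by omega)
  rw [torusRep_eq_self hx.length_pos (hIL hj2), indicator_of_mem hj2]

theorem abs_comp_density_sub_le (φ : ℝ → ℝ) {I : Set ℝ}
    (hI : I.OrdConnected) (hIL : I ⊆ Ico (-(L / 2)) (L / 2)) {y z : ℝ} (hy : y ∈ I) (hz : z ∈ I) :
    |φ (configDensity c N x y) - φ (configDensity c N x z)| ≤ ∑ j ∈ Finset.Ico (0 : ℤ) N,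
      I.indicator (fun _ => |φ (configCell c N x j) - φ (configCell c N x (j - 1))|)
        (torusRep L (x j)) := by
  obtain ⟨k, hk⟩ := hx.exists_mem_cell y
  obtain ⟨l, hl⟩ := hx.exists_mem_cell z
  rw [hx.density_eq hk, hx.density_eq hl]
  have ha : ∀ k, (fun k => φ (configCell c N x k)) (k + N) = (fun k => φ (configCell c N x k)) k :=
    fun k => by simp only [hx.cell_periodic]
  rcases le_total k l with h | h
  · rw [abs_sub_comm]
    exact hx.abs_cell_sub_le_of_lt (a := fun k => φ (configCell c N x k)) ha hI hIL hy hz hk hl h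
  · exact hx.abs_cell_sub_le_of_lt (a := fun k => φ (configCell c N x k)) ha hI hIL hz hy hl hk h

/-- Any two cell values differ by at most the total variation over a period. -/
theorem cell_sub_le_sum {a : ℤ → ℝ} (ha : ∀ k, a (k + N) = a k) (k l : ℤ) :
    |a l - a k| ≤ ∑ j ∈ Finset.Ico (0 : ℤ) N, |a j - a (j - 1)| := by
  have hN : (0 : ℤ) < N := by exact_mod_cast hx.pos
  obtain ⟨m, hm⟩ : ∃ m : ℕ, (m : ℤ) < N ∧ a l = a (k + m) := by
    refine ⟨((l - k) % N).toNat, ?_, ?_⟩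
    · have := Int.emod_lt_of_pos (l - k) hN
      have := Int.emod_nonneg (l - k) hN.ne'
      omega
    · have := Int.emod_nonneg (l - k) hN.ne'
      rw [Int.toNat_of_nonneg this]
      have h2 := Int.mul_ediv_add_emod (l - k) N
      have : l = (k + (l - k) % N) + ((l - k) / N) * N := by linarith [mul_comm (N : ℤ) ((l - k) / N)]
      conv_lhs => rw [this]
      exact periodic_add_mul ha _ _
  have tele : ∀ m : ℕ, a (k + m) - a k = ∑ j ∈ Finset.Ico (k + 1) (k + 1 + m), (a j - a (j - 1)) := by
    intro m
    induction m with
    | zero => simp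
    | succ m ih =>
      have : Finset.Ico (k + 1) (k + 1 + ((m + 1 : ℕ) : ℤ)) =
          insert (k + 1 + (m : ℤ)) (Finset.Ico (k + 1) (k + 1 + m)) := by
        ext j; simp; omega
      rw [this, Finset.sum_insert (by simp), ← ih]
      push_cast
      rw [show k + ((m : ℤ) + 1) = k + 1 + m by ring, show k + 1 + (m : ℤ) - 1 = k + m by ring]
      ring
  rw [hm.2, tele]
  have hp : ∀ j, |a (j + N) - a (j + N - 1)| = |a j - a (j - 1)| := fun j => by
    rw [ha, show j + N - 1 = j - 1 + N by ring, ha]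
  rw [← sum_Ico_int_shift (f := fun j => |a j - a (j - 1)|) hp (k + 1)]
  refine (Finset.abs_sum_le_sum_abs _ _).trans
    (Finset.sum_le_sum_of_subset_of_nonneg ?_ fun j _ _ => abs_nonneg _)
  intro j hj; simp at hj ⊢; omega

/-- Some cell is at least as wide as the average. -/
theorem exists_cell_le (hc : 0 < c) : ∃ k, configCell c N x k ≤ c / L := by
  by_contra! hcon
  have hL := hx.length_pos
  have hN := hx.natCast_pos
  have h1 : ∀ k ∈ Finset.Ico (0 : ℤ) N, x (k + 1) - x k < L / N := fun k _ => by
    have h2 := hcon k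
    have h3 := hx.cell_mul_gap (c := c) k
    have hg := hx.gap_pos k
    have : c / L * (x (k + 1) - x k) < c / N := by nlinarith
    rw [div_mul_eq_mul_div, div_lt_div_iff₀ hL hN] at this
    rw [lt_div_iff₀ hN]
    by_contra hh
    push Not at hh
    nlinarith
  have hne : (Finset.Ico (0 : ℤ) N).Nonempty := ⟨0, by simp; exact hx.pos⟩
  have := Finset.sum_lt_sum_of_nonempty hne h1
  rw [hx.sum_gap, sum_Ico_int_const] at this
  field_simp at this
  linarith

/-- The interaction forces on the two ends of a cell of minimal width are close. -/
theorem abs_sum_slope_sub_le {K : ℝ → ℝ} {B C : ℝ} (hk : SlopeBound (deriv K) B C)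
    {κ : ℤ → ℤ → ℝ} (hκ : ∀ k j, κ k j ∈ torusSlope K L (x k - x j))
    (hκp : ∀ k j, κ k (j + N) = κ k j) {k : ℤ}
    (hmin : ∀ j, x (k + 1) - x k ≤ x (j + 1) - x j) :
    |∑ j ∈ Finset.Ico (0 : ℤ) N, κ (k + 1) j - ∑ j ∈ Finset.Ico (0 : ℤ) N, κ k j| ≤
      C * N * (x (k + 1) - x k) + 8 * B := by
  have hL := hx.length_pos
  have hg := hx.gap_pos k
  have hB := hk.bound_nonneg
  obtain ⟨p, hp⟩ := hx.exists_mem_cell (x k - L / 2)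
  rw [← sum_Ico_int_shift (hκp (k + 1)) (k - N + 1), ← sum_Ico_int_shift (hκp k) (k - N + 1),
    ← Finset.sum_sub_distrib]
  -- The slope generated by `x_j` jumps at `x_j` and at its antipode. For `j` from `k - N + 1` to
  -- `k`, a jump of the first kind can touch the closed cell `k` only for `j = k` and for `j = k - N
  -- + 1`, a copy of `k + 1`. Shifted by `-L/2`, the cell begins in cell `p` and, being minimal, is
  -- no wider than cell `p + 1`, so the second kind leaves only `p` and `p + 1`. Four exceptional
  -- indices at `2B` each give `8B`.
  let bad : Finset ℤ := {k, k - N + 1, p, p + 1}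
  have hterm : ∀ j ∈ Finset.Ico (k - N + 1) (k - N + 1 + N), |κ (k + 1) j - κ k j| ≤
      C * (x (k + 1) - x k) + if j ∈ bad then 2 * B else 0 := by
    intro j hj
    simp only [Finset.mem_Ico] at hj
    split_ifs with hb
    · have h1 := abs_sub (κ (k + 1) j) (κ k j)
      have h2 := abs_le_of_mem_torusSlope hk (hκ (k + 1) j)
      have h3 := abs_le_of_mem_torusSlope hk (hκ k j)
      have := mul_nonneg hk.lip_nonneg hg.le
      linarith
    · simp only [bad, Finset.mem_insert, Finset.mem_singleton, not_or] at hb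
      obtain ⟨b1, b2, b3, b4⟩ := hb
      have hjk : x j < x k := hx.strictMono (by omega)
      have hjN : x (k + 1) < x j + L := by
        rw [← hx.periodic]; exact hx.strictMono (by omega)
      have hout : x j < x k - L / 2 ∨ x (k + 1) - L / 2 < x j := by
        rcases lt_or_ge j p with h | h
        · left; exact (hx.strictMono h).trans_le hp.1
        · right
          have h2 : x (p + 2) ≤ x j := hx.strictMono.monotone (by omega)
          have h3 := hmin (p + 1)
          rw [show p + 1 + 1 = p + 2 by ring] at h3
          linarith [hp.2]
      have := torusSlope_sub_le hk hL (hκ (k + 1) j) (hκ k j) (by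
        rcases hout with h | h
        · right; refine ⟨?_, ?_, ?_, ?_⟩ <;> linarith
        · left; refine ⟨?_, ?_, ?_, ?_⟩ <;> linarith)
      rw [show x (k + 1) - x j - (x k - x j) = x (k + 1) - x k by ring, abs_of_pos hg] at this
      linarith
  refine (Finset.abs_sum_le_sum_abs _ _).trans ((Finset.sum_le_sum hterm).trans ?_)
  rw [Finset.sum_add_distrib]
  have h1 : ∑ _j ∈ Finset.Ico (k - N + 1) (k - N + 1 + N), C * (x (k + 1) - x k) =
      C * N * (x (k + 1) - x k) := by
    rw [Finset.sum_const, Int.card_Ico]; simp; ring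
  have h2 : ∑ j ∈ Finset.Ico (k - N + 1) (k - N + 1 + N), (if j ∈ bad then 2 * B else 0) ≤
      8 * B := by
    rw [← Finset.sum_filter, Finset.sum_const, nsmul_eq_mul]
    have hcard : (((Finset.Ico (k - N + 1) (k - N + 1 + N)).filter (· ∈ bad)).card : ℝ) ≤ 4 := by
      have h3 : ((Finset.Ico (k - N + 1) (k - N + 1 + N)).filter (· ∈ bad)).card ≤ bad.card :=
        Finset.card_le_card fun j hj => (Finset.mem_filter.1 hj).2
      have h4 : bad.card ≤ 4 := Finset.card_le_four
      exact_mod_cast h3.trans h4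
    nlinarith
  linarith

end IsConfig

end AggDiff

end

noncomputable section

namespace AggDiff

/-! ### The diffusion -/

namespace AdmissibleDiffusion

variable {W φ : ℝ → ℝ} (hφ : AdmissibleDiffusion W φ)
include hφ

theorem nonneg {r : ℝ} (hr : 0 ≤ r) : 0 ≤ φ r := by
  rw [← hφ.zero]; exact hφ.strictMono.monotoneOn self_mem_Ici hr hr

theorem mono {r s : ℝ} (hr : 0 ≤ r) (h : r ≤ s) : φ r ≤ φ s :=
  hφ.strictMono.monotoneOn hr (hr.trans h) h

theorem exists_lipschitz (M : ℝ) : ∃ A, 0 ≤ A ∧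
    ∀ r ∈ Icc 0 M, ∀ s ∈ Icc 0 M, |φ r - φ s| ≤ A * |r - s| := by
  obtain ⟨A, hA⟩ := (hφ.contDiffOn.mono Icc_subset_Ici_self).exists_lipschitzOnWith (by norm_num)
    (convex_Icc 0 M) isCompact_Icc
  refine ⟨A, A.2, fun r hr s hs => ?_⟩
  simpa [Real.dist_eq] using hA.dist_le_mul r hr s hs

/-- The derivative of `W(r)/r` is `φ(r)/r² ≥ 0`. As `W(r)/r` is the energy per unit mass at density
`r`, this bounds the initial energy by the mass and the supremum of the datum. -/
theorem energy_div_mono {r s : ℝ} (hr : 0 < r) (h : r ≤ s) : W r / r ≤ W s / s := by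
  have hd : ∀ y ∈ Ioi (0 : ℝ), HasDerivAt (fun y => W y / y) (φ y / y ^ 2) y := fun y hy => by
    have hy0 : y ≠ 0 := ne_of_gt hy
    have := (hφ.differentiable y hy).hasDerivAt.div (hasDerivAt_id y) hy0
    refine this.congr_deriv ?_
    rw [hφ.eq y hy]; simp; ring
  have hm : MonotoneOn (fun y => W y / y) (Ioi 0) := by
    refine monotoneOn_of_deriv_nonneg (convex_Ioi 0)
      (fun y hy => (hd y hy).continuousAt.continuousWithinAt)
      (fun y hy => by
        rw [interior_Ioi] at hy; exact (hd y hy).differentiableAt.differentiableWithinAt)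
      (fun y hy => ?_)
    rw [interior_Ioi] at hy
    rw [(hd y hy).deriv]
    have := hφ.nonneg (le_of_lt hy)
    positivity
  exact hm hr (hr.trans_le h) h

/-- The energy of a cell of mass `a` as a function of its width. -/
theorem hasDerivAt_cellEnergy {a g : ℝ} (ha : 0 < a) (hg : 0 < g) :
    HasDerivAt (fun g => g * W (a / g)) (-φ (a / g)) g := by
  have hr : 0 < a / g := by positivity
  have h1 : HasDerivAt (fun g => a / g) (-a / g ^ 2) g := by
    have := (hasDerivAt_const g a).div (hasDerivAt_id g) hg.ne'
    refine this.congr_deriv ?_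
    simp
  have h2 := (hasDerivAt_id g).mul ((hφ.differentiable _ hr).hasDerivAt.comp g h1)
  refine h2.congr_deriv ?_
  rw [hφ.eq _ hr]; simp; field_simp; ring

theorem cellEnergy_lipschitz {a g₀ : ℝ} (ha : 0 < a) (hg₀ : 0 < g₀) {g h : ℝ}
    (hg : g₀ ≤ g) (hh : g₀ ≤ h) :
    |g * W (a / g) - h * W (a / h)| ≤ φ (a / g₀) * |g - h| := by
  have := Convex.norm_image_sub_le_of_norm_hasDerivWithin_le (f := fun g => g * W (a / g))
    (s := Ici g₀) (C := φ (a / g₀)) (f' := fun g => -φ (a / g))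
    (fun y hy => (hφ.hasDerivAt_cellEnergy ha (hg₀.trans_le hy)).hasDerivWithinAt)
    (fun y hy => by
      have hy0 : 0 < y := hg₀.trans_le hy
      rw [norm_neg, Real.norm_of_nonneg (hφ.nonneg (by positivity))]
      refine hφ.mono (by positivity) ?_
      exact div_le_div_of_nonneg_left ha.le hg₀ hy) (convex_Ici g₀) (mem_Ici.2 hh) (mem_Ici.2 hg)
  simpa [Real.norm_eq_abs] using this

end AdmissibleDiffusion

/-! ### Initial data -/

/-- Positive integrable data with prescribed bounds on the mass and on the supremum. -/
structure IsDatum (q : ℝ → ℝ) (m M : ℝ) : Prop where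
  integrable : Integrable q
  pos : ∀ᵐ x, 0 < q x
  le : ∀ᵐ x, q x ≤ M
  mass : ∫ x, q x ≤ m

namespace IsDatum

variable {q : ℝ → ℝ} {m M : ℝ} (hq : IsDatum q m M)
include hq

theorem integral_pos {a b : ℝ} (hab : a < b) : 0 < ∫ u in a..b, q u := by
  rw [intervalIntegral.integral_pos_iff_support_of_nonneg_ae (hq.pos.mono fun x hx => hx.le)
    hq.integrable.intervalIntegrable]
  refine ⟨hab, ?_⟩
  have h : (volume (Function.support q ∩ Ioc a b)) = volume (Ioc a b) := by
    refine measure_congr ?_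
    filter_upwards [hq.pos] with x hx
    apply propext
    exact ⟨fun h => h.2, fun h => ⟨hx.ne', h⟩⟩
  rw [h, Real.volume_Ioc]; simpa using hab

theorem cellMass_pos {L : ℝ} (hL : 0 < L) : 0 < cellMass q L := hq.integral_pos (by linarith)

theorem cellMass_le {L : ℝ} (hL : 0 < L) : cellMass q L ≤ m := by
  refine le_trans ?_ hq.mass
  unfold cellMass
  rw [intervalIntegral.integral_of_le (by linarith)]
  exact setIntegral_le_integral hq.integrable (hq.pos.mono fun x hx => hx.le)

theorem integral_le {a b : ℝ} (hab : a ≤ b) : ∫ u in a..b, q u ≤ M * (b - a) := by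
  have := intervalIntegral.integral_mono_ae (μ := volume) hab hq.integrable.intervalIntegrable
    (g := fun _ => M) (by simp) hq.le
  simpa [mul_comm] using this

theorem cdf_strictMono (a : ℝ) : StrictMono fun y => ∫ u in a..y, q u := by
  intro y z hyz
  have := intervalIntegral.integral_add_adjacent_intervals
    (hq.integrable.intervalIntegrable (a := a) (b := y))
    (hq.integrable.intervalIntegrable (a := y) (b := z))
  have := hq.integral_pos hyz
  simp only; linarith

theorem cdf_continuous (a : ℝ) : Continuous fun y => ∫ u in a..y, q u :=
  hq.integrable.continuous_primitive a

theorem pos_bound : 0 < M := by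
  obtain ⟨x, h1, h2⟩ := (hq.pos.and hq.le).exists
  linarith

theorem exists_quantile {L : ℝ} (hL : 0 < L) {a : ℝ} (ha : 0 ≤ a) (ha2 : a ≤ cellMass q L) :
    ∃ z ∈ Icc (-(L / 2)) (L / 2), ∫ u in (-(L / 2))..z, q u = a := by
  have := intermediate_value_Icc (a := -(L / 2)) (b := L / 2) (by linarith)
    (hq.cdf_continuous (-(L / 2))).continuousOn
  exact this ⟨by simpa using ha, ha2⟩

theorem isLUB_quantile {L : ℝ} {a p z : ℝ} (hz : z ∈ Icc (-(L / 2)) (L / 2))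
    (hz0 : -(L / 2) < z)
    (h : ∫ u in (-(L / 2))..z, q u = (∫ u in (-(L / 2))..p, q u) + a) :
    IsLUB {y | y ∈ Icc (-(L / 2)) (L / 2) ∧ ∫ u in p..y, q u < a} z := by
  have hs : {y | y ∈ Icc (-(L / 2)) (L / 2) ∧ ∫ u in p..y, q u < a} = Ico (-(L / 2)) z := by
    ext y
    have h1 := intervalIntegral.integral_add_adjacent_intervals
      (hq.integrable.intervalIntegrable (a := -(L / 2)) (b := p))
      (hq.integrable.intervalIntegrable (a := p) (b := y))
    have h2 : ∫ u in p..y, q u < a ↔ y < z := by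
      have h3 := (hq.cdf_strictMono (-(L / 2))).lt_iff_lt (a := y) (b := z)
      rw [← h3, ← h1, h]
      constructor <;> intro <;> linarith
    simp only [mem_ofPred_eq, h2, mem_Icc, mem_Ico]
    exact ⟨fun h => ⟨h.1.1, h.2⟩, fun h => ⟨⟨h.1, h.2.le.trans hz.2⟩, h.2⟩⟩
  rw [hs]
  exact isLUB_Ico hz0

end IsDatum

/-! ### Forces and dissipation -/

/-- The contribution of the diffusion to the velocity of a particle, up to sign. -/
def configForce (φ : ℝ → ℝ) (c : ℝ) (N : ℕ) (x : ℤ → ℝ) (k : ℤ) : ℝ :=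
  N / c * (φ (configCell c N x k) - φ (configCell c N x (k - 1)))

/-- The dissipation due to the diffusion. -/
def dissipation (φ : ℝ → ℝ) (c : ℝ) (N : ℕ) (x : ℤ → ℝ) : ℝ :=
  c / N * ∑ k ∈ Finset.Ico (0 : ℤ) N, configForce φ c N x k ^ 2

namespace IsConfig

variable {N : ℕ} {L c : ℝ} {x : ℤ → ℝ} (hx : IsConfig N L x)
include hx

theorem force_periodic (φ : ℝ → ℝ) (k : ℤ) :
    configForce φ c N x (k + N) = configForce φ c N x k := by
  unfold configForce
  rw [hx.cell_periodic, show k + N - 1 = k - 1 + N by ring, hx.cell_periodic]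

theorem sub_eq_force (hc : 0 < c) (φ : ℝ → ℝ) (k : ℤ) :
    φ (configCell c N x k) - φ (configCell c N x (k - 1)) = c / N * configForce φ c N x k := by
  have := hx.natCast_pos
  unfold configForce; field_simp

/-- Young's inequality `|D| ≤ α + D²/α`, summed over the particles. The parameter is `1` for the
total variation and the moment, and large for displacements over short times. -/
theorem sum_abs_force_le (hc : 0 < c) (φ : ℝ → ℝ) {α : ℝ} (hα : 0 < α) :
    c / N * ∑ k ∈ Finset.Ico (0 : ℤ) N, |configForce φ c N x k| ≤
      c * α + dissipation φ c N x / α := by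
  have hN := hx.natCast_pos
  have h : ∀ k ∈ Finset.Ico (0 : ℤ) N, |configForce φ c N x k| ≤
      α + configForce φ c N x k ^ 2 / α := fun k _ => by
    rw [← sq_abs (configForce φ c N x k)]
    have h0 := abs_nonneg (configForce φ c N x k)
    set d := |configForce φ c N x k|
    have : α + d ^ 2 / α - d = ((d - α / 2) ^ 2 + 3 / 4 * α ^ 2) / α := by field_simp; ring
    have : 0 ≤ ((d - α / 2) ^ 2 + 3 / 4 * α ^ 2) / α := by positivity
    linarith
  have h2 := Finset.sum_le_sum h
  rw [Finset.sum_add_distrib, sum_Ico_int_const, ← Finset.sum_div] at h2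
  calc _ ≤ c / N * (N * α + (∑ k ∈ Finset.Ico (0 : ℤ) N, configForce φ c N x k ^ 2) / α) :=
        mul_le_mul_of_nonneg_left h2 (by positivity)
    _ = _ := by unfold dissipation; field_simp

theorem sum_abs_sub_eq (hc : 0 < c) (φ : ℝ → ℝ) :
    ∑ k ∈ Finset.Ico (0 : ℤ) N, |φ (configCell c N x k) - φ (configCell c N x (k - 1))| =
      c / N * ∑ k ∈ Finset.Ico (0 : ℤ) N, |configForce φ c N x k| := by
  have := hx.natCast_pos
  rw [Finset.mul_sum]
  refine Finset.sum_congr rfl fun k _ => ?_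
  rw [hx.sub_eq_force hc, abs_mul, abs_of_pos (by positivity)]

theorem dissipation_nonneg (hc : 0 < c) (φ : ℝ → ℝ) : 0 ≤ dissipation φ c N x := by
  have := hx.natCast_pos
  unfold dissipation; positivity

theorem sum_abs_sub_le (hc : 0 < c) (φ : ℝ → ℝ) :
    ∑ k ∈ Finset.Ico (0 : ℤ) N, |φ (configCell c N x k) - φ (configCell c N x (k - 1))| ≤
      c + dissipation φ c N x := by
  rw [hx.sum_abs_sub_eq hc]
  simpa using hx.sum_abs_force_le hc φ one_pos

/-- The maximal density is controlled by the dissipation. -/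
theorem cell_le {W φ : ℝ → ℝ} (hφ : AdmissibleDiffusion W φ) (hc : 0 < c) {M c₂ r₂ : ℝ}
    (hM : c / L ≤ M) (hc₂ : 0 < c₂) (hr₂ : 0 ≤ r₂) (hlarge : ∀ r, r₂ ≤ r → c₂ * r ≤ φ r) (k : ℤ) :
    configCell c N x k ≤ r₂ + (φ M + c + dissipation φ c N x) / c₂ := by
  have hL := hx.length_pos
  -- Some cell has at most the mean density `c/L ≤ M`. Elsewhere `φ` exceeds its value there by at
  -- most the total variation, and the linear growth of `φ` at infinity turns this into a bound of
  -- the density that is affine in the dissipation.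
  obtain ⟨l, hl⟩ := hx.exists_cell_le hc
  have h1 := hx.cell_sub_le_sum (a := fun k => φ (configCell c N x k))
    (fun k => by simp only [hx.cell_periodic]) l k
  have h2 := hx.sum_abs_sub_le hc φ
  have h3 := hφ.mono (hx.cell_pos hc l).le (hl.trans hM)
  have h4 := (abs_le.1 h1).2
  have h5 : 0 ≤ φ M := hφ.nonneg (le_trans (by positivity) hM)
  have h6 := hx.dissipation_nonneg hc φ
  rcases le_total (configCell c N x k) r₂ with h | h
  · have : 0 ≤ (φ M + c + dissipation φ c N x) / c₂ := by positivity
    linarith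
  · have h7 := hlarge _ h
    have : configCell c N x k ≤ (φ M + c + dissipation φ c N x) / c₂ := by
      rw [le_div_iff₀ hc₂]; linarith
    linarith

end IsConfig

/-! ### Basic properties of particle evolutions -/

namespace IsParticleEvolution

variable {K φ q : ℝ → ℝ} {T L : ℝ} {N : ℕ} {x : ℤ → ℝ → ℝ}

theorem pos (hE : IsParticleEvolution K φ T L q N x) (hT : 0 < T) (hL : 0 < L) : 0 < N := by
  rcases Nat.eq_zero_or_pos N with h | h
  · have := hE.periodic 0 0 ⟨le_rfl, hT.le⟩
    rw [h] at this; simp at this; linarith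
  · exact h

theorem isConfig (hE : IsParticleEvolution K φ T L q N x) (hT : 0 < T) (hL : 0 < L) {t : ℝ}
    (ht : t ∈ Icc 0 T) : IsConfig N L (fun k => x k t) :=
  ⟨hE.pos hT hL, hL, fun k => hE.periodic k t ht, fun k => hE.ordered k t ht⟩

theorem continuousOn (hE : IsParticleEvolution K φ T L q N x) (hT : 0 < T) (k : ℤ) :
    ContinuousOn (x k) (Icc 0 T) := by
  have := (hE.absolutelyContinuous k).continuousOn
  rwa [uIcc_of_le hT.le] at this

/-- By induction, the supremum defining `x_k(0)` is the unique point at which the mass has grown by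
`c/N` since the previous particle; so `x_k(0)` is a quantile. The case `k = N` comes from
periodicity. -/
theorem initial_mass {m M : ℝ} (hE : IsParticleEvolution K φ T L q N x) (hT : 0 < T) (hL : 0 < L)
    (hq : IsDatum q m M) (k : ℕ) (hk : k ≤ N) : x k 0 ∈ Icc (-(L / 2)) (L / 2) ∧
      ∫ u in (-(L / 2))..(x k 0), q u = k * (cellMass q L / N) := by
  have hN := hE.pos hT hL
  have hN' : (0 : ℝ) < N := by exact_mod_cast hN
  have hc := hq.cellMass_pos hL
  rcases eq_or_lt_of_le hk with rfl | hk
  · have := hE.periodic 0 0 ⟨le_rfl, hT.le⟩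
    rw [zero_add, hE.initial_zero] at this
    rw [this, show -(L / 2) + L = L / 2 by ring]
    refine ⟨⟨by linarith, le_rfl⟩, ?_⟩
    change cellMass q L = _
    field_simp
  induction k with
  | zero => simp [hE.initial_zero]; linarith
  | succ k ih =>
    obtain ⟨h1, h2⟩ := ih (by omega) (by omega)
    have hlub := hE.initial (k + 1 : ℕ) (by push_cast; omega) (by exact_mod_cast hk)
    have hle : ((k + 1 : ℕ) : ℝ) * (cellMass q L / N) ≤ cellMass q L := by
      rw [mul_div_assoc', div_le_iff₀ hN', mul_comm]
      gcongr
    obtain ⟨z, hz, hzq⟩ := hq.exists_quantile hL (a := (k + 1 : ℕ) * (cellMass q L / N))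
      (by positivity) hle
    have hz0 : -(L / 2) < z := by
      rw [← (hq.cdf_strictMono (-(L / 2))).lt_iff_lt]
      simp only [intervalIntegral.integral_same, hzq]
      positivity
    have := hq.isLUB_quantile (p := x k 0) (a := cellMass q L / N) hz hz0 (by
      rw [hzq, h2]; push_cast; ring)
    have e : x ((k + 1 : ℕ) : ℤ) 0 = z := by
      refine hlub.unique ?_
      rw [show ((k + 1 : ℕ) : ℤ) - 1 = (k : ℤ) by push_cast; ring]
      exact this
    rw [e]
    exact ⟨hz, hzq⟩

theorem initial_cell {m M : ℝ} (hE : IsParticleEvolution K φ T L q N x) (hT : 0 < T) (hL : 0 < L)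
    (hq : IsDatum q m M) (k : ℕ) (hk : k < N) :
    ∫ u in (x k 0)..(x (k + 1 : ℤ) 0), q u = cellMass q L / N := by
  have h1 := hE.initial_mass hT hL hq k hk.le
  have h2 := hE.initial_mass hT hL hq (k + 1) hk
  have h3 := intervalIntegral.integral_add_adjacent_intervals
    (hq.integrable.intervalIntegrable (a := -(L / 2)) (b := x k 0))
    (hq.integrable.intervalIntegrable (a := x k 0) (b := x (k + 1 : ℤ) 0))
  have h4 := h2.2
  push_cast at h4
  rw [h1.2, h4] at h3
  linarith

/-- Each initial cell contains mass `c/N` of a density that is at most `M`. -/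
theorem initial_gap_ge {m M : ℝ} (hE : IsParticleEvolution K φ T L q N x) (hT : 0 < T) (hL : 0 < L)
    (hq : IsDatum q m M) (k : ℤ) : cellMass q L / (N * M) ≤ x (k + 1) 0 - x k 0 := by
  have hx := hE.isConfig hT hL (t := 0) ⟨le_rfl, hT.le⟩
  have hN := hx.natCast_pos
  have hM := hq.pos_bound
  have hNz : (0 : ℤ) < N := by exact_mod_cast hx.pos
  obtain ⟨j, hj, e⟩ : ∃ j : ℕ, j < N ∧ x (k + 1) 0 - x k 0 = x ((j : ℤ) + 1) 0 - x j 0 := by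
    have h1 := Int.emod_lt_of_pos k hNz
    have h2 := Int.emod_nonneg k hNz.ne'
    refine ⟨(k % N).toNat, by omega, ?_⟩
    rw [Int.toNat_of_nonneg h2]
    have h3 := Int.mul_ediv_add_emod k N
    have h4 := periodic_add_mul (f := fun k => x (k + 1) 0 - x k 0) hx.gap_periodic (k % N) (k / N)
    rw [show k % N + k / N * N = k by linarith [mul_comm (N : ℤ) (k / N)]] at h4
    exact h4
  rw [e]
  have h1 := hE.initial_cell hT hL hq j hj
  have h2 := hq.integral_le (hx.lt j).le
  rw [h1] at h2
  rw [div_le_iff₀ (by positivity)]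
  rw [div_le_iff₀ hN] at h2
  linarith

/-- The form of the equation used below: it holds for all integer indices, the slopes are periodic
in `j`, and the sum is complete because antisymmetry makes the self-interaction vanish. Interior
times are singled out since the relation between `x_k` and its copy `x_{k % N}` has to hold in a
neighbourhood in order to be differentiated. -/
theorem ae_velocity (hE : IsParticleEvolution K φ T L q N x) (hT : 0 < T) (hL : 0 < L) :
    ∀ᵐ t ∂(volume.restrict (Icc 0 T)), t ∈ Ioo 0 T ∧ ∃ κ : ℤ → ℤ → ℝ,
      (∀ k j, κ k j ∈ torusSlope K L (x k t - x j t)) ∧ (∀ k j, κ j k = -κ k j) ∧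
      (∀ k j, κ k (j + N) = κ k j) ∧
      ∀ k, HasDerivAt (x k) (-(cellMass q L / N) * (∑ j ∈ Finset.Ico (0 : ℤ) N, κ k j)
        - configForce φ (cellMass q L) N (fun k => x k t) k) t := by
  have hIoo : ∀ᵐ t ∂(volume.restrict (Icc 0 T)), t ∈ Ioo 0 T := by
    filter_upwards [ae_restrict_mem measurableSet_Icc,
      (Measure.ae_ne volume (0 : ℝ)).filter_mono (ae_mono Measure.restrict_le_self),
      (Measure.ae_ne volume T).filter_mono (ae_mono Measure.restrict_le_self)] with t h1 h2 h3
    exact ⟨lt_of_le_of_ne h1.1 h2.symm, lt_of_le_of_ne h1.2 h3⟩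
  filter_upwards [hIoo, hE.ode] with t ht hode
  refine ⟨ht, ?_⟩
  obtain ⟨κ, h1, h2, h3⟩ := hode
  have hx := hE.isConfig hT hL (Ioo_subset_Icc_self ht)
  have hN : (0 : ℤ) < N := by exact_mod_cast hx.pos
  have hdecomp : ∀ k : ℤ, k % N + k / N * N = k := fun k => by
    have := Int.mul_ediv_add_emod k N; linarith [mul_comm (N : ℤ) (k / N)]
  have hxk : ∀ s ∈ Icc 0 T, ∀ k, x k s = x (k % N) s + ((k / N : ℤ) : ℝ) * L := fun s hs k => by
    have := (hE.isConfig hT hL hs).add_mul (k % N) (k / N)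
    rwa [hdecomp] at this
  refine ⟨fun k j => κ (k % N) (j % N), fun k j => ?_, fun k j => h2 _ _, fun k j => by simp,
    fun k => ?_⟩
  · have := h1 (k % N) (j % N)
    rw [hxk t (Ioo_subset_Icc_self ht) k, hxk t (Ioo_subset_Icc_self ht) j]
    have e : x (k % N) t + ((k / N : ℤ) : ℝ) * L - (x (j % N) t + ((j / N : ℤ) : ℝ) * L) =
        x (k % N) t - x (j % N) t + ((k / N - j / N : ℤ) : ℝ) * L := by push_cast; ring
    rw [e, torusSlope_congr hL]
    exact this
  · have hmem : k % N ∈ Finset.Ico (0 : ℤ) N := by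
      simp [Int.emod_nonneg k hN.ne', Int.emod_lt_of_pos k hN]
    have h4 := (h3 (k % N) hmem).add_const (((k / N : ℤ) : ℝ) * L)
    have h5 : HasDerivAt (x k) _ t := h4.congr_of_eventuallyEq (by
      filter_upwards [isOpen_Ioo.mem_nhds ht] with s hs
      exact hxk s (Ioo_subset_Icc_self hs) k)
    convert h5 using 1
    have e1 : ∑ j ∈ Finset.Ico (0 : ℤ) N, κ (k % N) (j % N) =
        ∑ j ∈ (Finset.Ico (0 : ℤ) N).erase (k % N), κ (k % N) j := by
      rw [← Finset.add_sum_erase _ _ hmem]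
      have h0 : κ (k % N) (k % N) = 0 := by have := h2 (k % N) (k % N); linarith
      rw [Int.emod_emod_of_dvd _ dvd_rfl, h0, zero_add]
      refine Finset.sum_congr rfl fun j hj => ?_
      have := Finset.mem_of_mem_erase hj
      simp only [Finset.mem_Ico] at this
      rw [Int.emod_eq_of_lt this.1 this.2]
    have e2 := periodic_add_mul (hx.force_periodic (c := cellMass q L) φ) (k % N) (k / N)
    rw [hdecomp] at e2
    rw [e1, e2]
    rfl

/-- A qualitative bound, by compactness of the time interval and finiteness of the number of cells.
It depends on the evolution and only serves to make singular functions of the widths, such as the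
logarithm, Lipschitz on the relevant range. -/
theorem exists_gap_ge (hE : IsParticleEvolution K φ T L q N x) (hT : 0 < T) (hL : 0 < L) :
    ∃ g, 0 < g ∧ ∀ t ∈ Icc 0 T, ∀ k, g ≤ x (k + 1) t - x k t := by
  have h1 : ∀ k : ℤ, ∃ g, 0 < g ∧ ∀ t ∈ Icc 0 T, g ≤ x (k + 1) t - x k t := fun k => by
    obtain ⟨s, hs, hmin⟩ := isCompact_Icc.exists_isMinOn (nonempty_Icc.2 hT.le)
      ((hE.continuousOn hT (k + 1)).sub (hE.continuousOn hT k))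
    exact ⟨_, sub_pos.2 (hE.ordered k s hs), fun t ht => hmin ht⟩
  choose g hg hg2 using h1
  have hN := hE.pos hT hL
  have hNz : (0 : ℤ) < N := by exact_mod_cast hN
  have hne : (Finset.Ico (0 : ℤ) N).Nonempty := ⟨0, by simpa using hN⟩
  refine ⟨(Finset.Ico (0 : ℤ) N).inf' hne g, by simpa using fun i _ _ => hg i, fun t ht k => ?_⟩
  have hx := hE.isConfig hT hL ht
  have h4 := periodic_add_mul (f := fun k => x (k + 1) t - x k t) hx.gap_periodic (k % N) (k / N)
  have h3 := Int.mul_ediv_add_emod k N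
  rw [show k % N + k / N * N = k by linarith [mul_comm (N : ℤ) (k / N)]] at h4
  rw [show x (k + 1) t - x k t = x (k % N + 1) t - x (k % N) t from h4]
  refine le_trans (Finset.inf'_le _ ?_) (hg2 (k % N) t ht)
  simp [Int.emod_nonneg k hNz.ne', Int.emod_lt_of_pos k hNz]

theorem absolutelyContinuous_comp_gap (hE : IsParticleEvolution K φ T L q N x) (hT : 0 < T)
    {g A : ℝ} (hg : ∀ t ∈ Icc 0 T, ∀ k, g ≤ x (k + 1) t - x k t) {h : ℝ → ℝ}
    (hA : 0 ≤ A) (hh : ∀ a b, g ≤ a → g ≤ b → |h a - h b| ≤ A * |a - b|) (k : ℤ) :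
    AbsolutelyContinuousOnInterval (fun t => h (x (k + 1) t - x k t)) 0 T := by
  refine absolutelyContinuous_of_le_sum (s := {k, k + 1}) (f := x)
    (fun i _ => hE.absolutelyContinuous i) A fun t ht u hu => ?_
  rw [uIcc_of_le hT.le] at ht hu
  rw [Finset.sum_pair (by omega)]
  refine (hh _ _ (hg t ht k) (hg u hu k)).trans ?_
  gcongr
  have := abs_sub (x (k + 1) t - x (k + 1) u) (x k t - x k u)
  rw [show x (k + 1) t - x k t - (x (k + 1) u - x k u) =
    x (k + 1) t - x (k + 1) u - (x k t - x k u) by ring]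
  linarith

theorem continuousOn_comp_cell {W : ℝ → ℝ} {a b : ℝ} (hφ : AdmissibleDiffusion W φ)
    (hE : IsParticleEvolution K φ T L q N x) (hT : 0 < T) (hL : 0 < L) (hq : IsDatum q a b)
    (k : ℤ) : ContinuousOn (fun t => φ (configCell (cellMass q L) N (fun k => x k t) k))
      (Icc 0 T) := by
  have hc := hq.cellMass_pos hL
  refine ContinuousOn.comp (t := Ici 0) hφ.contDiffOn.continuousOn ?_
    (fun t ht => ((hE.isConfig hT hL ht).cell_pos hc k).le)
  refine continuousOn_const.div (continuousOn_const.mul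
    ((hE.continuousOn hT (k + 1)).sub (hE.continuousOn hT k))) fun t ht => ?_
  have hx := hE.isConfig hT hL ht
  have := hx.gap_pos k; have := hx.natCast_pos
  positivity

theorem continuousOn_force {W : ℝ → ℝ} {a b : ℝ} (hφ : AdmissibleDiffusion W φ)
    (hE : IsParticleEvolution K φ T L q N x) (hT : 0 < T) (hL : 0 < L) (hq : IsDatum q a b)
    (k : ℤ) : ContinuousOn (fun t => configForce φ (cellMass q L) N (fun k => x k t) k)
      (Icc 0 T) :=
  continuousOn_const.mul ((continuousOn_comp_cell hφ hE hT hL hq k).sub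
    (continuousOn_comp_cell hφ hE hT hL hq (k - 1)))

theorem continuousOn_dissipation {W : ℝ → ℝ} {a b : ℝ} (hφ : AdmissibleDiffusion W φ)
    (hE : IsParticleEvolution K φ T L q N x) (hT : 0 < T) (hL : 0 < L) (hq : IsDatum q a b) :
    ContinuousOn (fun t => dissipation φ (cellMass q L) N (fun k => x k t)) (Icc 0 T) :=
  continuousOn_const.mul (continuousOn_finsetSum _ fun k _ =>
    (continuousOn_force hφ hE hT hL hq k).pow 2)

end IsParticleEvolution

end AggDiff

end

/-! ### A priori estimates, uniform in the number of particles and in the length of the torus. -/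

noncomputable section

namespace AggDiff

theorem abs_sup'_sub_sup'_le {ι : Type*} {s : Finset ι} (hs : s.Nonempty) (f g : ι → ℝ) :
    |s.sup' hs f - s.sup' hs g| ≤ ∑ i ∈ s, |f i - g i| := by
  have key : ∀ f g : ι → ℝ, s.sup' hs f - s.sup' hs g ≤ ∑ i ∈ s, |f i - g i| := fun f g => by
    obtain ⟨i, hi, e⟩ := s.exists_mem_eq_sup' hs f
    have h1 := s.le_sup' g hi
    have h2 := Finset.single_le_sum (f := fun i => |f i - g i|) (fun i _ => abs_nonneg _) hi
    have h3 := le_abs_self (f i - g i)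
    linarith
  rw [abs_le]
  constructor
  · have := key g f
    simp_rw [abs_sub_comm (g _)] at this
    linarith
  · exact key f g

namespace IsParticleEvolution

variable {K W φ q : ℝ → ℝ} {T L B C m M : ℝ} {N : ℕ} {x : ℤ → ℝ → ℝ}

theorem abs_interaction_le (hk : SlopeBound (deriv K) B C) {κ : ℤ → ℤ → ℝ} {x : ℤ → ℝ}
    (hκ : ∀ k j, κ k j ∈ torusSlope K L (x k - x j)) (k : ℤ) :
    |∑ j ∈ Finset.Ico (0 : ℤ) N, κ k j| ≤ N * B := by
  refine (Finset.abs_sum_le_sum_abs _ _).trans ?_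
  refine (Finset.sum_le_sum fun j _ => abs_le_of_mem_torusSlope hk (hκ k j)).trans ?_
  rw [sum_Ico_int_const]

/-- The energy estimate. -/
theorem integral_dissipation_le (hk : SlopeBound (deriv K) B C) (hφ : AdmissibleDiffusion W φ)
    (hE : IsParticleEvolution K φ T L q N x) (hT : 0 < T) (hL : 0 < L) (hq : IsDatum q m M) :
    ∫ t in 0..T, dissipation φ (cellMass q L) N (fun k => x k t) ≤
      2 * m * (W M / M) + m ^ 3 * B ^ 2 * T := by
  have hc := hq.cellMass_pos hL
  have hcm := hq.cellMass_le hL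
  have hM := hq.pos_bound
  have hN := (hE.isConfig hT hL ⟨le_rfl, hT.le⟩).natCast_pos
  set c := cellMass q L with hcdef
  obtain ⟨g, hg, hgap⟩ := hE.exists_gap_ge hT hL
  let e : ℝ → ℝ := fun g => g * W ((c / N) / g)
  have ha : 0 < c / N := by positivity
  -- The internal energy `∫ W(ρ)` over a period, written in terms of the widths of the cells.
  let E : ℝ → ℝ := fun t => ∑ k ∈ Finset.Ico (0 : ℤ) N, e (x (k + 1) t - x k t)
  have hEac : AbsolutelyContinuousOnInterval E 0 T := by
    refine absolutelyContinuous_of_le_sum (s := Finset.Ico (0 : ℤ) N)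
      (f := fun k t => e (x (k + 1) t - x k t)) (fun k _ =>
        hE.absolutelyContinuous_comp_gap hT hgap (A := φ (c / N / g))
        (hφ.nonneg (by positivity)) (fun a b h1 h2 => hφ.cellEnergy_lipschitz ha hg h1 h2) k) 1
      fun t _ u _ => ?_
    rw [one_mul, ← Finset.sum_sub_distrib]
    exact Finset.abs_sum_le_sum_abs _ _
  have hder : ∀ᵐ t ∂volume.restrict (Icc 0 T), deriv E t ≤
      c * (c * B) ^ 2 / 2 - dissipation φ c N (fun k => x k t) / 2 := by
    filter_upwards [hE.ae_velocity hT hL] with t ht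
    obtain ⟨htI, κ, h1, h2, h3, h4⟩ := ht
    have hx := hE.isConfig hT hL (Ioo_subset_Icc_self htI)
    set v : ℤ → ℝ := fun k => -(c / N) * (∑ j ∈ Finset.Ico (0 : ℤ) N, κ k j) -
      configForce φ c N (fun k => x k t) k with hv
    have h4' : ∀ k, HasDerivAt (x k) (v k) t := h4
    let D : ℤ → ℝ := fun k => configForce φ c N (fun k => x k t) k
    -- The slopes are known to be periodic in the second index only; antisymmetry transfers this to
    -- the first.
    have hvp : ∀ k, v (k + N) = v k := fun k => by
      simp only [hv, hx.force_periodic]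
      congr 3 with j
      rw [h2 j (k + N), h2 j k, h3]
    have hd : HasDerivAt E (∑ k ∈ Finset.Ico (0 : ℤ) N,
        -φ (configCell c N (fun k => x k t) k) * (v (k + 1) - v k)) t := by
      refine HasDerivAt.fun_sum fun k _ => ?_
      have := (hφ.hasDerivAt_cellEnergy ha (hx.gap_pos k)).comp t ((h4' (k + 1)).sub (h4' k))
      refine this.congr_deriv ?_
      unfold configCell
      rw [div_div]
    rw [hd.deriv]
    -- Summation by parts over a period: pressure against relative velocity becomes velocity against
    -- force.
    have hparts : ∑ k ∈ Finset.Ico (0 : ℤ) N,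
        -φ (configCell c N (fun k => x k t) k) * (v (k + 1) - v k) =
        ∑ k ∈ Finset.Ico (0 : ℤ) N, v k * (c / N * D k) := by
      have := sum_Ico_int_add_one (N := N)
        (f := fun k => φ (configCell c N (fun k => x k t) (k - 1)) * v k) (fun k => by
          rw [hvp, show k + N - 1 = k - 1 + N by ring, hx.cell_periodic])
      simp only [add_sub_cancel_right] at this
      have e1 : ∀ k, v k * (c / N * D k) = φ (configCell c N (fun k => x k t) k) * v k -
          φ (configCell c N (fun k => x k t) (k - 1)) * v k := fun k => by
        rw [← hx.sub_eq_force hc]; ring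
      simp_rw [e1]
      rw [Finset.sum_sub_distrib, ← this, ← Finset.sum_sub_distrib]
      exact Finset.sum_congr rfl fun k _ => by ring
    rw [hparts]
    have hterm : ∀ k ∈ Finset.Ico (0 : ℤ) N, v k * (c / N * D k) ≤
        c / N * ((c * B) ^ 2 / 2) - c / N * (D k ^ 2) / 2 := fun k _ => by
      have hA := abs_interaction_le (N := N) hk h1 k
      set S := ∑ j ∈ Finset.Ico (0 : ℤ) N, κ k j
      have hA2 : (c / N * S) ^ 2 ≤ (c * B) ^ 2 := by
        rw [← sq_abs]
        have : |c / N * S| ≤ c * B := by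
          rw [abs_mul, abs_of_pos ha]
          calc _ ≤ c / N * (N * B) := by gcongr
            _ = _ := by field_simp
        gcongr
      -- With `F` the interaction term, `v = -F - D` and `v D = -F D - D² ≤ F²/2 - D²/2`; half of
      -- the dissipation absorbs the interaction.
      have e2 : v k * D k ≤ (c / N * S) ^ 2 / 2 - D k ^ 2 / 2 := by
        change (-(c / N) * S - D k) * D k ≤ _
        nlinarith [sq_nonneg (c / N * S + D k)]
      have : v k * (c / N * D k) = c / N * (v k * D k) := by ring
      rw [this]
      have : v k * D k ≤ (c * B) ^ 2 / 2 - D k ^ 2 / 2 := by linarith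
      have := mul_le_mul_of_nonneg_left this ha.le
      linarith
    refine (Finset.sum_le_sum hterm).trans ?_
    rw [Finset.sum_sub_distrib, sum_Ico_int_const, ← Finset.sum_div, ← Finset.mul_sum]
    have : (N : ℝ) * (c / N * ((c * B) ^ 2 / 2)) = c * (c * B) ^ 2 / 2 := by field_simp
    rw [this]
    rfl
  have hdc := continuousOn_dissipation hφ hE hT hL hq
  have hdi : IntervalIntegrable (fun t => dissipation φ c N (fun k => x k t)) volume 0 T := by
    refine ContinuousOn.intervalIntegrable ?_
    rwa [uIcc_of_le hT.le]
  have hfin := AbsolutelyContinuousOnInterval.sub_le_integral hT.le hEac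
    ((intervalIntegrable_const).sub (hdi.div_const 2)) hder
  rw [intervalIntegral.integral_sub (by simp) (hdi.div_const 2),
    intervalIntegral.integral_const, intervalIntegral.integral_div, smul_eq_mul] at hfin
  have hET : 0 ≤ E T := by
    have hx := hE.isConfig hT hL (t := T) ⟨hT.le, le_rfl⟩
    refine Finset.sum_nonneg fun k _ => ?_
    have hgk := hx.gap_pos k
    exact mul_nonneg hgk.le (hφ.energy_nonneg _ (by positivity))
  have hE0 : E 0 ≤ m * (W M / M) := by
    have hx := hE.isConfig hT hL (t := 0) ⟨le_rfl, hT.le⟩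
    have hWM : 0 ≤ W M / M := div_nonneg (hφ.energy_nonneg _ hM.le) hM.le
    have hterm : ∀ k ∈ Finset.Ico (0 : ℤ) N, e (x (k + 1) 0 - x k 0) ≤ c / N * (W M / M) := by
      intro k _
      have hgk := hx.gap_pos k
      have hgm := hE.initial_gap_ge hT hL hq k
      rw [← hcdef] at hgm
      have hle : (c / N) / (x (k + 1) 0 - x k 0) ≤ M := by
        rw [div_le_iff₀ (by positivity)] at hgm ⊢
        rw [div_le_iff₀ hN]
        linarith
      have := hφ.energy_div_mono (r := (c / N) / (x (k + 1) 0 - x k 0)) (by positivity) hle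
      calc e (x (k + 1) 0 - x k 0) = c / N * (W ((c / N) / (x (k + 1) 0 - x k 0)) /
            ((c / N) / (x (k + 1) 0 - x k 0))) := by
              simp only [e]; field_simp
        _ ≤ _ := by gcongr
    calc E 0 ≤ ∑ _k ∈ Finset.Ico (0 : ℤ) N, c / N * (W M / M) := Finset.sum_le_sum hterm
      _ = c * (W M / M) := by rw [sum_Ico_int_const]; field_simp
      _ ≤ _ := by gcongr
  have hc3 : (T - 0) * (c * (c * B) ^ 2 / 2) ≤ m ^ 3 * B ^ 2 * T / 2 := by
    have : c ^ 3 ≤ m ^ 3 := by gcongr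
    have h2 : 0 ≤ B ^ 2 * T := by positivity
    nlinarith
  linarith

/-- The bound for the density. -/
theorem cell_le_exp (hk : SlopeBound (deriv K) B C) (hφ : AdmissibleDiffusion W φ)
    (hE : IsParticleEvolution K φ T L q N x) (hT : 0 < T) (hL : 0 < L) (hq : IsDatum q m M)
    {c₂ r₂ Q : ℝ} (hc₂ : 0 < c₂) (hr₂ : 0 ≤ r₂) (hlarge : ∀ r, r₂ ≤ r → c₂ * r ≤ φ r)
    (hQ : ∫ t in 0..T, dissipation φ (cellMass q L) N (fun k => x k t) ≤ Q)
    {t : ℝ} (ht : t ∈ Icc 0 T) (k : ℤ) :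
    configCell (cellMass q L) N (fun k => x k t) k ≤
      M * Real.exp ((m * C + 8 * B * (r₂ + (φ M + m) / c₂)) * T + 8 * B * (Q / c₂)) := by
  have hc := hq.cellMass_pos hL
  have hcm := hq.cellMass_le hL
  have hM := hq.pos_bound
  have hB := hk.bound_nonneg
  have hC := hk.lip_nonneg
  have hx0 := hE.isConfig hT hL (t := 0) ⟨le_rfl, hT.le⟩
  have hxt := hE.isConfig hT hL ht
  have hN := hx0.natCast_pos
  set c := cellMass q L with hcdef
  have hcL : c / L ≤ M := by
    rw [div_le_iff₀ hL]
    have := hq.integral_le (a := -(L / 2)) (b := L / 2) (by linarith)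
    calc c ≤ M * (L / 2 - -(L / 2)) := this
      _ = M * L := by ring
  obtain ⟨g, hg, hgap⟩ := hE.exists_gap_ge hT hL
  have hne : (Finset.Ico (0 : ℤ) N).Nonempty := ⟨0, by simpa using hx0.pos⟩
  let l : ℤ → ℝ → ℝ := fun k t => -Real.log (x (k + 1) t - x k t)
  have hlp : ∀ t ∈ Icc 0 T, ∀ k, l k t = l (k % N) t := fun t ht k => by
    have hx := hE.isConfig hT hL ht
    have h4 := periodic_add_mul (f := fun k => x (k + 1) t - x k t) hx.gap_periodic (k % N) (k / N)
    have h3 := Int.mul_ediv_add_emod k N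
    rw [show k % N + k / N * N = k by linarith [mul_comm (N : ℤ) (k / N)]] at h4
    simp only [l]
    rw [show x (k + 1) t - x k t = x (k % N + 1) t - x (k % N) t from h4]
  have hlac : ∀ k, AbsolutelyContinuousOnInterval (l k) 0 T := fun k => by
    refine hE.absolutelyContinuous_comp_gap hT hgap (A := 1 / g) (h := fun r => -Real.log r)
      (by positivity) (fun a b ha hb => ?_) k
    have := Convex.norm_image_sub_le_of_norm_hasDerivWithin_le (f := fun r => -Real.log r)
      (s := Ici g) (C := 1 / g) (f' := fun r => -r⁻¹)
      (fun y hy => (Real.hasDerivAt_log (hg.trans_le hy).ne').neg.hasDerivWithinAt)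
      (fun y hy => by
        have hy0 : 0 < y := hg.trans_le hy
        rw [norm_neg, Real.norm_of_nonneg (by positivity), ← one_div]
        exact one_div_le_one_div_of_le hg hy) (convex_Ici g) (mem_Ici.2 hb) (mem_Ici.2 ha)
    simpa [Real.norm_eq_abs] using this
  -- `μ` is minus the logarithm of the smallest width, and is absolutely continuous as a maximum of
  -- finitely many such functions.
  let μ : ℝ → ℝ := fun t => (Finset.Ico (0 : ℤ) N).sup' hne (fun k => l k t)
  have hNz : (0 : ℤ) < N := by exact_mod_cast hx0.pos
  have hlμ : ∀ t ∈ Icc 0 T, ∀ k, l k t ≤ μ t := fun t ht k => by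
    rw [hlp t ht]
    exact Finset.le_sup' (fun k => l k t)
      (by simp [Int.emod_nonneg k hNz.ne', Int.emod_lt_of_pos k hNz])
  have hμac : AbsolutelyContinuousOnInterval μ 0 T := by
    refine absolutelyContinuous_of_le_sum (s := Finset.Ico (0 : ℤ) N) (f := l)
      (fun k _ => hlac k) 1 fun t _ u _ => ?_
    rw [one_mul]
    exact abs_sup'_sub_sup'_le hne _ _
  have hIcc : uIcc 0 T = Icc 0 T := uIcc_of_le hT.le
  have hder : ∀ᵐ t ∂volume.restrict (Icc 0 T), deriv μ t ≤ c * C + 8 * B *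
      (r₂ + (φ M + c + dissipation φ c N (fun k => x k t)) / c₂) := by
    filter_upwards [hE.ae_velocity hT hL, ae_restrict_mem measurableSet_Icc,
      (hμac.ae_differentiableAt).filter_mono (ae_mono Measure.restrict_le_self)]
      with t ht htI hdiff
    obtain ⟨htI', κ, h1, h2, h3, h4⟩ := ht
    have hx := hE.isConfig hT hL htI
    have hμd := (hdiff (by rwa [hIcc])).hasDerivAt
    obtain ⟨k, hkm, hke⟩ := (Finset.Ico (0 : ℤ) N).exists_mem_eq_sup' hne (fun k => l k t)
    set v : ℤ → ℝ := fun k => -(c / N) * (∑ j ∈ Finset.Ico (0 : ℤ) N, κ k j) -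
      configForce φ c N (fun k => x k t) k with hv
    have h4' : ∀ k, HasDerivAt (x k) (v k) t := h4
    have hgk := hx.gap_pos k
    have hld : HasDerivAt (l k) (-((v (k + 1) - v k) / (x (k + 1) t - x k t))) t :=
      (((h4' (k + 1)).sub (h4' k)).log hgk.ne').neg
    -- `μ - l k` is nonnegative and vanishes at `t`, so at a point of differentiability `μ` has the
    -- derivative of any function attaining the maximum.
    have hmin : IsLocalMin (fun s => μ s - l k s) t := by
      filter_upwards [isOpen_Ioo.mem_nhds htI'] with s hs
      have : μ t = l k t := hke
      have := hlμ s (Ioo_subset_Icc_self hs) k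
      linarith
    have hzero := hmin.hasDerivAt_eq_zero (hμd.sub hld)
    have hmingap : ∀ j, x (k + 1) t - x k t ≤ x (j + 1) t - x j t := fun j => by
      have h5 : l j t ≤ l k t := (hlμ t htI j).trans hke.le
      have h6 : Real.log (x (k + 1) t - x k t) ≤ Real.log (x (j + 1) t - x j t) := by
        simp only [l] at h5; linarith
      exact (Real.log_le_log_iff hgk (hx.gap_pos j)).1 h6
    -- The narrowest cell has the largest density, hence the largest pressure, so the diffusion can
    -- only widen it.
    have hforce : configForce φ c N (fun k => x k t) (k + 1) ≤
        configForce φ c N (fun k => x k t) k := by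
      have hcell : ∀ j, φ (configCell c N (fun k => x k t) j) ≤
          φ (configCell c N (fun k => x k t) k) := fun j => by
        refine hφ.mono (hx.cell_pos hc j).le ?_
        exact div_le_div_of_nonneg_left hc.le (mul_pos hN hgk)
          (mul_le_mul_of_nonneg_left (hmingap j) hN.le)
      unfold configForce
      rw [add_sub_cancel_right]
      have := hcell (k + 1); have := hcell (k - 1)
      gcongr
    have hsl := (abs_le.1 (hx.abs_sum_slope_sub_le hk h1 h3 hmingap)).2
    have hvv : -(v (k + 1) - v k) ≤ c / N * (C * N * (x (k + 1) t - x k t) + 8 * B) := by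
      have := mul_le_mul_of_nonneg_left hsl (show 0 ≤ c / N by positivity)
      change -((-(c / N) * (∑ j ∈ Finset.Ico (0 : ℤ) N, κ (k + 1) j) -
        configForce φ c N (fun k => x k t) (k + 1)) - (-(c / N) * (∑ j ∈ Finset.Ico (0 : ℤ) N, κ k j) -
        configForce φ c N (fun k => x k t) k)) ≤ _
      linarith
    -- Divided by the width, the jump contribution `8B c/N` becomes `8B` times the density of the
    -- cell. This density is bounded here through the dissipation and not through `exp μ`; the
    -- right-hand side is then integrable in time and no Gronwall argument, with its possible
    -- blow-up, is needed.
    have hcl := hx.cell_le hφ hc hcL hc₂ hr₂ hlarge k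
    have hfin : -((v (k + 1) - v k) / (x (k + 1) t - x k t)) ≤
        c * C + 8 * B * configCell c N (fun k => x k t) k := by
      rw [← neg_div, div_le_iff₀ hgk]
      refine hvv.trans (le_of_eq ?_)
      have e1 := hx.cell_mul_gap (c := c) k
      rw [add_mul, mul_assoc (8 * B), e1]
      field_simp
    have : deriv μ t = -((v (k + 1) - v k) / (x (k + 1) t - x k t)) := by linarith
    rw [this]
    refine hfin.trans ?_
    gcongr
  have hdc := continuousOn_dissipation hφ hE hT hL hq
  have hsub : Icc 0 t ⊆ Icc 0 T := Icc_subset_Icc le_rfl ht.2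
  have hdi : ∀ s ∈ Icc 0 T, IntervalIntegrable (fun t => dissipation φ c N (fun k => x k t))
      volume 0 s := fun s hs => by
    refine ContinuousOn.intervalIntegrable ?_
    rw [uIcc_of_le hs.1]
    exact hdc.mono (Icc_subset_Icc le_rfl hs.2)
  set Z := r₂ + (φ M + m) / c₂ with hZ
  have hgi : IntervalIntegrable (fun s => (m * C + 8 * B * Z) +
      8 * B / c₂ * dissipation φ c N (fun k => x k s)) volume 0 t :=
    (intervalIntegrable_const).add ((hdi t ht).const_mul _)
  have hmain := AbsolutelyContinuousOnInterval.sub_le_integral ht.1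
    (hμac.mono (by rw [hIcc, uIcc_of_le ht.1]; exact hsub)) hgi (by
      filter_upwards [ae_mono (Measure.restrict_mono hsub le_rfl) hder] with s hs
      refine hs.trans ?_
      have e : c * C + 8 * B * (r₂ + (φ M + c + dissipation φ c N (fun k => x k s)) / c₂) =
        (c * C + 8 * B * (r₂ + (φ M + c) / c₂)) +
          8 * B / c₂ * dissipation φ c N (fun k => x k s) := by ring
      rw [e]
      simp only [hZ]
      gcongr)
  rw [intervalIntegral.integral_add (by simp) ((hdi t ht).const_mul _),
    intervalIntegral.integral_const, intervalIntegral.integral_const_mul, smul_eq_mul] at hmain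
  have hQt : ∫ s in 0..t, dissipation φ c N (fun k => x k s) ≤ Q := by
    refine le_trans ?_ hQ
    refine intervalIntegral.integral_mono_interval le_rfl ht.1 ht.2 ?_ (hdi T ⟨hT.le, le_rfl⟩)
    rw [EventuallyLE, ae_restrict_iff' measurableSet_Ioc]
    exact Eventually.of_forall fun s hs =>
      (hE.isConfig hT hL (Ioc_subset_Icc_self hs)).dissipation_nonneg hc φ
  have hZ0 : 0 ≤ m * C + 8 * B * Z := by
    have h5 : 0 ≤ φ M := hφ.nonneg hM.le
    have : 0 < m := hc.trans_le hcm
    positivity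
  set Λ := (m * C + 8 * B * Z) * T + 8 * B * (Q / c₂) with hΛ
  have hΛle : μ t - μ 0 ≤ Λ := by
    refine hmain.trans ?_
    have h6 : (t - 0) * (m * C + 8 * B * Z) ≤ (m * C + 8 * B * Z) * T := by
      rw [mul_comm]; gcongr; linarith [ht.2]
    have h7 : 8 * B / c₂ * ∫ s in 0..t, dissipation φ c N (fun k => x k s) ≤ 8 * B / c₂ * Q := by
      gcongr
    have h8 : 8 * B / c₂ * Q = 8 * B * (Q / c₂) := by ring
    linarith
  have hμ0 : μ 0 ≤ -Real.log (c / (N * M)) := by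
    refine Finset.sup'_le hne _ fun k _ => ?_
    simp only [l]
    have := hE.initial_gap_ge hT hL hq k
    have := Real.log_le_log (by positivity) this
    linarith
  have hlk := hlμ t ht k
  have hgk := hxt.gap_pos k
  have hlog : Real.log (c / (N * M)) - Λ ≤ Real.log (x (k + 1) t - x k t) := by
    simp only [l] at hlk; linarith
  have hexp := Real.exp_le_exp.2 hlog
  rw [Real.exp_log hgk, Real.exp_sub, Real.exp_log (by positivity)] at hexp
  unfold configCell
  rw [div_le_iff₀ (by positivity)]
  have hexp0 := Real.exp_pos Λ
  rw [div_le_iff₀ hexp0, div_le_iff₀ (by positivity)] at hexp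
  linarith

/-- The displacement of the particles. -/
theorem sum_abs_displacement_le (hk : SlopeBound (deriv K) B C) (hφ : AdmissibleDiffusion W φ)
    (hE : IsParticleEvolution K φ T L q N x) (hT : 0 < T) (hL : 0 < L) (hq : IsDatum q m M)
    {Q : ℝ} (hQ : ∫ t in 0..T, dissipation φ (cellMass q L) N (fun k => x k t) ≤ Q)
    {s t α : ℝ} (hs : 0 ≤ s) (hst : s ≤ t) (htT : t ≤ T) (hα : 0 < α) :
    cellMass q L / N * ∑ k ∈ Finset.Ico (0 : ℤ) N, |x k t - x k s| ≤
      (t - s) * (m ^ 2 * B + m * α) + Q / α := by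
  have hc := hq.cellMass_pos hL
  have hcm := hq.cellMass_le hL
  have hB := hk.bound_nonneg
  have hx0 := hE.isConfig hT hL (t := 0) ⟨le_rfl, hT.le⟩
  have hN := hx0.natCast_pos
  set c := cellMass q L with hcdef
  have hsub : Icc s t ⊆ Icc 0 T := Icc_subset_Icc hs htT
  have hfi : ∀ k, IntervalIntegrable (fun r => c * B + |configForce φ c N (fun k => x k r) k|)
      volume s t := fun k => by
    refine ContinuousOn.intervalIntegrable ?_
    rw [uIcc_of_le hst]
    exact continuousOn_const.add ((continuousOn_force hφ hE hT hL hq k).mono hsub).abs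
  have h1 : ∀ k, |x k t - x k s| ≤
      ∫ r in s..t, (c * B + |configForce φ c N (fun k => x k r) k|) := fun k => by
    refine AbsolutelyContinuousOnInterval.abs_sub_le_integral hst
      ((hE.absolutelyContinuous k).mono (by
        rw [uIcc_of_le hst, uIcc_of_le hT.le]; exact hsub)) (hfi k) ?_
    filter_upwards [ae_mono (Measure.restrict_mono hsub le_rfl) (hE.ae_velocity hT hL)] with r hr
    obtain ⟨_, κ, h1, h2, h3, h4⟩ := hr
    rw [(h4 k).deriv]
    refine (abs_sub _ _).trans ?_
    gcongr
    rw [← hcdef, abs_mul, abs_neg, abs_of_pos (by positivity)]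
    calc c / N * |∑ j ∈ Finset.Ico (0 : ℤ) N, κ k j| ≤ c / N * (N * B) := by
          gcongr
          exact abs_interaction_le (N := N) hk h1 k
      _ = _ := by field_simp
  have hdc := continuousOn_dissipation hφ hE hT hL hq
  have hdT : IntervalIntegrable (fun t => dissipation φ c N (fun k => x k t)) volume 0 T := by
    refine ContinuousOn.intervalIntegrable ?_
    rwa [uIcc_of_le hT.le]
  have hdi : IntervalIntegrable (fun t => dissipation φ c N (fun k => x k t)) volume s t := by
    refine ContinuousOn.intervalIntegrable ?_
    rw [uIcc_of_le hst]
    exact hdc.mono hsub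
  have hQt : ∫ r in s..t, dissipation φ c N (fun k => x k r) ≤ Q := by
    refine le_trans ?_ hQ
    refine intervalIntegral.integral_mono_interval hs hst htT ?_ hdT
    rw [EventuallyLE, ae_restrict_iff' measurableSet_Ioc]
    exact Eventually.of_forall fun s hs =>
      (hE.isConfig hT hL (Ioc_subset_Icc_self hs)).dissipation_nonneg hc φ
  calc c / N * ∑ k ∈ Finset.Ico (0 : ℤ) N, |x k t - x k s|
      ≤ c / N * ∑ k ∈ Finset.Ico (0 : ℤ) N,
        ∫ r in s..t, (c * B + |configForce φ c N (fun k => x k r) k|) := by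
        gcongr with k _
        exact h1 k
    _ = ∫ r in s..t, c / N * ∑ k ∈ Finset.Ico (0 : ℤ) N,
        (c * B + |configForce φ c N (fun k => x k r) k|) := by
        rw [intervalIntegral.integral_const_mul, intervalIntegral.integral_finsetSum]
        exact fun k _ => hfi k
    _ ≤ ∫ r in s..t, ((m ^ 2 * B + m * α) + dissipation φ c N (fun k => x k r) / α) := by
        refine intervalIntegral.integral_mono_on hst ?_
          ((intervalIntegrable_const).add (hdi.div_const α)) fun r hr => ?_
        · refine IntervalIntegrable.const_mul ?_ _
          have := IntervalIntegrable.sum (Finset.Ico (0 : ℤ) N) fun k _ => hfi k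
          rw [Finset.sum_fn] at this
          exact this
        · have hx := hE.isConfig hT hL (hsub hr)
          -- The force contributes `α` times the elapsed time plus dissipation over `α`; both become
          -- small if `α` is taken large and then the time step small.
          have h3 := hx.sum_abs_force_le hc φ hα
          rw [Finset.sum_add_distrib, mul_add, sum_Ico_int_const]
          have e : c / N * (N * (c * B)) = c ^ 2 * B := by field_simp
          have h4 : c ^ 2 * B ≤ m ^ 2 * B := by gcongr
          have h5 : c * α ≤ m * α := by gcongr
          linarith
    _ = (t - s) * (m ^ 2 * B + m * α) +
        (∫ r in s..t, dissipation φ c N (fun k => x k r)) / α := by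
        rw [intervalIntegral.integral_add (by simp) (hdi.div_const α),
          intervalIntegral.integral_const, intervalIntegral.integral_div, smul_eq_mul]
    _ ≤ _ := by gcongr

end IsParticleEvolution

/-- Uniform bounds for all particle evolutions up to time `T` with data bounded in terms of `m`
and `M`. -/
theorem exists_evolution_bounds {K W φ : ℝ → ℝ} {B C : ℝ} (hk : SlopeBound (deriv K) B C)
    (hφ : AdmissibleDiffusion W φ) (T m M : ℝ) (hm : 0 ≤ m) (hM : 0 < M) :
    ∃ R Q : ℝ, 0 < R ∧ 0 ≤ Q ∧ ∀ (τ L : ℝ) (q : ℝ → ℝ) (N : ℕ) (x : ℤ → ℝ → ℝ), 0 < τ → τ ≤ T →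
      0 < L → IsDatum q m M → IsParticleEvolution K φ τ L q N x →
      (∀ t ∈ Icc 0 τ, ∀ k, configCell (cellMass q L) N (fun k => x k t) k ≤ R) ∧
      ∫ t in 0..τ, dissipation φ (cellMass q L) N (fun k => x k t) ≤ Q := by
  obtain ⟨c₂, r₂, hc₂, hr₂, hlarge⟩ := hφ.large
  have hB := hk.bound_nonneg
  have hC := hk.lip_nonneg
  rcases le_or_gt T 0 with hT | hT
  · exact ⟨1, 0, one_pos, le_rfl, fun τ _ _ _ _ h1 h2 => absurd h1 (by linarith)⟩
  have hWM : 0 ≤ W M / M := div_nonneg (hφ.energy_nonneg _ hM.le) hM.le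
  have hφM := hφ.nonneg hM.le
  -- Both bounds increase with time, so their values at `T` serve on every shorter interval `[0,
  -- τ]`, as the continuation argument for existence requires.
  set Q := 2 * m * (W M / M) + m ^ 3 * B ^ 2 * T with hQ
  refine ⟨M * Real.exp ((m * C + 8 * B * (r₂ + (φ M + m) / c₂)) * T + 8 * B * (Q / c₂)), Q,
    by positivity, by positivity, fun τ L q N x hτ hτT hL hq hE => ?_⟩
  have hd : ∫ t in 0..τ, dissipation φ (cellMass q L) N (fun k => x k t) ≤ Q := by
    refine (hE.integral_dissipation_le hk hφ hτ hL hq).trans ?_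
    rw [hQ]
    gcongr
  refine ⟨fun t ht k => ?_, hd⟩
  refine (hE.cell_le_exp hk hφ hτ hL hq hc₂ (by linarith) hlarge hd ht k).trans ?_
  gcongr

end AggDiff

end

noncomputable section

namespace AggDiff

/-! ### Existence for bounded Lipschitz vector fields -/

/-- Picard–Lindelöf in a ball of radius `Λ T`, which the solution cannot leave before time `T`. -/
theorem exists_solution_of_bounded_lipschitz {E : Type*} [NormedAddCommGroup E] [NormedSpace ℝ E]
    [CompleteSpace E] (F : E → E) (A Λ : NNReal) (hA : LipschitzWith A F) (hΛ : ∀ w, ‖F w‖ ≤ Λ)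
    (w₀ : E) {T : ℝ} (hT : 0 ≤ T) :
    ∃ w : ℝ → E, w 0 = w₀ ∧ ∀ t ∈ Icc 0 T, HasDerivWithinAt w (F (w t)) (Icc 0 T) t := by
  have h : IsPicardLindelof (fun _ => F) (tmin := 0) (tmax := T) ⟨0, le_rfl, hT⟩ w₀
      (Λ * T.toNNReal) 0 Λ A :=
    { lipschitzOnWith := fun t _ => hA.lipschitzOnWith
      continuousOn := fun _ _ => continuousOn_const
      norm_le := fun _ _ w _ => hΛ w
      mul_max_le := by simp [hT] }
  obtain ⟨w, h1, h2⟩ := h.exists_eq_forall_mem_Icc_hasDerivWithinAt₀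
  exact ⟨w, h1, h2⟩

/-- The unknowns are the displacements from the initial positions, indexed by `ZMod N`, so that the
periodicity of the lifted configuration is automatic. The interaction slope `g` and the pressure `h`
are bounded and Lipschitz here, which makes the field globally so. -/
theorem exists_regularized_evolution {N : ℕ} (hN : 0 < N) {L T B A H A' a : ℝ} (hT : 0 ≤ T)
    (ha : 0 ≤ a) {y : ℤ → ℝ}
    (hy : ∀ k, y (k + N) = y k + L) {g h : ℝ → ℝ} (hgp : Function.Periodic g L)
    (hgB : ∀ z, |g z| ≤ B) (hgA : ∀ z w, |g z - g w| ≤ A * |z - w|)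
    (hhB : ∀ z, |h z| ≤ H) (hhA : ∀ z w, |h z - h w| ≤ A' * |z - w|) :
    ∃ x : ℤ → ℝ → ℝ, (∀ k, x k 0 = y k) ∧ (∀ k t, x (k + N) t = x k t + L) ∧
      ∀ k, ∀ t ∈ Icc 0 T, HasDerivWithinAt (x k)
        (-a * ∑ j ∈ Finset.Ico (0 : ℤ) N, g (x k t - x j t) -
          (h (x (k + 1) t - x k t) - h (x k t - x (k - 1) t))) (Icc 0 T) t := by
  have : NeZero N := ⟨hN.ne'⟩
  have hB0 : 0 ≤ B := (abs_nonneg _).trans (hgB 0)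
  have hH0 : 0 ≤ H := (abs_nonneg _).trans (hhB 0)
  have hA0 : 0 ≤ A := by simpa using (abs_nonneg _).trans (hgA 1 0)
  have hA'0 : 0 ≤ A' := by simpa using (abs_nonneg _).trans (hhA 1 0)
  let X : (ZMod N → ℝ) → ℤ → ℝ := fun w k => y k + w (k : ZMod N)
  have hX : ∀ w k, X w (k + N) = X w k + L := fun w k => by
    simp only [X, hy]; push_cast; simp; ring
  let V : (ZMod N → ℝ) → ℤ → ℝ := fun w k =>
    -a * ∑ j ∈ Finset.Ico (0 : ℤ) N, g (X w k - X w j) -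
      (h (X w (k + 1) - X w k) - h (X w k - X w (k - 1)))
  have hV : ∀ w k, V w (k + N) = V w k := fun w k => by
    simp only [V]
    rw [show k + (N : ℤ) + 1 = k + 1 + N by ring, show k + (N : ℤ) - 1 = k - 1 + N by ring, hX, hX,
      hX]
    have e1 : ∀ j, g (X w k + L - X w j) = g (X w k - X w j) := fun j => by
      rw [← hgp (X w k - X w j)]; congr 1; ring
    simp_rw [e1]
    congr 3 <;> ring
  have hXl : ∀ w w' k l, |(X w k - X w l) - (X w' k - X w' l)| ≤ 2 * ‖w - w'‖ := fun w w' k l => by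
    have h1 := norm_le_pi_norm (w - w') (k : ZMod N)
    have h2 := norm_le_pi_norm (w - w') (l : ZMod N)
    have h3 := abs_sub ((w - w') (k : ZMod N)) ((w - w') (l : ZMod N))
    rw [Real.norm_eq_abs] at h1 h2
    have e : (X w k - X w l) - (X w' k - X w' l) =
        (w - w') (k : ZMod N) - (w - w') (l : ZMod N) := by simp only [X, Pi.sub_apply]; ring
    rw [e]; linarith
  let F : (ZMod N → ℝ) → (ZMod N → ℝ) := fun w i => V w (i.val : ℤ)
  have hF : ∀ w (k : ℤ), F w (k : ZMod N) = V w k := fun w k => by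
    simp only [F]
    have h1 : (((k : ZMod N).val : ℤ) : ZMod N) = (k : ZMod N) := by simp
    rw [ZMod.intCast_eq_intCast_iff_dvd_sub] at h1
    obtain ⟨m, hm⟩ := h1
    have := periodic_add_mul (hV w) (((k : ZMod N).val : ℤ)) m
    rw [← this]
    congr 1
    linarith [mul_comm (N : ℤ) m]
  let Λ : ℝ := a * (N * B) + 2 * H
  let Γ : ℝ := a * (N * (A * 2)) + 4 * A'
  have hΛ0 : 0 ≤ Λ := by positivity
  have hΓ0 : 0 ≤ Γ := by positivity
  have hVΛ : ∀ w k, |V w k| ≤ Λ := fun w k => by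
    simp only [V]
    refine (abs_sub _ _).trans ?_
    have h1 := abs_sub (h (X w (k + 1) - X w k)) (h (X w k - X w (k - 1)))
    have h2 := hhB (X w (k + 1) - X w k)
    have h3 := hhB (X w k - X w (k - 1))
    have h4 : |∑ j ∈ Finset.Ico (0 : ℤ) N, g (X w k - X w j)| ≤ N * B := by
      refine (Finset.abs_sum_le_sum_abs _ _).trans ?_
      refine (Finset.sum_le_sum fun j _ => hgB _).trans ?_
      rw [sum_Ico_int_const]
    rw [abs_mul, abs_neg, abs_of_nonneg ha]
    have := mul_le_mul_of_nonneg_left h4 ha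
    simp only [Λ]; linarith
  have hVΓ : ∀ w w' k, |V w k - V w' k| ≤ Γ * ‖w - w'‖ := fun w w' k => by
    have h1 : |∑ j ∈ Finset.Ico (0 : ℤ) N, (g (X w k - X w j) - g (X w' k - X w' j))| ≤
        N * (A * (2 * ‖w - w'‖)) := by
      refine (Finset.abs_sum_le_sum_abs _ _).trans ?_
      refine (Finset.sum_le_sum fun j _ => (hgA _ _).trans
        (mul_le_mul_of_nonneg_left (hXl w w' k j) hA0)).trans ?_
      rw [sum_Ico_int_const]
    have h2 := (hhA (X w (k + 1) - X w k) (X w' (k + 1) - X w' k)).trans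
      (mul_le_mul_of_nonneg_left (hXl w w' (k + 1) k) hA'0)
    have h3 := (hhA (X w k - X w (k - 1)) (X w' k - X w' (k - 1))).trans
      (mul_le_mul_of_nonneg_left (hXl w w' k (k - 1)) hA'0)
    rw [Finset.sum_sub_distrib] at h1
    have e : V w k - V w' k = -a * (∑ j ∈ Finset.Ico (0 : ℤ) N, g (X w k - X w j) -
        ∑ j ∈ Finset.Ico (0 : ℤ) N, g (X w' k - X w' j)) -
        ((h (X w (k + 1) - X w k) - h (X w' (k + 1) - X w' k)) -
          (h (X w k - X w (k - 1)) - h (X w' k - X w' (k - 1)))) := by simp only [V]; ring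
    rw [e]
    refine (abs_sub _ _).trans ?_
    rw [abs_mul, abs_neg, abs_of_nonneg ha]
    have h4 := mul_le_mul_of_nonneg_left h1 ha
    have h5 := abs_sub (h (X w (k + 1) - X w k) - h (X w' (k + 1) - X w' k))
      (h (X w k - X w (k - 1)) - h (X w' k - X w' (k - 1)))
    simp only [Γ]; linarith
  obtain ⟨w, hw0, hw⟩ := exists_solution_of_bounded_lipschitz F Γ.toNNReal Λ.toNNReal
    (LipschitzWith.of_dist_le_mul fun w w' => by
      rw [Real.coe_toNNReal _ hΓ0, dist_eq_norm, dist_eq_norm]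
      exact (pi_norm_le_iff_of_nonneg (by positivity)).2 fun i => hVΓ w w' _)
    (fun w => by
      rw [Real.coe_toNNReal _ hΛ0]
      exact (pi_norm_le_iff_of_nonneg hΛ0).2 fun i => hVΛ w _) 0 hT
  refine ⟨fun k t => X (w t) k, fun k => by simp [X, hw0], fun k t => hX _ _, fun k t ht => ?_⟩
  have := (hasDerivWithinAt_pi.1 (hw t ht) (k : ZMod N)).const_add (y k)
  rw [hF] at this
  exact this

/-! ### Limits along an ultrafilter -/

theorem abs_intervalIntegral_le {f : ℝ → ℝ} {a b D : ℝ} (h : ∀ r ∈ uIoc a b, |f r| ≤ D) :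
    |∫ r in a..b, f r| ≤ D * |b - a| :=
  intervalIntegral.norm_integral_le_of_norm_le_const (f := f) h

/-- An ultrafilter selects limits for all pairs of particles and all times at once and replaces a
diagonal extraction. -/
theorem exists_tendsto_hyperfilter {a : ℕ → ℝ} {A : ℝ} (h : ∀ n, |a n| ≤ A) :
    ∃ l, Tendsto a (hyperfilter ℕ : Ultrafilter ℕ) (𝓝 l) := by
  obtain ⟨l, _, hl⟩ := (isCompact_Icc (a := -A) (b := A)).ultrafilter_le_nhds'
    ((hyperfilter ℕ : Ultrafilter ℕ).map a)
    (Ultrafilter.mem_map.2 (Filter.mem_of_superset univ_mem fun n _ => abs_le.1 (h n)))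
  exact ⟨l, hl⟩

/-- The derivative of a limit of primitives with locally convergent integrands. -/
theorem hasDerivAt_of_tendsto_primitive {l : Filter ℕ} [l.NeBot] {T : ℝ} {f : ℕ → ℝ → ℝ}
    (hf : ∀ n, ContinuousOn (f n) (Icc 0 T)) {G : ℝ → ℝ}
    (hG : ∀ t ∈ Icc 0 T, Tendsto (fun n => ∫ s in 0..t, f n s) l (𝓝 (G t))) {t v : ℝ}
    (ht : t ∈ Ioo 0 T) (h : ∀ ε > 0, ∃ η > 0, ∀ᶠ n in l, ∀ s ∈ Icc 0 T, |s - t| < η →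
      |f n s - v| ≤ ε) : HasDerivAt G v t := by
  rw [hasDerivAt_iff_isLittleO, Asymptotics.isLittleO_iff]
  intro ε hε
  obtain ⟨η, hη, hev⟩ := h ε hε
  filter_upwards [isOpen_Ioo.mem_nhds ht, Metric.ball_mem_nhds t hη] with s hs hsη
  have htI := Ioo_subset_Icc_self ht
  have hsI := Ioo_subset_Icc_self hs
  have hii : ∀ n, ∀ a ∈ Icc 0 T, ∀ b ∈ Icc 0 T, IntervalIntegrable (f n) volume a b :=
    fun n a ha b hb => ContinuousOn.intervalIntegrable ((hf n).mono (uIcc_subset_Icc ha hb))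
  have h0 : (0 : ℝ) ∈ Icc 0 T := ⟨le_rfl, htI.1.trans htI.2⟩
  have hlim : Tendsto (fun n => |(∫ r in 0..s, f n r) - (∫ r in 0..t, f n r) - (s - t) * v|) l
      (𝓝 |G s - G t - (s - t) * v|) := (((hG s hsI).sub (hG t htI)).sub_const _).abs
  rw [Real.norm_eq_abs, Real.norm_eq_abs, smul_eq_mul]
  refine le_of_tendsto hlim ?_
  filter_upwards [hev] with n hn
  rw [intervalIntegral.integral_interval_sub_left (hii n 0 h0 s hsI) (hii n 0 h0 t htI)]
  have e : (∫ r in t..s, f n r) - (s - t) * v = ∫ r in t..s, (f n r - v) := by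
    rw [intervalIntegral.integral_sub (hii n t htI s hsI) (by simp)]; simp
  rw [e]
  refine abs_intervalIntegral_le fun r hr => ?_
  have hr2 := uIoc_subset_uIcc hr
  refine hn r (uIcc_subset_Icc htI hsI hr2) ?_
  rw [Metric.mem_ball, Real.dist_eq] at hsη
  refine lt_of_le_of_lt ?_ hsη
  exact abs_sub_left_of_mem_uIcc hr2

/-- The counterpart for singular points: near `t` the integrands have no limit but an asymptotic
bound, which is inherited by the increments of `G` and hence by its derivative, where it exists. -/
theorem abs_le_of_hasDerivAt_of_tendsto_primitive {l : Filter ℕ} [l.NeBot] {T : ℝ}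
    {f : ℕ → ℝ → ℝ} (hf : ∀ n, ContinuousOn (f n) (Icc 0 T)) {G : ℝ → ℝ}
    (hG : ∀ t ∈ Icc 0 T, Tendsto (fun n => ∫ s in 0..t, f n s) l (𝓝 (G t))) {t v b : ℝ}
    (ht : t ∈ Ioo 0 T) (hv : HasDerivAt G v t) (hb : 0 ≤ b)
    (h : ∀ ε > 0, ∃ η > 0, ∀ᶠ n in l, ∀ s ∈ Icc 0 T, |s - t| < η → |f n s| ≤ b + ε) : |v| ≤ b := by
  refine le_of_forall_pos_le_add fun ε hε => ?_
  obtain ⟨η, hη, hev⟩ := h ε hε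
  refine hv.le_of_lip' (by positivity) ?_
  filter_upwards [isOpen_Ioo.mem_nhds ht, Metric.ball_mem_nhds t hη] with s hs hsη
  have htI := Ioo_subset_Icc_self ht
  have hsI := Ioo_subset_Icc_self hs
  have hii : ∀ n, ∀ a ∈ Icc 0 T, ∀ b ∈ Icc 0 T, IntervalIntegrable (f n) volume a b :=
    fun n a ha b hb => ContinuousOn.intervalIntegrable ((hf n).mono (uIcc_subset_Icc ha hb))
  have h0 : (0 : ℝ) ∈ Icc 0 T := ⟨le_rfl, htI.1.trans htI.2⟩
  have hlim : Tendsto (fun n => |(∫ r in 0..s, f n r) - (∫ r in 0..t, f n r)|) l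
      (𝓝 |G s - G t|) := ((hG s hsI).sub (hG t htI)).abs
  rw [Real.norm_eq_abs, Real.norm_eq_abs]
  refine le_of_tendsto hlim ?_
  filter_upwards [hev] with n hn
  rw [intervalIntegral.integral_interval_sub_left (hii n 0 h0 s hsI) (hii n 0 h0 t htI)]
  refine abs_intervalIntegral_le fun r hr => ?_
  have hr2 := uIoc_subset_uIcc hr
  refine hn r (uIcc_subset_Icc htI hsI hr2) ?_
  rw [Metric.mem_ball, Real.dist_eq] at hsη
  exact lt_of_le_of_lt (abs_sub_left_of_mem_uIcc hr2) hsη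

/-- Passage to the limit in the regularized evolutions: the limit solves a differential inclusion
for any set-valued slope `S` that is the graph limit of the regularized slopes. -/
theorem exists_inclusion_evolution {N : ℕ} (hN : 0 < N) {L T B H A' a b : ℝ} (hT : 0 < T)
    (ha : 0 ≤ a) (hb : 0 ≤ b) {y : ℤ → ℝ}
    (hy : ∀ k, y (k + N) = y k + L) {g : ℕ → ℝ → ℝ} {A : ℕ → ℝ} {h g₀ : ℝ → ℝ} {P : Set ℝ}
    (hgp : ∀ n, Function.Periodic (g n) L) (hgodd : ∀ n z, g n (-z) = -g n z)
    (hgB : ∀ n z, |g n z| ≤ B) (hgA : ∀ n z w, |g n z - g n w| ≤ A n * |z - w|)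
    (hhB : ∀ z, |h z| ≤ H) (hhA : ∀ z w, |h z - h w| ≤ A' * |z - w|)
    (hreg : ∀ z ∉ P, ∀ ε > 0, ∃ η > 0, ∀ᶠ n in atTop, ∀ w, |w - z| < η → |g n w - g₀ z| ≤ ε)
    (hsing : ∀ z ∈ P, ∀ ε > 0, ∃ η > 0, ∀ n, ∀ w, |w - z| < η → |g n w| ≤ b + ε) :
    ∃ x : ℤ → ℝ → ℝ, (∀ k, x k 0 = y k) ∧ (∀ k, ∀ t ∈ Icc 0 T, x (k + N) t = x k t + L) ∧
      (∀ k, ∀ t ∈ Icc 0 T, ∀ s ∈ Icc 0 T, |x k t - x k s| ≤ (a * (N * B) + 2 * H) * |t - s|) ∧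
      ∀ᵐ t ∂volume.restrict (Icc 0 T), ∃ κ : ℤ → ℤ → ℝ,
        (∀ k j, (x k t - x j t ∉ P → κ k j = g₀ (x k t - x j t)) ∧
          (x k t - x j t ∈ P → |κ k j| ≤ b)) ∧ (∀ k j, κ j k = -κ k j) ∧
        ∀ k, HasDerivAt (x k) (-a * ∑ j ∈ Finset.Ico (0 : ℤ) N, κ k j -
          (h (x (k + 1) t - x k t) - h (x k t - x (k - 1) t))) t := by
  choose X hX0 hXp hXd using fun n => exists_regularized_evolution (A := A n) hN hT.le ha hy (hgp n)
    (hgB n) (hgA n) hhB hhA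
  have hB0 : 0 ≤ B := (abs_nonneg _).trans (hgB 0 0)
  have hH0 : 0 ≤ H := (abs_nonneg _).trans (hhB 0)
  have hA'0 : 0 ≤ A' := by simpa using (abs_nonneg _).trans (hhA 1 0)
  have hgc : ∀ n, Continuous (g n) := fun n => by
    have : LipschitzWith (A n).toNNReal (g n) := LipschitzWith.of_dist_le_mul fun z w => by
      rw [Real.dist_eq, Real.dist_eq]
      exact (hgA n z w).trans (mul_le_mul_of_nonneg_right (Real.le_coe_toNNReal _) (abs_nonneg _))
    exact this.continuous
  have hhc : Continuous h := by
    have : LipschitzWith A'.toNNReal h := LipschitzWith.of_dist_le_mul fun z w => by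
      rw [Real.dist_eq, Real.dist_eq]
      exact (hhA z w).trans (mul_le_mul_of_nonneg_right (Real.le_coe_toNNReal _) (abs_nonneg _))
    exact this.continuous
  have hXc : ∀ n k, ContinuousOn (X n k) (Icc 0 T) := fun n k t ht =>
    (hXd n k t ht).continuousWithinAt
  -- The interaction of each pair is followed separately, so that antisymmetry survives the limit.
  -- The slopes `κ k j` of the limit will be the derivatives of the limits `I k j` of the primitives
  -- of these functions.
  let f : ℤ → ℤ → ℕ → ℝ → ℝ := fun k j n s => g n (X n k s - X n j s)
  let e : ℤ → ℕ → ℝ → ℝ := fun k n s => h (X n (k + 1) s - X n k s)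
  have hfc : ∀ k j n, ContinuousOn (f k j n) (Icc 0 T) := fun k j n =>
    (hgc n).comp_continuousOn ((hXc n k).sub (hXc n j))
  have hec : ∀ k n, ContinuousOn (e k n) (Icc 0 T) := fun k n =>
    hhc.comp_continuousOn ((hXc n (k + 1)).sub (hXc n k))
  have hIcc0 : (0 : ℝ) ∈ Icc 0 T := ⟨le_rfl, hT.le⟩
  have hii : ∀ F : ℝ → ℝ, ContinuousOn F (Icc 0 T) → ∀ t ∈ Icc 0 T, ∀ s ∈ Icc 0 T,
      IntervalIntegrable F volume t s :=
    fun F hF t ht s hs => ContinuousOn.intervalIntegrable (hF.mono (uIcc_subset_Icc ht hs))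
  have hlip : ∀ (F : ℝ → ℝ) (D : ℝ), (∀ t, |F t| ≤ D) → ContinuousOn F (Icc 0 T) →
      ∀ t ∈ Icc 0 T, ∀ s ∈ Icc 0 T,
      |(∫ r in 0..t, F r) - ∫ r in 0..s, F r| ≤ D * |t - s| := by
    intro F D hD hF t ht s hs
    rw [intervalIntegral.integral_interval_sub_left (hii F hF 0 hIcc0 t ht)
      (hii F hF 0 hIcc0 s hs)]
    exact abs_intervalIntegral_le fun r _ => hD r
  have hbd : ∀ (F : ℝ → ℝ) (D : ℝ), (∀ t, |F t| ≤ D) → ContinuousOn F (Icc 0 T) →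
      ∀ t ∈ Icc 0 T, |∫ r in 0..t, F r| ≤ D * T := by
    intro F D hD hF t ht
    have := hlip F D hD hF t ht 0 hIcc0
    have hD0 : 0 ≤ D := (abs_nonneg _).trans (hD 0)
    rw [intervalIntegral.integral_same, sub_zero, sub_zero, abs_of_nonneg ht.1] at this
    exact this.trans (mul_le_mul_of_nonneg_left ht.2 hD0)
  have hI : ∀ k j t, ∃ v, t ∈ Icc 0 T → Tendsto (fun n => ∫ s in 0..t, f k j n s)
      (hyperfilter ℕ : Ultrafilter ℕ) (𝓝 v) := fun k j t => by
    by_cases ht : t ∈ Icc 0 T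
    · obtain ⟨v, hv⟩ := exists_tendsto_hyperfilter (a := fun n => ∫ s in 0..t, f k j n s)
        fun n => hbd _ B (fun s => hgB n _) (hfc k j n) t ht
      exact ⟨v, fun _ => hv⟩
    · exact ⟨0, fun h => absurd h ht⟩
  have hJ : ∀ k t, ∃ v, t ∈ Icc 0 T → Tendsto (fun n => ∫ s in 0..t, e k n s)
      (hyperfilter ℕ : Ultrafilter ℕ) (𝓝 v) := fun k t => by
    by_cases ht : t ∈ Icc 0 T
    · obtain ⟨v, hv⟩ := exists_tendsto_hyperfilter (a := fun n => ∫ s in 0..t, e k n s)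
        fun n => hbd _ H (fun s => hhB _) (hec k n) t ht
      exact ⟨v, fun _ => hv⟩
    · exact ⟨0, fun h => absurd h ht⟩
  choose I hI using hI
  choose J hJ using hJ
  have hXint : ∀ n k, ∀ t ∈ Icc 0 T, X n k t = y k -
      a * ∑ j ∈ Finset.Ico (0 : ℤ) N, (∫ s in 0..t, f k j n s) -
      ((∫ s in 0..t, e k n s) - ∫ s in 0..t, e (k - 1) n s) := by
    intro n k t ht
    let F : ℝ → ℝ := fun s => -a * ∑ j ∈ Finset.Ico (0 : ℤ) N, f k j n s - (e k n s - e (k - 1) n s)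
    have hsub : Icc 0 t ⊆ Icc 0 T := Icc_subset_Icc le_rfl ht.2
    have hFTC := intervalIntegral.integral_eq_sub_of_hasDerivAt_of_le ht.1 ((hXc n k).mono hsub)
      (f' := F) (fun s hs => by
        have hs' : s ∈ Ioo 0 T := ⟨hs.1, hs.2.trans_le ht.2⟩
        have := (hXd n k s (Ioo_subset_Icc_self hs')).hasDerivAt (Icc_mem_nhds hs'.1 hs'.2)
        simp only [F, f, e, sub_add_cancel]
        exact this)
      (by
        refine hii F ?_ 0 hIcc0 t ht
        exact (continuousOn_const.mul (continuousOn_finsetSum _ fun j _ => hfc k j n)).sub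
          ((hec k n).sub (hec (k - 1) n)))
    rw [hX0] at hFTC
    have hs1 : IntervalIntegrable (fun s => ∑ j ∈ Finset.Ico (0 : ℤ) N, f k j n s) volume 0 t :=
      hii _ (continuousOn_finsetSum _ fun j _ => hfc k j n) 0 hIcc0 t ht
    have he1 := hii _ (hec k n) 0 hIcc0 t ht
    have he2 := hii _ (hec (k - 1) n) 0 hIcc0 t ht
    simp only [F] at hFTC
    rw [intervalIntegral.integral_sub (hs1.const_mul _) (he1.sub he2),
      intervalIntegral.integral_sub he1 he2, intervalIntegral.integral_const_mul,
      intervalIntegral.integral_finsetSum fun j _ => hii _ (hfc k j n) 0 hIcc0 t ht] at hFTC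
    linarith
  -- The limit positions are read off from the integrated equation.
  let x : ℤ → ℝ → ℝ := fun k t => y k - a * ∑ j ∈ Finset.Ico (0 : ℤ) N, I k j t -
    (J k t - J (k - 1) t)
  have hxlim : ∀ k, ∀ t ∈ Icc 0 T, Tendsto (fun n => X n k t) (hyperfilter ℕ : Ultrafilter ℕ)
      (𝓝 (x k t)) := fun k t ht => by
    refine Tendsto.congr (fun n => (hXint n k t ht).symm) ?_
    exact (tendsto_const_nhds.sub ((tendsto_finsetSum _ fun j _ => hI k j t ht).const_mul a)).sub
      ((hJ k t ht).sub (hJ (k - 1) t ht))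
  set Λ : ℝ := a * (N * B) + 2 * H with hΛ
  have hΛ0 : 0 ≤ Λ := by positivity
  have hXlip : ∀ n k, ∀ t ∈ Icc 0 T, ∀ s ∈ Icc 0 T, |X n k t - X n k s| ≤ Λ * |t - s| := by
    intro n k t ht s hs
    refine Convex.norm_image_sub_le_of_norm_hasDerivWithin_le (fun r hr => hXd n k r hr)
      (fun r _ => ?_) (convex_Icc 0 T) hs ht
    rw [Real.norm_eq_abs]
    refine (abs_sub _ _).trans ?_
    have h1 := abs_sub (h (X n (k + 1) r - X n k r)) (h (X n k r - X n (k - 1) r))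
    have h2 := hhB (X n (k + 1) r - X n k r)
    have h3 := hhB (X n k r - X n (k - 1) r)
    have h4 : |∑ j ∈ Finset.Ico (0 : ℤ) N, g n (X n k r - X n j r)| ≤ N * B := by
      refine (Finset.abs_sum_le_sum_abs _ _).trans ?_
      refine (Finset.sum_le_sum fun j _ => hgB n _).trans ?_
      rw [sum_Ico_int_const]
    rw [abs_mul, abs_neg, abs_of_nonneg ha]
    have := mul_le_mul_of_nonneg_left h4 ha
    linarith
  have hxlip : ∀ k, ∀ t ∈ Icc 0 T, ∀ s ∈ Icc 0 T, |x k t - x k s| ≤ Λ * |t - s| :=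
    fun k t ht s hs => le_of_tendsto ((hxlim k t ht).sub (hxlim k s hs)).abs
      (Eventually.of_forall fun n => hXlip n k t ht s hs)
  have hIlip : ∀ k j, ∀ t ∈ Icc 0 T, ∀ s ∈ Icc 0 T, |I k j t - I k j s| ≤ B * |t - s| :=
    fun k j t ht s hs => le_of_tendsto ((hI k j t ht).sub (hI k j s hs)).abs
      (Eventually.of_forall fun n => hlip _ B (fun r => hgB n _) (hfc k j n) t ht s hs)
  have hIac : ∀ k j, AbsolutelyContinuousOnInterval (I k j) 0 T := fun k j => by
    have : LipschitzOnWith B.toNNReal (I k j) (uIcc 0 T) := LipschitzOnWith.of_dist_le_mul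
      fun t ht s hs => by
        rw [uIcc_of_le hT.le] at ht hs
        rw [Real.dist_eq, Real.dist_eq, Real.coe_toNNReal _ hB0]
        exact hIlip k j t ht s hs
    exact this.absolutelyContinuousOnInterval
  have hIodd : ∀ k j, ∀ t ∈ Icc 0 T, I j k t = -I k j t := fun k j t ht => by
    refine tendsto_nhds_unique (hI j k t ht) ?_
    refine (hI k j t ht).neg.congr fun n => ?_
    rw [← intervalIntegral.integral_neg]
    refine intervalIntegral.integral_congr fun s _ => ?_
    simp only [f]
    rw [← hgodd, neg_sub]
  -- A Lipschitz bound uniform in `n` makes convergence at the single time `t` effective on a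
  -- neighbourhood of `t` that is the same for all `n` in a set of the ultrafilter.
  have hclose : ∀ k j, ∀ t ∈ Icc 0 T, ∀ η > 0, ∃ η' > 0, ∀ᶠ n in (hyperfilter ℕ : Ultrafilter ℕ),
      ∀ s ∈ Icc 0 T, |s - t| < η' → |(X n k s - X n j s) - (x k t - x j t)| < η := by
    intro k j t ht η hη
    refine ⟨η / 2 / (2 * Λ + 1), by positivity, ?_⟩
    have h1 := (Metric.tendsto_nhds.1 ((hxlim k t ht).sub (hxlim j t ht))) (η / 2) (by positivity)
    filter_upwards [h1] with n hn s hs hst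
    rw [Real.dist_eq] at hn
    have h2 := hXlip n k s hs t ht
    have h3 := hXlip n j s hs t ht
    rw [lt_div_iff₀ (by positivity)] at hst
    have h5 : |(X n k s - X n k t) - (X n j s - X n j t)| ≤ Λ * |s - t| + Λ * |s - t| :=
      (abs_sub _ _).trans (add_le_add h2 h3)
    have h6 := abs_add_le ((X n k s - X n k t) - (X n j s - X n j t))
      ((X n k t - X n j t) - (x k t - x j t))
    have e1 : (X n k s - X n k t) - (X n j s - X n j t) + ((X n k t - X n j t) - (x k t - x j t)) =
      (X n k s - X n j s) - (x k t - x j t) := by ring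
    rw [e1] at h6
    have := abs_nonneg (s - t)
    nlinarith
  refine ⟨x, fun k => ?_, fun k t ht => ?_, hxlip, ?_⟩
  · refine tendsto_nhds_unique (hxlim k 0 hIcc0) ?_
    exact tendsto_const_nhds.congr fun n => (hX0 n k).symm
  · refine tendsto_nhds_unique (hxlim (k + N) t ht) ?_
    exact ((hxlim k t ht).add_const L).congr fun n => (hXp n k t).symm
  · have hIoo : ∀ᵐ t ∂(volume.restrict (Icc 0 T)), t ∈ Ioo 0 T := by
      filter_upwards [ae_restrict_mem measurableSet_Icc,
        (Measure.ae_ne volume (0 : ℝ)).filter_mono (ae_mono Measure.restrict_le_self),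
        (Measure.ae_ne volume T).filter_mono (ae_mono Measure.restrict_le_self)] with t h1 h2 h3
      exact ⟨lt_of_le_of_ne h1.1 h2.symm, lt_of_le_of_ne h1.2 h3⟩
    have hdiff : ∀ᵐ t ∂(volume.restrict (Icc 0 T)), ∀ k j, DifferentiableAt ℝ (I k j) t := by
      rw [ae_all_iff]; intro k
      rw [ae_all_iff]; intro j
      filter_upwards [(hIac k j).ae_differentiableAt.filter_mono
        (ae_mono Measure.restrict_le_self), ae_restrict_mem measurableSet_Icc] with t h1 h2
      exact h1 (by rwa [uIcc_of_le hT.le])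
    filter_upwards [hIoo, hdiff] with t ht hd
    have htI := Ioo_subset_Icc_self ht
    refine ⟨fun k j => deriv (I k j) t, fun k j => ⟨fun hP => ?_, fun hP => ?_⟩, fun k j => ?_,
      fun k => ?_⟩
    · refine HasDerivAt.deriv (hasDerivAt_of_tendsto_primitive (hfc k j) (hI k j) ht ?_)
      intro ε hε
      obtain ⟨η, hη, hn⟩ := hreg _ hP ε hε
      obtain ⟨η', hη', hn'⟩ := hclose k j t htI η hη
      refine ⟨η', hη', ?_⟩
      filter_upwards [hn', hn.filter_mono Nat.hyperfilter_le_atTop] with n h1 h2 s hs hst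
      exact h2 _ (h1 s hs hst)
    · refine abs_le_of_hasDerivAt_of_tendsto_primitive (hfc k j) (hI k j) ht (hd k j).hasDerivAt
        hb ?_
      intro ε hε
      obtain ⟨η, hη, hn⟩ := hsing _ hP ε hε
      obtain ⟨η', hη', hn'⟩ := hclose k j t htI η hη
      refine ⟨η', hη', ?_⟩
      filter_upwards [hn'] with n h1 s hs hst
      exact hn n _ (h1 s hs hst)
    · rw [← deriv.fun_neg]
      refine Filter.EventuallyEq.deriv_eq ?_
      filter_upwards [isOpen_Ioo.mem_nhds ht] with s hs
      exact hIodd k j s (Ioo_subset_Icc_self hs)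
    · have hJd : ∀ k, HasDerivAt (J k) (h (x (k + 1) t - x k t)) t := fun k => by
        refine hasDerivAt_of_tendsto_primitive (hec k) (hJ k) ht fun ε hε => ?_
        obtain ⟨η', hη', hn'⟩ := hclose (k + 1) k t htI (ε / (A' + 1)) (by positivity)
        refine ⟨η', hη', ?_⟩
        filter_upwards [hn'] with n h1 s hs hst
        have h2 := h1 s hs hst
        refine (hhA _ _).trans ?_
        rw [lt_div_iff₀ (by positivity)] at h2
        have := abs_nonneg ((X n (k + 1) s - X n k s) - (x (k + 1) t - x k t))
        nlinarith
      have h1 : HasDerivAt (fun t => ∑ j ∈ Finset.Ico (0 : ℤ) N, I k j t)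
          (∑ j ∈ Finset.Ico (0 : ℤ) N, deriv (I k j) t) t :=
        HasDerivAt.fun_sum fun j _ => (hd k j).hasDerivAt
      have h2 := (((hasDerivAt_const t (y k)).sub (h1.const_mul a)).sub
        ((hJd k).sub (hJd (k - 1))))
      refine h2.congr_deriv ?_
      rw [sub_add_cancel]; ring

end AggDiff

end

noncomputable section

namespace AggDiff

/-! ### Regularized slopes -/

/-- The slope of the kernel, made linear between `-δ` and `δ`. -/
def linearizedSlope (k : ℝ → ℝ) (δ z : ℝ) : ℝ := k (max |z| δ) * max (-1) (min 1 (z / δ))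

/-- A cutoff near the antipodal point. -/
def antipodalCutoff (L : ℝ) (n : ℕ) (z : ℝ) : ℝ := max 0 (min 1 (n * (L / 2 - |z|)))

theorem abs_clamp_sub_le (a b : ℝ) :
    |max (-1) (min 1 a) - max (-1) (min 1 b)| ≤ |a - b| :=
  (abs_max_sub_max_le_max _ _ _ _).trans (by
    simp only [sub_self, abs_zero]
    refine max_le (abs_nonneg _) ((abs_min_sub_min_le_max _ _ _ _).trans ?_)
    simp)

namespace SlopeBound

variable {k : ℝ → ℝ} {B C δ L : ℝ} (hk : SlopeBound k B C) (hδ : 0 < δ)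
include hk hδ

theorem linearizedSlope_of_le {z : ℝ} (hz : δ ≤ |z|) : linearizedSlope k δ z = k z := by
  unfold linearizedSlope
  rw [max_eq_left hz]
  rcases le_total 0 z with h | h
  · rw [abs_of_nonneg h] at hz ⊢
    have : 1 ≤ z / δ := by rwa [le_div_iff₀ hδ, one_mul]
    rw [min_eq_left this, max_eq_right (by norm_num), mul_one]
  · rw [abs_of_nonpos h] at hz ⊢
    have : z / δ ≤ -1 := by rw [div_le_iff₀ hδ]; linarith
    rw [max_eq_left ((min_le_right _ _).trans this), hk.odd]; ring

omit hk hδ in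
theorem linearizedSlope_zero : linearizedSlope k δ 0 = 0 := by
  unfold linearizedSlope; simp

omit hk hδ in
theorem linearizedSlope_neg (z : ℝ) : linearizedSlope k δ (-z) = -linearizedSlope k δ z := by
  unfold linearizedSlope
  rw [abs_neg, neg_div]
  have : max (-1) (min 1 (-(z / δ))) = -max (-1) (min 1 (z / δ)) := by
    grind
  rw [this]; ring

omit hδ in
theorem abs_linearizedSlope_le (z : ℝ) : |linearizedSlope k δ z| ≤ B := by
  unfold linearizedSlope
  rw [abs_mul]
  have h1 := hk.bound (max |z| δ)
  have h2 : |max (-1) (min 1 (z / δ))| ≤ 1 := by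
    rw [abs_le]
    exact ⟨le_max_left _ _, max_le (by norm_num) (min_le_left _ _)⟩
  have := mul_le_mul h1 h2 (abs_nonneg _) hk.bound_nonneg
  linarith

theorem linearizedSlope_lip (z w : ℝ) :
    |linearizedSlope k δ z - linearizedSlope k δ w| ≤ (C + B / δ) * |z - w| := by
  unfold linearizedSlope
  set a := k (max |z| δ); set a' := k (max |w| δ)
  set b := max (-1) (min 1 (z / δ)); set b' := max (-1) (min 1 (w / δ))
  have h1 : |a - a'| ≤ C * |z - w| := by
    refine (hk.lip _ _ (lt_max_of_lt_right hδ) (lt_max_of_lt_right hδ)).trans ?_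
    refine mul_le_mul_of_nonneg_left ?_ hk.lip_nonneg
    refine (abs_max_sub_max_le_max _ _ _ _).trans ?_
    simpa using abs_abs_sub_abs_le z w
  have h2 : |b - b'| ≤ |z - w| / δ := by
    refine (abs_clamp_sub_le _ _).trans ?_
    rw [← sub_div, abs_div, abs_of_pos hδ]
  have h3 : |b| ≤ 1 := by
    rw [abs_le]
    exact ⟨le_max_left _ _, max_le (by norm_num) (min_le_left _ _)⟩
  have h4 : |a'| ≤ B := hk.bound _
  have e : a * b - a' * b' = (a - a') * b + a' * (b - b') := by ring
  rw [e]
  refine (abs_add_le _ _).trans ?_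
  rw [abs_mul, abs_mul]
  have h5 := mul_le_mul h1 h3 (abs_nonneg _) (mul_nonneg hk.lip_nonneg (abs_nonneg _))
  have h6 := mul_le_mul h4 h2 (abs_nonneg _) hk.bound_nonneg
  have e2 : (C + B / δ) * |z - w| = C * |z - w| * 1 + B * (|z - w| / δ) := by ring
  linarith

end SlopeBound

section Cutoff

variable {L : ℝ} (n : ℕ)

theorem abs_antipodalCutoff_le (z : ℝ) : |antipodalCutoff L n z| ≤ 1 := by
  unfold antipodalCutoff
  rw [abs_of_nonneg (le_max_left _ _)]
  exact max_le zero_le_one (min_le_left _ _)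

theorem antipodalCutoff_lip (z w : ℝ) :
    |antipodalCutoff L n z - antipodalCutoff L n w| ≤ n * |z - w| := by
  unfold antipodalCutoff
  refine (abs_max_sub_max_le_max _ _ _ _).trans ?_
  simp only [sub_self, abs_zero]
  refine max_le (by positivity) ((abs_min_sub_min_le_max _ _ _ _).trans ?_)
  simp only [sub_self, abs_zero]
  refine max_le (by positivity) ?_
  rw [← mul_sub, abs_mul, Nat.abs_cast]
  refine mul_le_mul_of_nonneg_left ?_ (by positivity)
  rw [show L / 2 - |z| - (L / 2 - |w|) = |w| - |z| by ring, abs_sub_comm z w]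
  exact abs_abs_sub_abs_le w z

theorem antipodalCutoff_half (hL : 0 < L) : antipodalCutoff L n (L / 2) = 0 := by
  unfold antipodalCutoff
  rw [abs_of_pos (by linarith)]; simp

theorem antipodalCutoff_neg (z : ℝ) : antipodalCutoff L n (-z) = antipodalCutoff L n z := by
  unfold antipodalCutoff; rw [abs_neg]

end Cutoff

/-- The regularized slope on the torus. -/
def regularizedSlope (k : ℝ → ℝ) (δ L : ℝ) (n : ℕ) (z : ℝ) : ℝ :=
  linearizedSlope k δ (torusRep L z) * antipodalCutoff L n (torusRep L z)

namespace SlopeBound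

variable {k : ℝ → ℝ} {B C δ L : ℝ} (hk : SlopeBound k B C) (hδ : 0 < δ) (hL : 0 < L)

include hL in
theorem regularizedSlope_periodic (n : ℕ) : Function.Periodic (regularizedSlope k δ L n) L :=
  fun z => by unfold regularizedSlope; rw [torusRep_periodic hL]

include hL in
theorem regularizedSlope_neg (n : ℕ) (z : ℝ) :
    regularizedSlope k δ L n (-z) = -regularizedSlope k δ L n z := by
  unfold regularizedSlope
  by_cases h : torusRep L z = -(L / 2)
  · rw [torusRep_neg_of_eq hL h, h, antipodalCutoff_neg, antipodalCutoff_half n hL]; simp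
  · rw [torusRep_neg hL h, linearizedSlope_neg, antipodalCutoff_neg]; ring

theorem abs_regularizedSlope_le_linearized (n : ℕ) (z : ℝ) :
    |regularizedSlope k δ L n z| ≤ |linearizedSlope k δ (torusRep L z)| := by
  unfold regularizedSlope
  rw [abs_mul]
  exact mul_le_of_le_one_right (abs_nonneg _) (abs_antipodalCutoff_le n _)

include hk in
theorem abs_regularizedSlope_le (n : ℕ) (z : ℝ) : |regularizedSlope k δ L n z| ≤ B :=
  (SlopeBound.abs_regularizedSlope_le_linearized n z).trans (hk.abs_linearizedSlope_le _)

include hk hδ hL in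
theorem regularizedSlope_lip (n : ℕ) (z w : ℝ) :
    |regularizedSlope k δ L n z - regularizedSlope k δ L n w| ≤
      (C + B / δ + B * n) * |z - w| := by
  refine abs_comp_torusRep_sub_le (g := fun u => linearizedSlope k δ u * antipodalCutoff L n u) hL
    (fun u _ v _ => ?_) ?_ z w
  · have h1 := hk.linearizedSlope_lip hδ u v
    have h2 := hk.abs_linearizedSlope_le (δ := δ) v
    have h3 := abs_antipodalCutoff_le (L := L) n u
    have h4 := antipodalCutoff_lip (L := L) n u v
    set a := linearizedSlope k δ u; set a' := linearizedSlope k δ v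
    set b := antipodalCutoff L n u; set b' := antipodalCutoff L n v
    have e : a * b - a' * b' = (a - a') * b + a' * (b - b') := by ring
    simp only [e]
    refine (abs_add_le _ _).trans ?_
    rw [abs_mul, abs_mul]
    have h5 := mul_le_mul h1 h3 (abs_nonneg _) ((abs_nonneg _).trans h1)
    have h6 := mul_le_mul h2 h4 (abs_nonneg _) hk.bound_nonneg
    linarith
  · simp only [antipodalCutoff_neg, antipodalCutoff_half n hL, mul_zero]

include hk hδ hL in
theorem regularizedSlope_regular {z : ℝ} (hz : torusRep L z ≠ -(L / 2)) {ε : ℝ} (hε : 0 < ε) :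
    ∃ η > 0, ∀ᶠ n in atTop, ∀ w, |w - z| < η →
      |regularizedSlope k δ L n w - linearizedSlope k δ (torusRep L z)| ≤ ε := by
  have hB := hk.bound_nonneg
  have hC := hk.lip_nonneg
  have hm := torusRep_mem hL z
  obtain ⟨m, hm2⟩ := exists_torusRep_eq L z
  set r := torusRep L z
  have hr : |r| < L / 2 := abs_lt.2 ⟨lt_of_le_of_ne hm.1 (Ne.symm hz), hm.2⟩
  set A := C + B / δ with hA
  have hA0 : 0 ≤ A := by positivity
  have hη1 : 0 < (L / 2 - |r|) / 2 := by linarith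
  -- Within the first distance, points stay at least `(L/2 - |r|)/2` away from the antipode, and the
  -- cutoff is `1` there for large `n`; the second distance is for the Lipschitz bound of the
  -- linearized slope.
  refine ⟨min ((L / 2 - |r|) / 2) (ε / (A + 1)), by positivity, ?_⟩
  filter_upwards [eventually_ge_atTop ⌈1 / ((L / 2 - |r|) / 2)⌉₊] with n hn w hw
  have h1 : |w - z| < (L / 2 - |r|) / 2 := hw.trans_le (min_le_left _ _)
  have h2 : |w - z| < ε / (A + 1) := hw.trans_le (min_le_right _ _)
  have hwm : w - m * L = r + (w - z) := by rw [hm2]; ring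
  have habs : |w - m * L| ≤ |r| + |w - z| := by rw [hwm]; exact abs_add_le _ _
  have hrep : torusRep L w = w - m * L := torusRep_eq_sub hL (by
    have := abs_le.1 habs
    constructor <;> linarith)
  unfold regularizedSlope
  rw [hrep]
  have hcut : antipodalCutoff L n (w - m * L) = 1 := by
    unfold antipodalCutoff
    have hn' : 1 / ((L / 2 - |r|) / 2) ≤ n := (Nat.le_ceil _).trans (by exact_mod_cast hn)
    rw [div_le_iff₀ hη1] at hn'
    have : 1 ≤ n * (L / 2 - |w - m * L|) := hn'.trans (by gcongr; linarith)
    rw [min_eq_left this]; simp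
  rw [hcut, mul_one]
  refine (hk.linearizedSlope_lip hδ _ _).trans ?_
  rw [hwm, add_sub_cancel_left]
  rw [lt_div_iff₀ (by positivity)] at h2
  nlinarith [abs_nonneg (w - z)]

include hk hδ hL in
-- At the antipode only a bound survives: the cutoff connects the one-sided slopes `±K'(L/2)`, so
-- any value between them may appear in the limit. The condition `δ ≤ L/2` keeps the linearization
-- at the origin from changing the value at the antipode.
theorem regularizedSlope_singular (hδL : δ ≤ L / 2) {z : ℝ} (hz : torusRep L z = -(L / 2)) {ε : ℝ}
    (hε : 0 < ε) : ∃ η > 0, ∀ n, ∀ w, |w - z| < η →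
      |regularizedSlope k δ L n w| ≤ |k (L / 2)| + ε := by
  have hB := hk.bound_nonneg
  have hC := hk.lip_nonneg
  set A := C + B / δ with hA
  have hA0 : 0 ≤ A := by positivity
  refine ⟨ε / (A + 1), by positivity, fun n w hw => ?_⟩
  refine (SlopeBound.abs_regularizedSlope_le_linearized n w).trans ?_
  have h1 := abs_comp_torusRep_sub_le (g := fun u => |linearizedSlope k δ u|) (A := A) hL
    (fun u _ v _ => (abs_abs_sub_abs_le _ _).trans (hk.linearizedSlope_lip hδ u v))
    (by simp only [linearizedSlope_neg, abs_neg]) w z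
  have h2 : |linearizedSlope k δ (torusRep L z)| = |k (L / 2)| := by
    rw [hz, linearizedSlope_neg, abs_neg, hk.linearizedSlope_of_le hδ]
    rwa [abs_of_pos (by linarith)]
  simp only [h2] at h1
  rw [lt_div_iff₀ (by positivity)] at hw
  have h3 := (abs_le.1 h1).2
  nlinarith [abs_nonneg (w - z)]

end SlopeBound

/-! ### Well-prepared initial positions -/

/-- Quantiles of the datum on one period, extended to all integers through quotient and remainder
modulo `N`. -/
theorem IsDatum.exists_initial {q : ℝ → ℝ} {m M L : ℝ} (hq : IsDatum q m M) (hL : 0 < L) {N : ℕ}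
    (hN : 0 < N) : ∃ y : ℤ → ℝ, IsConfig N L y ∧ y 0 = -(L / 2) ∧
      (∀ k : ℤ, 1 ≤ k → k < N →
        IsLUB {z | z ∈ Icc (-(L / 2)) (L / 2) ∧ ∫ u in (y (k - 1))..z, q u < cellMass q L / N}
          (y k)) ∧
      ∀ k, cellMass q L / (N * M) ≤ y (k + 1) - y k := by
  have hc := hq.cellMass_pos hL
  have hN' : (0 : ℝ) < N := by exact_mod_cast hN
  have hNz : (0 : ℤ) < N := by exact_mod_cast hN
  have hM := hq.pos_bound
  have hz : ∀ i : ℕ, ∃ z, i ≤ N → z ∈ Icc (-(L / 2)) (L / 2) ∧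
      ∫ u in (-(L / 2))..z, q u = i * (cellMass q L / N) := fun i => by
    by_cases hi : i ≤ N
    · obtain ⟨z, h1, h2⟩ := hq.exists_quantile hL (a := i * (cellMass q L / N)) (by positivity) (by
        have : (i : ℝ) ≤ N := by exact_mod_cast hi
        rw [mul_div_assoc', div_le_iff₀ hN', mul_comm]
        gcongr)
      exact ⟨z, fun _ => ⟨h1, h2⟩⟩
    · exact ⟨0, fun h => absurd h hi⟩
  choose z hz using hz
  have hinj := (hq.cdf_strictMono (-(L / 2))).injective
  have hz0 : z 0 = -(L / 2) := hinj (by simp [(hz 0 (by omega)).2])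
  have hzN : z N = L / 2 := hinj (by
    simp only [(hz N le_rfl).2]
    change _ = cellMass q L
    field_simp)
  have hzgap : ∀ i < N, ∫ u in (z i)..(z (i + 1)), q u = cellMass q L / N := fun i hi => by
    have h3 := intervalIntegral.integral_add_adjacent_intervals
      (hq.integrable.intervalIntegrable (a := -(L / 2)) (b := z i))
      (hq.integrable.intervalIntegrable (a := z i) (b := z (i + 1)))
    rw [(hz i hi.le).2, (hz (i + 1) hi).2] at h3
    push_cast at h3; linarith
  have hzlt : ∀ i < N, z i < z (i + 1) := fun i hi => by
    rw [← (hq.cdf_strictMono (-(L / 2))).lt_iff_lt]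
    simp only [(hz i hi.le).2, (hz (i + 1) hi).2]
    push_cast
    have : 0 < cellMass q L / N := by positivity
    linarith
  let y : ℤ → ℝ := fun k => z (k % N).toNat + ((k / N : ℤ) : ℝ) * L
  have hy : ∀ i : ℕ, i < N → y i = z i := fun i hi => by
    have h1 : (i : ℤ) % N = i := Int.emod_eq_of_lt (by omega) (by omega)
    have h2 : (i : ℤ) / N = 0 := Int.ediv_eq_zero_of_lt (by omega) (by omega)
    simp [y, h1, h2]
  have hgap : ∀ k, ∃ i < N, y (k + 1) - y k = z (i + 1) - z i := fun k => by
    have h1 := Int.emod_lt_of_pos k hNz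
    have h2 := Int.emod_nonneg k hNz.ne'
    have h3 := Int.mul_ediv_add_emod k N
    refine ⟨(k % N).toNat, by omega, ?_⟩
    by_cases h : k % N + 1 < N
    · have e1 : (k + 1) % N = k % N + 1 := by
        rw [Int.add_emod, Int.emod_eq_of_lt (a := 1) (by omega) (by omega),
          Int.emod_eq_of_lt (by omega) h]
      have e2 : (k + 1) / N = k / N := by
        have h4 := Int.mul_ediv_add_emod (k + 1) N
        rw [e1] at h4
        have h5 : (N : ℤ) * ((k + 1) / N) = N * (k / N) := by linarith
        exact mul_left_cancel₀ hNz.ne' h5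
      simp only [y, e1, e2]
      rw [show (k % N + 1).toNat = (k % N).toNat + 1 by omega]
      ring
    -- The last cell of a period: it ends at `z N = L/2`, which is `z 0 = -L/2` moved by one period.
    · have h' : k % N = N - 1 := by omega
      have e0 : k + 1 = (N : ℤ) * (k / N + 1) := by rw [h'] at h3; linarith
      have e1 : (k + 1) % N = 0 := by rw [e0]; simp
      have e2 : (k + 1) / N = k / N + 1 := by
        rw [e0, Int.mul_ediv_cancel_left _ hNz.ne']
      simp only [y, e1, e2]
      rw [show (k % N).toNat + 1 = N by omega, hzN]
      simp only [Int.toNat_zero, hz0]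
      push_cast; ring
  refine ⟨y, ⟨hN, hL, fun k => ?_, fun k => ?_⟩, ?_, fun k hk1 hkN => ?_, fun k => ?_⟩
  · simp only [y, Int.add_emod_right, Int.add_ediv_of_dvd_right (dvd_refl (N : ℤ)),
      Int.ediv_self hNz.ne']
    push_cast; ring
  · obtain ⟨i, hi, e⟩ := hgap k
    have := hzlt i hi
    linarith
  · have := hy 0 hN
    rw [hz0] at this
    simpa using this
  · obtain ⟨i, rfl⟩ : ∃ i : ℕ, k = (i : ℤ) + 1 := ⟨(k - 1).toNat, by omega⟩
    have hi : i + 1 < N := by omega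
    have e1 := hy i (by omega)
    have e2 := hy (i + 1) hi
    push_cast at e2
    rw [add_sub_cancel_right, e1, e2]
    refine hq.isLUB_quantile (hz (i + 1) hi.le).1 ?_ ?_
    · exact lt_of_le_of_lt (hz i (by omega)).1.1 (hzlt i (by omega))
    · rw [(hz i (by omega)).2, (hz (i + 1) hi.le).2]; push_cast; ring
  · obtain ⟨i, hi, e⟩ := hgap k
    rw [e]
    have h2 := hq.integral_le (hzlt i hi).le
    rw [hzgap i hi, div_le_iff₀ hN'] at h2
    rw [div_le_iff₀ (by positivity)]
    linarith

/-! ### Existence of particle evolutions -/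

theorem IsConfig.le_abs_sub {N : ℕ} {L δ : ℝ} {x : ℤ → ℝ} (hx : IsConfig N L x)
    (hδ : ∀ k, δ ≤ x (k + 1) - x k) {k j : ℤ} (h : k ≠ j) : δ ≤ |x k - x j| := by
  wlog hkj : k < j generalizing k j
  · rw [abs_sub_comm]
    exact this h.symm (by omega)
  have h1 := hx.strictMono.monotone (show k + 1 ≤ j by omega)
  have h2 := hδ k
  rw [abs_sub_comm]
  exact (by linarith : δ ≤ x j - x k).trans (le_abs_self _)

theorem exists_particleEvolution {K W φ q : ℝ → ℝ} {B C T L m M : ℝ}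
    (hk : SlopeBound (deriv K) B C) (hφ : AdmissibleDiffusion W φ) (hT : 0 < T) (hL : 0 < L)
    (hq : IsDatum q m M) {N : ℕ} (hN : 0 < N) : ∃ x, IsParticleEvolution K φ T L q N x := by
  have hc := hq.cellMass_pos hL
  have hM := hq.pos_bound
  have hN' : (0 : ℝ) < N := by exact_mod_cast hN
  have hm : 0 ≤ m := hc.le.trans (hq.cellMass_le hL)
  obtain ⟨R, Q, hR, hQ, hbounds⟩ := exists_evolution_bounds hk hφ T m M hm hM
  obtain ⟨y, hy, hy0, hylub, hygap⟩ := hq.exists_initial hL hN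
  set c := cellMass q L with hcdef
  -- The density bound `R` keeps widths above `c/(NR)` and the initial widths are at least `c/(NM)`;
  -- `δ` is at most half of either. The last term keeps the linearization of the slope away from the
  -- antipode.
  let δ : ℝ := min (min (c / (N * R) / 2) (c / (N * M) / 2)) (L / 4)
  have hδ : 0 < δ := by positivity
  have hδR : 2 * δ ≤ c / (N * R) := by
    have : δ ≤ c / (N * R) / 2 := (min_le_left _ _).trans (min_le_left _ _)
    linarith
  have hδM : 2 * δ ≤ c / (N * M) := by
    have : δ ≤ c / (N * M) / 2 := (min_le_left _ _).trans (min_le_right _ _)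
    linarith
  have hδL : δ ≤ L / 2 := (min_le_right _ _).trans (by linarith)
  -- The pressure, frozen for widths below `δ`.
  let h : ℝ → ℝ := fun g => N / c * φ (c / (N * max g δ))
  obtain ⟨A, hA0, hA⟩ := hφ.exists_lipschitz (c / (N * δ))
  have hrange : ∀ g, c / (N * max g δ) ∈ Icc 0 (c / (N * δ)) := fun g => by
    have : δ ≤ max g δ := le_max_right _ _
    have hpos : 0 < max g δ := hδ.trans_le this
    exact ⟨by positivity, by gcongr⟩
  have hhB : ∀ g, |h g| ≤ N / c * φ (c / (N * δ)) := fun g => by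
    have h1 := hrange g
    have h2 := hφ.nonneg h1.1
    rw [abs_of_nonneg (by positivity)]
    exact mul_le_mul_of_nonneg_left (hφ.mono h1.1 h1.2) (by positivity)
  have hhA : ∀ g g', |h g - h g'| ≤ N / c * (A * (c / (N * δ ^ 2))) * |g - g'| := fun g g' => by
    have h1 := hA _ (hrange g) _ (hrange g')
    simp only [h]
    rw [← mul_sub, abs_mul, abs_of_pos (by positivity), mul_assoc]
    refine mul_le_mul_of_nonneg_left ?_ (by positivity)
    refine h1.trans ?_
    rw [mul_assoc]
    refine mul_le_mul_of_nonneg_left ?_ hA0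
    have ha : δ ≤ max g δ := le_max_right _ _
    have hb : δ ≤ max g' δ := le_max_right _ _
    have hab : |max g' δ - max g δ| ≤ |g - g'| := by
      refine (abs_max_sub_max_le_max _ _ _ _).trans ?_
      rw [abs_sub_comm g]; simp
    set a := max g δ
    set b := max g' δ
    have ha0 : 0 < a := hδ.trans_le ha
    have hb0 : 0 < b := hδ.trans_le hb
    have e : c / (N * a) - c / (N * b) = c / N * ((b - a) / (a * b)) := by field_simp
    rw [e, abs_mul, abs_of_pos (show 0 < c / N by positivity), abs_div,
      abs_of_pos (show 0 < a * b by positivity)]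
    have hab2 : δ ^ 2 ≤ a * b := by nlinarith
    calc c / N * (|b - a| / (a * b)) ≤ c / N * (|g - g'| / δ ^ 2) := by gcongr
      _ = _ := by field_simp
  obtain ⟨x, hx0, hxp, hxlip, hxode⟩ := exists_inclusion_evolution (L := L) (a := c / N)
    (b := |deriv K (L / 2)|) hN hT (by positivity) (abs_nonneg _) hy.periodic
    (g := regularizedSlope (deriv K) δ L)
    (g₀ := fun z => linearizedSlope (deriv K) δ (torusRep L z))
    (P := {z | torusRep L z = -(L / 2)})
    (fun n => SlopeBound.regularizedSlope_periodic hL n)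
    (fun n z => SlopeBound.regularizedSlope_neg hL n z)
    (fun n z => hk.abs_regularizedSlope_le n z)
    (fun n z w => hk.regularizedSlope_lip hδ hL n z w) hhB hhA
    (fun z hz ε hε => hk.regularizedSlope_regular hδ hL hz hε)
    (fun z hz ε hε => hk.regularizedSlope_singular hδ hL hδL hz hε)
  set Λ := c / N * (N * B) + 2 * (N / c * φ (c / (N * δ)))
  have hΛ0 : 0 ≤ Λ := by
    have h1 := hφ.nonneg (show 0 ≤ c / (N * δ) by positivity)
    have := hk.bound_nonneg
    positivity
  -- As long as the widths are at least `δ`, the frozen pressure is the true one. Distinct particles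
  -- are then at distance at least `δ` on the torus, where the linearized slope equals `K'`, so the
  -- solution of the inclusion is a genuine evolution.
  have key : ∀ τ, 0 < τ → τ ≤ T → (∀ t ∈ Icc 0 τ, ∀ k, δ ≤ x (k + 1) t - x k t) →
      IsParticleEvolution K φ τ L q N x := by
    intro τ hτ hτT hgap
    have hsub : Icc 0 τ ⊆ Icc 0 T := Icc_subset_Icc le_rfl hτT
    have hconf : ∀ t ∈ Icc 0 τ, IsConfig N L (fun k => x k t) := fun t ht =>
      ⟨hN, hL, fun k => hxp k t (hsub ht), fun k => by linarith [hgap t ht k]⟩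
    refine ⟨fun k t ht => hxp k t (hsub ht), fun k t ht => (hconf t ht).lt k, by rw [hx0, hy0],
      fun k h1 h2 => by rw [hx0, hx0]; exact hylub k h1 h2, fun k => ?_, ?_⟩
    · have : LipschitzOnWith Λ.toNNReal (x k) (uIcc 0 τ) := LipschitzOnWith.of_dist_le_mul
        fun t ht s hs => by
          rw [uIcc_of_le hτ.le] at ht hs
          rw [Real.dist_eq, Real.dist_eq, Real.coe_toNNReal _ hΛ0]
          exact hxlip k t (hsub ht) s (hsub hs)
      exact this.absolutelyContinuousOnInterval
    · filter_upwards [ae_mono (Measure.restrict_mono hsub le_rfl) hxode,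
        ae_restrict_mem measurableSet_Icc] with t ht htI
      obtain ⟨κ, h1, h2, h3⟩ := ht
      have hx := hconf t htI
      refine ⟨κ, fun k j => ⟨fun hz => ?_, fun hz => (h1 k j).2 hz⟩, h2, fun k hkm => ?_⟩
      · rw [(h1 k j).1 hz]
        obtain ⟨n, hn⟩ := exists_torusRep_eq L (x k t - x j t)
        have e : torusRep L (x k t - x j t) = x k t - x (j + n * N) t := by
          rw [hn, hx.add_mul]; ring
        change linearizedSlope (deriv K) δ (torusRep L (x k t - x j t)) = _
        rw [e]
        by_cases hkj : k = j + n * N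
        · rw [← hkj, sub_self, SlopeBound.linearizedSlope_zero, hk.zero]
        · exact hk.linearizedSlope_of_le hδ (hx.le_abs_sub (hgap t htI) hkj)
      · have h4 := h3 k
        have hkk : κ k k = 0 := by have := h2 k k; linarith
        rw [← Finset.add_sum_erase _ _ hkm, hkk, zero_add] at h4
        refine h4.congr_deriv ?_
        have g1 := max_eq_left (hgap t htI k)
        have g2 := max_eq_left (hgap t htI (k - 1))
        rw [sub_add_cancel] at g2
        simp only [h, g1, g2, cellDensity, sub_add_cancel]
        ring
  -- In time `ε` a width loses at most `2Λε ≤ δ`. Widths of at least `2δ` up to time `nε` thus give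
  -- at least `δ` up to time `(n+1)ε`; on that interval the evolution is genuine, and the a priori
  -- bound improves `δ` to `2δ` again.
  let ε : ℝ := δ / (2 * Λ + 1)
  have hε : 0 < ε := by positivity
  have hind : ∀ n : ℕ, ∀ t ∈ Icc 0 T, t ≤ n * ε → ∀ k, 2 * δ ≤ x (k + 1) t - x k t := by
    intro n
    induction n with
    | zero =>
      intro t ht htn k
      have : t = 0 := le_antisymm (by simpa using htn) ht.1
      rw [this, hx0, hx0]
      exact hδM.trans (hygap k)
    | succ n ih =>
      intro t ht htn k
      rcases eq_or_lt_of_le ht.1 with h0 | h0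
      · rw [← h0, hx0, hx0]
        exact hδM.trans (hygap k)
      have hgap : ∀ s ∈ Icc 0 t, ∀ k, δ ≤ x (k + 1) s - x k s := by
        intro s hs k
        have hsT : s ∈ Icc 0 T := ⟨hs.1, hs.2.trans ht.2⟩
        have hs' : max (s - ε) 0 ∈ Icc 0 T := ⟨le_max_right _ _, max_le (by linarith [hsT.2]) hT.le⟩
        have h1 := ih _ hs' (max_le (by push_cast at htn; linarith [hs.2]) (by positivity)) k
        have hd : |s - max (s - ε) 0| ≤ ε := by
          rw [abs_of_nonneg (sub_nonneg.2 (max_le (by linarith) hs.1))]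
          linarith [le_max_left (s - ε) 0]
        have h2 := (hxlip (k + 1) s hsT _ hs').trans (mul_le_mul_of_nonneg_left hd hΛ0)
        have h3 := (hxlip k s hsT _ hs').trans (mul_le_mul_of_nonneg_left hd hΛ0)
        have h4 : 2 * (Λ * ε) ≤ δ := by
          have : ε * (2 * Λ + 1) = δ := by simp only [ε]; field_simp
          nlinarith
        have := (abs_le.1 h2).1
        have := (abs_le.1 h3).2
        linarith
      have hE := key t h0 ht.2 hgap
      have h1 := (hbounds t L q N x h0 ht.2 hL hq hE).1 t ⟨h0.le, le_rfl⟩ k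
      have hx := hE.isConfig h0 hL (t := t) ⟨h0.le, le_rfl⟩
      have h2 := hx.gap_eq hc k
      have h3 := hx.cell_pos hc k
      rw [h2]
      refine hδR.trans ?_
      gcongr
  refine ⟨x, key T hT le_rfl fun t ht k => ?_⟩
  obtain ⟨n, hn⟩ := exists_nat_ge (t / ε)
  rw [div_le_iff₀ hε] at hn
  linarith [hind n t ht hn k]

end AggDiff

end

noncomputable section

namespace AggDiff

/-! ### Periodization of functions on the fundamental domain -/

section Periodize

variable {L : ℝ} (hL : 0 < L) {g : ℝ → ℝ} {A : ℝ}
  (hg : ∀ u ∈ Icc (-(L / 2)) (L / 2), ∀ v ∈ Icc (-(L / 2)) (L / 2), |g u - g v| ≤ A * |u - v|)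
  (hb : g (-(L / 2)) = g (L / 2))

include hL hg hb in
theorem continuous_comp_torusRep : Continuous fun y => g (torusRep L y) := by
  have hA : 0 ≤ A := by
    have := (abs_nonneg _).trans (abs_comp_torusRep_sub_le hL hg hb 1 0)
    simpa using this
  have : LipschitzWith A.toNNReal fun y => g (torusRep L y) :=
    LipschitzWith.of_dist_le_mul fun y z => by
      rw [Real.dist_eq, Real.dist_eq, Real.coe_toNNReal _ hA]
      exact abs_comp_torusRep_sub_le hL hg hb y z
  exact this.continuous

include hL in
theorem periodic_comp_torusRep (g : ℝ → ℝ) : Function.Periodic (fun y => g (torusRep L y)) L :=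
  fun y => by simp only [torusRep_periodic hL y]

include hL in
theorem integral_mul_comp_torusRep (u g : ℝ → ℝ) :
    ∫ y in (-(L / 2))..(L / 2), u y * g (torusRep L y) = ∫ y in (-(L / 2))..(L / 2), u y * g y := by
  refine intervalIntegral.integral_congr_ae ?_
  filter_upwards [Measure.ae_ne volume (L / 2)] with y hy hy2
  rw [uIoc_of_le (by linarith)] at hy2
  rw [torusRep_eq_self hL ⟨hy2.1.le, lt_of_le_of_ne hy2.2 hy⟩]

end Periodize

/-! ### Transport of the density -/

namespace IsConfig

variable {N : ℕ} {L c : ℝ} {x x' : ℤ → ℝ}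

/-- Each density is replaced by its empirical measure at the cost `(c/N) L`, and the two empirical
measures differ by the transport of the particles. -/
theorem abs_integral_sub_le (hx : IsConfig N L x) (hx' : IsConfig N L x') (hc : 0 < c)
    {g : ℝ → ℝ} {A : ℝ}
    (hg : ∀ u ∈ Icc (-(L / 2)) (L / 2), ∀ v ∈ Icc (-(L / 2)) (L / 2), |g u - g v| ≤ A * |u - v|)
    (hb : g (-(L / 2)) = g (L / 2)) :
    |(∫ y in (-(L / 2))..(L / 2), configDensity c N x y * g y) -
      ∫ y in (-(L / 2))..(L / 2), configDensity c N x' y * g y| ≤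
      A * (c / N * ∑ k ∈ Finset.Ico (0 : ℤ) N, |x k - x' k| + 2 * (c / N * L)) := by
  have hL := hx.length_pos
  have hN := hx.natCast_pos
  have hlip := abs_comp_torusRep_sub_le hL hg hb
  have hcont := continuous_comp_torusRep hL hg hb
  have h1 := hx.abs_quadrature_le hc hlip hcont (periodic_comp_torusRep hL g)
  have h2 := hx'.abs_quadrature_le hc hlip hcont (periodic_comp_torusRep hL g)
  rw [integral_mul_comp_torusRep hL] at h1 h2
  have h3 : |c / N * ∑ k ∈ Finset.Ico (0 : ℤ) N, g (torusRep L (x k)) -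
      c / N * ∑ k ∈ Finset.Ico (0 : ℤ) N, g (torusRep L (x' k))| ≤
      c / N * (A * ∑ k ∈ Finset.Ico (0 : ℤ) N, |x k - x' k|) := by
    rw [← mul_sub, ← Finset.sum_sub_distrib, abs_mul, abs_of_pos (by positivity), Finset.mul_sum]
    refine mul_le_mul_of_nonneg_left ?_ (by positivity)
    exact (Finset.abs_sum_le_sum_abs _ _).trans (Finset.sum_le_sum fun k _ => hlip _ _)
  rw [abs_le] at h1 h2 h3 ⊢
  constructor <;> nlinarith

/-- On a small interval the density is close to its weighted average. -/
theorem abs_density_sub_average_le (hx : IsConfig N L x) (hc : 0 < c) {φ : ℝ → ℝ} {R D ε : ℝ}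
    (hR : ∀ k, configCell c N x k ≤ R)
    (hD : ∀ r ∈ Icc 0 R, ∀ s ∈ Icc 0 R, |r - s| ≤ ε + D * |φ r - φ s|) (hD0 : 0 ≤ D)
    {I : Set ℝ} (hI : I.OrdConnected) (hIL : I ⊆ Ico (-(L / 2)) (L / 2)) {f : ℝ → ℝ}
    (hf : Continuous f) (hf0 : ∀ y, 0 ≤ f y) (hfI : ∀ y ∉ I, f y = 0)
    (hf1 : ∫ y in (-(L / 2))..(L / 2), f y = 1) {z : ℝ} (hz : z ∈ I) :
    |configDensity c N x z - ∫ y in (-(L / 2))..(L / 2), configDensity c N x y * f y| ≤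
      ε + D * ∑ j ∈ Finset.Ico (0 : ℤ) N,
        I.indicator (fun _ => |φ (configCell c N x j) - φ (configCell c N x (j - 1))|)
          (torusRep L (x j)) := by
  have hL := hx.length_pos
  set O := ∑ j ∈ Finset.Ico (0 : ℤ) N,
        I.indicator (fun _ => |φ (configCell c N x j) - φ (configCell c N x (j - 1))|)
          (torusRep L (x j))
  have hi := hx.intervalIntegrable_mul_density hc hR hf (-(L / 2)) (L / 2)
  have e : configDensity c N x z - ∫ y in (-(L / 2))..(L / 2), configDensity c N x y * f y =
      ∫ y in (-(L / 2))..(L / 2), (configDensity c N x z * f y - configDensity c N x y * f y) := by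
    rw [intervalIntegral.integral_sub ((hf.intervalIntegrable _ _).const_mul _) hi,
      intervalIntegral.integral_const_mul, hf1, mul_one]
  have hmem : ∀ y, configDensity c N x y ∈ Icc 0 R := fun y =>
    ⟨(hx.density_pos hc y).le, hx.density_le hR y⟩
  have hpt : ∀ y, |configDensity c N x z * f y - configDensity c N x y * f y| ≤
      (ε + D * O) * f y := fun y => by
    by_cases hy : y ∈ I
    · rw [← sub_mul, abs_mul, abs_of_nonneg (hf0 y)]
      refine mul_le_mul_of_nonneg_right ?_ (hf0 y)
      refine (hD _ (hmem z) _ (hmem y)).trans ?_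
      have := hx.abs_comp_density_sub_le (c := c) φ hI hIL hz hy
      have := mul_le_mul_of_nonneg_left this hD0
      linarith
    · rw [hfI y hy]; simp
  rw [e]
  refine (intervalIntegral.abs_integral_le_integral_abs (by linarith)).trans ?_
  have := intervalIntegral.integral_mono_on (μ := volume) (a := -(L / 2)) (b := L / 2)
    (by linarith) (((hf.intervalIntegrable _ _).const_mul _).sub hi).abs
    ((hf.intervalIntegrable _ _).const_mul (ε + D * O)) (fun y _ => hpt y)
  rwa [intervalIntegral.integral_const_mul, hf1, mul_one] at this

end IsConfig

namespace IsParticleEvolution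

variable {K W φ q : ℝ → ℝ} {T L B C m M : ℝ} {N : ℕ} {x : ℤ → ℝ → ℝ}

/-- The particle density agrees on the time interval with a measurable function. -/
theorem exists_measurable_eq (hE : IsParticleEvolution K φ T L q N x) (hT : 0 < T) (hL : 0 < L)
    (c : ℝ) : ∃ u : ℝ × ℝ → ℝ, Measurable u ∧
      ∀ p : ℝ × ℝ, p.1 ∈ Icc 0 T → particleDensity c N x p = u p := by
  -- Positions are continuous only on `[0, T]`; clamping the time makes them continuous on the whole
  -- line.
  let τ : ℝ → ℝ := fun t => max 0 (min T t)
  have hτ : ∀ t, τ t ∈ Icc 0 T := fun t => ⟨le_max_left _ _, max_le hT.le (min_le_left _ _)⟩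
  have hτc : Continuous τ := by fun_prop
  have hxc : ∀ k, Continuous fun t => x k (τ t) := fun k =>
    (hE.continuousOn hT k).comp_continuous hτc hτ
  let X : ℤ → ℝ → ℝ := fun k t => x k (τ t)
  refine ⟨particleDensity c N X, ?_, fun p hp => ?_⟩
  · refine measurable_of_Iio fun a => ?_
    have : particleDensity c N X ⁻¹' Iio a = ⋃ k : ℤ,
        {p : ℝ × ℝ | X k p.1 ≤ p.2 ∧ p.2 < X (k + 1) p.1 ∧ cellDensity c N X k p.1 < a} := by
      ext p
      have hx := hE.isConfig hT hL (hτ p.1)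
      simp only [mem_preimage, mem_Iio, mem_iUnion, mem_ofPred_eq, particleDensity_eq]
      constructor
      · intro h
        obtain ⟨k, hk⟩ := hx.exists_mem_cell p.2
        have e := hx.density_eq (c := c) hk
        exact ⟨k, hk.1, hk.2, by rw [cellDensity_eq, ← e]; exact h⟩
      · rintro ⟨k, h1, h2, h3⟩
        have e := hx.density_eq (c := c) (k := k) (y := p.2) ⟨h1, h2⟩
        change configDensity c N (fun k => x k (τ p.1)) p.2 < a
        rw [e]; exact h3
    rw [this]
    refine MeasurableSet.iUnion fun k => ?_
    have h1 : Measurable fun p : ℝ × ℝ => X k p.1 := (hxc k).measurable.comp measurable_fst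
    have h2 : Measurable fun p : ℝ × ℝ => X (k + 1) p.1 :=
      (hxc (k + 1)).measurable.comp measurable_fst
    have h3 : Measurable fun p : ℝ × ℝ => cellDensity c N X k p.1 := by
      exact measurable_const.div (measurable_const.mul (h2.sub h1))
    exact (measurableSet_le h1 measurable_snd).inter
      ((measurableSet_lt measurable_snd h2).inter (measurableSet_lt h3 measurable_const))
  · have : τ p.1 = p.1 := by
      simp only [τ]; rw [min_eq_right hp.2, max_eq_right hp.1]
    simp only [particleDensity_eq, X, this]

theorem aestronglyMeasurable (hE : IsParticleEvolution K φ T L q N x) (hT : 0 < T) (hL : 0 < L)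
    (c : ℝ) {S : Set (ℝ × ℝ)} (hS : MeasurableSet S) (hST : ∀ p ∈ S, p.1 ∈ Icc 0 T) :
    AEStronglyMeasurable (particleDensity c N x) (volume.restrict S) := by
  obtain ⟨u, hu, h⟩ := hE.exists_measurable_eq hT hL c
  refine hu.aestronglyMeasurable.congr ?_
  filter_upwards [ae_restrict_mem hS] with p hp
  exact (h p (hST p hp)).symm

/-- The datum has mass exactly `c/N` in each initial cell, and moving this mass to the left end
costs the Lipschitz constant times the width. No regularity of the datum enters. -/
theorem abs_initial_quadrature_le (hE : IsParticleEvolution K φ T L q N x) (hT : 0 < T)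
    (hL : 0 < L) (hq : IsDatum q m M) {g : ℝ → ℝ} {A : ℝ}
    (hg : ∀ u ∈ Icc (-(L / 2)) (L / 2), ∀ v ∈ Icc (-(L / 2)) (L / 2), |g u - g v| ≤ A * |u - v|)
    (hb : g (-(L / 2)) = g (L / 2)) :
    |cellMass q L / N * ∑ k ∈ Finset.Ico (0 : ℤ) N, g (torusRep L (x k 0)) -
      ∫ y in (-(L / 2))..(L / 2), q y * g y| ≤ A * (cellMass q L / N * L) := by
  have hx := hE.isConfig hT hL (t := 0) ⟨le_rfl, hT.le⟩
  have hlip := abs_comp_torusRep_sub_le hL hg hb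
  have hA : 0 ≤ A := by
    have := (abs_nonneg _).trans (hlip 1 0)
    simpa using this
  have hcont := continuous_comp_torusRep hL hg hb
  set G : ℝ → ℝ := fun y => g (torusRep L y) with hG
  rw [← integral_mul_comp_torusRep hL]
  obtain ⟨D, hD⟩ := isCompact_Icc.exists_bound_of_continuousOn (s := Icc (-(L / 2)) (L / 2))
    hcont.continuousOn
  have hqG : ∀ a b, IntervalIntegrable (fun y => q y * G y) volume a b := fun a b =>
    hq.integrable.intervalIntegrable.mul_continuousOn hcont.continuousOn
  have hsum := intervalIntegral.sum_integral_adjacent_intervals (μ := volume) (n := N)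
    (f := fun y => q y * G y) (a := fun i : ℕ => x (i : ℤ) 0) (fun i _ => hqG _ _)
  have e0 : x ((0 : ℕ) : ℤ) 0 = -(L / 2) := hE.initial_zero
  have eN : x (N : ℤ) 0 = L / 2 := by
    have := hE.periodic 0 0 ⟨le_rfl, hT.le⟩
    rw [zero_add, hE.initial_zero] at this
    rw [this]; ring
  rw [e0, eN] at hsum
  have hsum2 : ∑ k ∈ Finset.Ico (0 : ℤ) N, G (x k 0) = ∑ i ∈ Finset.range N, G (x i 0) := by
    rw [sum_Ico_int_eq_sum_add (f := fun k => G (x k 0)) (fun k => by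
      simp only [hE.periodic k 0 ⟨le_rfl, hT.le⟩, hG, torusRep_periodic hL (x k 0)]) 0]
    simp
  have hgap2 : ∑ i ∈ Finset.range N, (x (i + 1 : ℤ) 0 - x i 0) = L := by
    have := Finset.sum_range_sub (fun i : ℕ => x (i : ℤ) 0) N
    rw [e0, eN] at this
    push_cast at this
    linarith
  change |cellMass q L / N * ∑ k ∈ Finset.Ico (0 : ℤ) N, G (x k 0) -
    ∫ y in (-(L / 2))..(L / 2), q y * G y| ≤ _
  rw [hsum2, ← hsum, Finset.mul_sum, ← Finset.sum_sub_distrib]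
  have hterm : ∀ i ∈ Finset.range N, |cellMass q L / N * G (x i 0) -
      ∫ y in (x (i : ℤ) 0)..(x ((i + 1 : ℕ) : ℤ) 0), q y * G y| ≤
      A * (cellMass q L / N) * (x (i + 1 : ℤ) 0 - x i 0) := by
    intro i hi
    have hm := hE.initial_cell hT hL hq i (by simpa using hi)
    push_cast
    have hlt : x (i : ℤ) 0 < x ((i : ℤ) + 1) 0 := hx.lt i
    have e : cellMass q L / N * G (x i 0) - ∫ y in (x (i : ℤ) 0)..(x ((i : ℤ) + 1) 0), q y * G y =
        ∫ y in (x (i : ℤ) 0)..(x ((i : ℤ) + 1) 0), (q y * G (x i 0) - q y * G y) := by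
      rw [intervalIntegral.integral_sub (hq.integrable.intervalIntegrable.mul_const _) (hqG _ _),
        intervalIntegral.integral_mul_const, hm]
    rw [e]
    refine (intervalIntegral.abs_integral_le_integral_abs hlt.le).trans ?_
    have hle := intervalIntegral.integral_mono_ae_restrict (μ := volume) hlt.le
      ((hq.integrable.intervalIntegrable.mul_const (G (x i 0))).sub (hqG _ _)).abs
      (hq.integrable.intervalIntegrable.mul_const (A * (x ((i : ℤ) + 1) 0 - x i 0))) (by
        filter_upwards [ae_restrict_mem measurableSet_Icc,
          hq.pos.filter_mono (ae_mono Measure.restrict_le_self)] with y hy hy2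
        rw [← mul_sub, abs_mul, abs_of_pos hy2]
        refine mul_le_mul_of_nonneg_left ?_ hy2.le
        refine (hlip _ _).trans (mul_le_mul_of_nonneg_left ?_ hA)
        rw [abs_sub_comm, abs_of_nonneg (by linarith [hy.1])]
        linarith [hy.2])
    rw [intervalIntegral.integral_mul_const, hm] at hle
    refine hle.trans (le_of_eq (by ring))
  refine (Finset.abs_sum_le_sum_abs _ _).trans ((Finset.sum_le_sum hterm).trans ?_)
  rw [← Finset.mul_sum, hgap2, mul_assoc]

end IsParticleEvolution

end AggDiff

end

noncomputable section

namespace AggDiff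

/-! ### Hat functions -/

/-- The integral of the hat function of half width `η`. -/
def hatMass (η : ℝ) : ℝ := ∫ y, max 0 (η - |y|)

/-- The hat function of half width `η` centred at `a`, with integral one. -/
def hat (η a y : ℝ) : ℝ := (hatMass η)⁻¹ * max 0 (η - |y - a|)

section Hat

variable {η : ℝ} (hη : 0 < η) (a : ℝ)

include hη in
theorem hatMass_pos : 0 < hatMass η := by
  refine Continuous.integral_pos_of_hasCompactSupport_nonneg_nonzero (x := 0) (by fun_prop) ?_
    (fun y => le_max_left _ _) ?_
  · refine HasCompactSupport.intro (isCompact_Icc (a := -η) (b := η)) fun y hy => ?_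
    refine max_eq_left ?_
    by_contra h
    push Not at h
    exact hy (abs_le.1 (by linarith))
  · simp [hη.ne', hη.le]

theorem continuous_hat : Continuous (hat η a) := by unfold hat; fun_prop

include hη in
theorem hat_nonneg (y : ℝ) : 0 ≤ hat η a y :=
  mul_nonneg (inv_nonneg.2 (hatMass_pos hη).le) (le_max_left _ _)

include hη in
theorem hat_lip (y z : ℝ) : |hat η a y - hat η a z| ≤ (hatMass η)⁻¹ * |y - z| := by
  have h := hatMass_pos hη
  unfold hat
  rw [← mul_sub, abs_mul, abs_of_pos (inv_pos.2 h)]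
  refine mul_le_mul_of_nonneg_left ?_ (inv_pos.2 h).le
  refine (abs_max_sub_max_le_max _ _ _ _).trans ?_
  simp only [sub_self, abs_zero]
  refine max_le (abs_nonneg _) ?_
  rw [show η - |y - a| - (η - |z - a|) = |z - a| - |y - a| by ring, abs_sub_comm y z]
  refine (abs_abs_sub_abs_le _ _).trans (le_of_eq ?_)
  congr 1; ring

theorem hat_eq_zero {y : ℝ} (h : η ≤ |y - a|) : hat η a y = 0 := by
  unfold hat; rw [max_eq_left (by linarith), mul_zero]

include hη in
theorem integral_hat {b c : ℝ} (hb : b ≤ a - η) (hc : a + η ≤ c) : ∫ y in b..c, hat η a y = 1 := by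
  rw [intervalIntegral.integral_eq_integral_of_support_subset]
  · unfold hat
    rw [integral_const_mul, integral_sub_right_eq_self (fun y => max 0 (η - |y|)) a]
    exact inv_mul_cancel₀ (hatMass_pos hη).ne'
  · intro y hy
    have : |y - a| < η := by
      by_contra h
      exact hy (hat_eq_zero a (not_lt.1 h))
    have := abs_lt.1 this
    constructor <;> linarith

end Hat

/-! ### Approximation by step functions -/

/-- The index of the cell of a uniform space-time grid. -/
def gridIndex (T Y : ℝ) (p n : ℕ) (z : ℝ × ℝ) : ℕ × ℕ :=
  (⌊z.1 * p / T⌋₊, ⌊(z.2 + Y) * n / (2 * Y)⌋₊)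

theorem measurable_gridIndex (T Y : ℝ) (p n : ℕ) : Measurable (gridIndex T Y p n) := by
  unfold gridIndex
  exact (Nat.measurable_floor.comp (by fun_prop)).prodMk (Nat.measurable_floor.comp (by fun_prop))

theorem floor_grid {l : ℝ} (hl : 0 < l) {n : ℕ} (hn : 0 < n) {z : ℝ} (hz : z ∈ Ico 0 l) :
    ⌊z * n / l⌋₊ < n ∧ l * (⌊z * n / l⌋₊ : ℝ) / n ≤ z ∧
      z < l * ((⌊z * n / l⌋₊ : ℝ) + 1) / n := by
  have hn' : (0 : ℝ) < n := by exact_mod_cast hn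
  have h0 : 0 ≤ z * n / l := by have := hz.1; positivity
  have h1 := Nat.floor_le h0
  have h2 := Nat.lt_floor_add_one (z * n / l)
  rw [le_div_iff₀ hl] at h1
  rw [div_lt_iff₀ hl] at h2
  refine ⟨?_, ?_, ?_⟩
  · rw [Nat.floor_lt h0, div_lt_iff₀ hl]
    have := hz.2
    nlinarith
  · rw [div_le_iff₀ hn']; linarith
  · rw [lt_div_iff₀ hn']; linarith

namespace IsParticleEvolution

variable {K W φ q : ℝ → ℝ} {T L B C m M : ℝ} {N : ℕ} {x : ℤ → ℝ → ℝ}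

/-- The step function takes on each space-time grid cell the hat average of the density at the
beginning of the time slab. At a fixed time the density differs from its hat average by its
oscillation on the spatial cell, which is controlled, through `D` and up to `ε`, by the jumps of
`φ(ρ)` at the particles inside. The hat average changes in time only by the displacement of the
particles and the quadrature error, times the Lipschitz constant of the hat; this is `θ`. -/
theorem integral_abs_sub_step_le (hk : SlopeBound (deriv K) B C) (hφ : AdmissibleDiffusion W φ)
    (hE : IsParticleEvolution K φ T L q N x) (hT : 0 < T) (hL : 0 < L) (hq : IsDatum q m M)
    {R Q : ℝ} (hR : ∀ t ∈ Icc 0 T, ∀ k, configCell (cellMass q L) N (fun k => x k t) k ≤ R)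
    (hQ : ∫ t in 0..T, dissipation φ (cellMass q L) N (fun k => x k t) ≤ Q)
    {D ε : ℝ} (hD : ∀ r ∈ Icc 0 R, ∀ s ∈ Icc 0 R, |r - s| ≤ ε + D * |φ r - φ s|) (hD0 : 0 ≤ D)
    {Y : ℝ} (hY : 0 < Y) (hYL : Y ≤ L / 2) {n p : ℕ} (hn : 0 < n) (hp : 0 < p) {α θ : ℝ}
    (hα : 0 < α) (hθ : (hatMass (Y / n))⁻¹ *
      (T / p * (m ^ 2 * B + m * α) + Q / α + 2 * (m / N * L)) ≤ θ) :
    ∃ b : ℕ × ℕ → ℝ, (∀ i < p, ∀ j < n, |b (i, j)| ≤ R) ∧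
      ∫ z in Ico 0 T ×ˢ Ico (-Y) Y,
        |particleDensity (cellMass q L) N x z - b (gridIndex T Y p n z)| ≤
        2 * Y * T * (ε + θ) + D * (2 * (2 * Y / n)) * (m * T + Q) := by
  have hc := hq.cellMass_pos hL
  have hcm := hq.cellMass_le hL
  have hB := hk.bound_nonneg
  have hx0 := hE.isConfig hT hL (t := 0) ⟨le_rfl, hT.le⟩
  have hN := hx0.natCast_pos
  have hn' : (0 : ℝ) < n := by exact_mod_cast hn
  have hp' : (0 : ℝ) < p := by exact_mod_cast hp
  have hη : 0 < Y / n := by positivity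
  have hZ := hatMass_pos hη
  have hm : 0 < m := hc.trans_le hcm
  set c := cellMass q L with hcdef
  let cen : ℕ → ℝ := fun j => -Y + Y * (2 * j + 1) / n
  let dens : ℝ → ℝ → ℝ := fun t => configDensity c N (fun k => x k t)
  let b : ℕ × ℕ → ℝ := fun ij =>
    ∫ y in (-(L / 2))..(L / 2), dens (T * ij.1 / p) y * hat (Y / n) (cen ij.2) y
  have hcen : ∀ j < n, -(L / 2) ≤ cen j - Y / n ∧ cen j + Y / n ≤ L / 2 := by
    intro j hj
    have hj' : (j : ℝ) + 1 ≤ n := by exact_mod_cast hj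
    have e1 : cen j - Y / n = -Y + Y * (2 * j) / n := by simp only [cen]; ring
    have e2 : cen j + Y / n = -Y + Y * (2 * (j + 1)) / n := by simp only [cen]; ring
    rw [e1, e2]
    constructor
    · have : 0 ≤ Y * (2 * j) / n := by positivity
      linarith
    · have : Y * (2 * (j + 1)) / n ≤ 2 * Y := by
        rw [div_le_iff₀ hn']; nlinarith
      linarith
  have htime : ∀ i : ℕ, i < p → T * i / p ∈ Icc 0 T := fun i hi => by
    refine ⟨by positivity, ?_⟩
    rw [div_le_iff₀ hp']
    have : (i : ℝ) ≤ p := by exact_mod_cast hi.le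
    gcongr
  have hhat1 : ∀ j < n, ∫ y in (-(L / 2))..(L / 2), hat (Y / n) (cen j) y = 1 := fun j hj =>
    integral_hat hη _ (hcen j hj).1 (hcen j hj).2
  refine ⟨b, fun i hi j hj => ?_, ?_⟩
  · have hx := hE.isConfig hT hL (htime i hi)
    have hRi := hR _ (htime i hi)
    have hint := hx.intervalIntegrable_mul_density hc hRi (continuous_hat (η := Y / n) (cen j))
      (-(L / 2)) (L / 2)
    have h1 := intervalIntegral.integral_mono_on (μ := volume) (a := -(L / 2)) (b := L / 2)
      (by linarith) hint
      (((continuous_hat (η := Y / n) (cen j)).intervalIntegrable _ _).const_mul R)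
      (fun y _ => mul_le_mul_of_nonneg_right (hx.density_le hRi y) (hat_nonneg hη _ y))
    rw [intervalIntegral.integral_const_mul, hhat1 j hj, mul_one] at h1
    have h2 := intervalIntegral.integral_nonneg (μ := volume) (a := -(L / 2)) (b := L / 2)
      (by linarith) (fun y _ => mul_nonneg (hx.density_pos hc y).le (hat_nonneg hη (cen j) y))
    rw [abs_of_nonneg h2]
    exact h1
  have hε : 0 ≤ ε := by
    have hR0 : 0 ≤ R := (hx0.cell_pos hc 0).le.trans (hR 0 ⟨le_rfl, hT.le⟩ 0)
    simpa using hD 0 ⟨le_rfl, hR0⟩ 0 ⟨le_rfl, hR0⟩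
  -- the pointwise bound
  let jump : ℝ → ℤ → ℝ := fun t k => |φ (configCell c N (fun k => x k t) k) -
    φ (configCell c N (fun k => x k t) (k - 1))|
  let l : ℝ := 2 * Y / n
  have hl : 0 < l := by positivity
  have hpt : ∀ t ∈ Ico 0 T, ∀ y ∈ Ico (-Y) Y,
      |particleDensity c N x (t, y) - b (gridIndex T Y p n (t, y))| ≤ (ε + θ) +
        D * ∑ k ∈ Finset.Ico (0 : ℤ) N,
          (Icc (torusRep L (x k t) - l) (torusRep L (x k t) + l)).indicator
            (fun _ => jump t k) y := by
    intro t ht y hy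
    have htI := Ico_subset_Icc_self ht
    have hx := hE.isConfig hT hL htI
    have hg1 := floor_grid hT hp ht
    have hg2 := floor_grid (l := 2 * Y) (by positivity) hn (z := y + Y)
      ⟨by linarith [hy.1], by linarith [hy.2]⟩
    simp only [gridIndex]
    set i := ⌊t * p / T⌋₊
    set j := ⌊(y + Y) * n / (2 * Y)⌋₊
    have hsI := htime i hg1.1
    have hxs := hE.isConfig hT hL hsI
    have hc1 := hcen j hg2.1
    let I : Set ℝ := Ico (cen j - Y / n) (cen j + Y / n)
    have e1 : cen j - Y / n = -Y + 2 * Y * j / n := by simp only [cen]; ring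
    have e2 : cen j + Y / n = -Y + 2 * Y * (j + 1) / n := by simp only [cen]; ring
    have hlen : cen j + Y / n - (cen j - Y / n) = l := by simp only [l]; ring
    have hyI : y ∈ I := ⟨by rw [e1]; linarith [hg2.2.1], by rw [e2]; linarith [hg2.2.2]⟩
    have hIL : I ⊆ Ico (-(L / 2)) (L / 2) := Ico_subset_Ico hc1.1 hc1.2
    have hhatI : ∀ z ∉ I, hat (Y / n) (cen j) z = 0 := fun z hz => by
      refine hat_eq_zero _ ?_
      by_contra h
      push Not at h
      have := abs_lt.1 h
      exact hz ⟨by linarith, by linarith⟩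
    have h1 := hx.abs_density_sub_average_le (φ := φ) hc (hR t htI) hD hD0 ordConnected_Ico hIL
      (continuous_hat _) (hat_nonneg hη _) hhatI (hhat1 j hg2.1) hyI
    have h2 := hx.abs_integral_sub_le hxs hc (g := hat (Y / n) (cen j)) (A := (hatMass (Y / n))⁻¹)
      (fun u _ v _ => hat_lip hη _ u v) (by
        rw [hat_eq_zero, hat_eq_zero]
        · rw [abs_of_nonneg] <;> linarith
        · rw [abs_of_nonpos] <;> linarith)
    have h3 := hE.sum_abs_displacement_le hk hφ hT hL hq hQ hsI.1 hg1.2.1 htI.2 hα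
    have h4 : t - T * i / p ≤ T / p := by
      have : T * ((i : ℝ) + 1) / p = T * i / p + T / p := by ring
      linarith [hg1.2.2]
    have h5 : |(∫ y in (-(L / 2))..(L / 2), dens t y * hat (Y / n) (cen j) y) - b (i, j)| ≤ θ := by
      refine h2.trans (le_trans ?_ hθ)
      refine mul_le_mul_of_nonneg_left ?_ (inv_pos.2 hZ).le
      have h6 : (t - T * i / p) * (m ^ 2 * B + m * α) ≤ T / p * (m ^ 2 * B + m * α) := by gcongr
      have h7 : c / N * L ≤ m / N * L := by gcongr
      linarith
    -- A jump in the grid cell of `y` is within one cell width `l` of `y`. Read as a function of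
    -- `y`, the new indicator has integral at most `2l`, so that integration in space gains the
    -- factor `l` in front of the total variation.
    have h8 : ∑ k ∈ Finset.Ico (0 : ℤ) N, I.indicator (fun _ => jump t k) (torusRep L (x k t)) ≤
        ∑ k ∈ Finset.Ico (0 : ℤ) N,
          (Icc (torusRep L (x k t) - l) (torusRep L (x k t) + l)).indicator
            (fun _ => jump t k) y := by
      refine Finset.sum_le_sum fun k _ => ?_
      by_cases hmem : torusRep L (x k t) ∈ I
      · rw [indicator_of_mem hmem, indicator_of_mem]
        constructor <;> linarith [hmem.1, hmem.2, hyI.1, hyI.2]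
      · rw [indicator_of_notMem hmem]
        exact indicator_nonneg (fun _ _ => abs_nonneg _) _
    have h9 := abs_sub_le (configDensity c N (fun k => x k t) y)
      (∫ y in (-(L / 2))..(L / 2), dens t y * hat (Y / n) (cen j) y) (b (i, j))
    have h10 := mul_le_mul_of_nonneg_left h8 hD0
    change |configDensity c N (fun k => x k t) y - b (i, j)| ≤ _
    simp only [jump] at h10 ⊢
    linarith
  -- the integral over a time slice
  have hjump : ∀ t ∈ Icc 0 T, ∑ k ∈ Finset.Ico (0 : ℤ) N, jump t k ≤
      c + dissipation φ c N (fun k => x k t) := fun t ht =>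
    (hE.isConfig hT hL ht).sum_abs_sub_le hc φ
  have hind : ∀ (a r : ℝ), IntegrableOn ((Icc (a - l) (a + l)).indicator fun _ => r)
      (Ico (-Y) Y) := fun a r =>
    (integrable_const _).indicator measurableSet_Icc
  have hslice : ∀ t ∈ Ico 0 T, ∫ y in Ico (-Y) Y, ((ε + θ) + D * ∑ k ∈ Finset.Ico (0 : ℤ) N,
          (Icc (torusRep L (x k t) - l) (torusRep L (x k t) + l)).indicator
            (fun _ => jump t k) y) ≤
      2 * Y * (ε + θ) + D * (2 * l) * (c + dissipation φ c N (fun k => x k t)) := by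
    intro t ht
    rw [integral_add (integrable_const _) ((integrable_finsetSum _ fun k _ =>
      hind _ _).const_mul D), integral_const_mul, integral_finsetSum _ fun k _ => hind _ _]
    have h1 : ∀ k ∈ Finset.Ico (0 : ℤ) N, ∫ y in Ico (-Y) Y,
        (Icc (torusRep L (x k t) - l) (torusRep L (x k t) + l)).indicator (fun _ => jump t k) y ≤
        2 * l * jump t k := fun k _ => by
      have hnn : 0 ≤ jump t k := abs_nonneg _
      calc _ ≤ ∫ y, (Icc (torusRep L (x k t) - l) (torusRep L (x k t) + l)).indicator
            (fun _ => jump t k) y := by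
            refine setIntegral_le_integral ?_ (Eventually.of_forall fun y =>
              indicator_nonneg (fun _ _ => hnn) _)
            exact (integrable_indicator_iff measurableSet_Icc).2 (integrableOn_const (by simp))
        _ = _ := by
            rw [integral_indicator measurableSet_Icc]
            simp only [integral_const, smul_eq_mul, MeasurableSet.univ, measureReal_restrict_apply,
              univ_inter, Real.volume_real_Icc]
            rw [max_eq_left (by linarith)]; ring
    have h2 := Finset.sum_le_sum h1
    rw [← Finset.mul_sum] at h2
    have h3 := mul_le_mul_of_nonneg_left (hjump t (Ico_subset_Icc_self ht))
      (show 0 ≤ 2 * l by positivity)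
    have h4 := mul_le_mul_of_nonneg_left (h2.trans h3) hD0
    have h5 : ∫ _y in Ico (-Y) Y, (ε + θ) = 2 * Y * (ε + θ) := by
      simp only [integral_const, smul_eq_mul, MeasurableSet.univ, measureReal_restrict_apply,
        univ_inter, Real.volume_real_Ico]
      rw [max_eq_left (by linarith)]; ring
    rw [h5]
    linarith
  -- integrability
  have hSm : MeasurableSet (Ico 0 T ×ˢ Ico (-Y) Y) := measurableSet_Ico.prod measurableSet_Ico
  have hSfin : volume (Ico 0 T ×ˢ Ico (-Y) Y) < ⊤ := by
    rw [Measure.volume_eq_prod, Measure.prod_prod]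
    simp [← ENNReal.ofReal_mul, hT.le]
  have hmeas : AEStronglyMeasurable
      (fun z => |particleDensity c N x z - b (gridIndex T Y p n z)|)
      (volume.restrict (Ico 0 T ×ˢ Ico (-Y) Y)) := by
    refine AEStronglyMeasurable.norm (f := fun z => particleDensity c N x z -
      b (gridIndex T Y p n z)) ?_
    refine (hE.aestronglyMeasurable hT hL c hSm fun z hz => Ico_subset_Icc_self hz.1).sub ?_
    exact ((measurable_of_countable b).comp (measurable_gridIndex T Y p n)).aestronglyMeasurable
  have hbij : ∀ ij ∈ Finset.range p ×ˢ Finset.range n, |b ij| ≤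
      ∑ ij ∈ Finset.range p ×ˢ Finset.range n, |b ij| := fun ij hij =>
    Finset.single_le_sum (f := fun ij => |b ij|) (fun _ _ => abs_nonneg _) hij
  have hInt : IntegrableOn (fun z => |particleDensity c N x z - b (gridIndex T Y p n z)|)
      (Ico 0 T ×ˢ Ico (-Y) Y) := by
    have hfin : IsFiniteMeasure (volume.restrict (Ico 0 T ×ˢ Ico (-Y) Y)) :=
      ⟨by rwa [Measure.restrict_apply_univ]⟩
    refine Integrable.of_bound hmeas
      (R + ∑ ij ∈ Finset.range p ×ˢ Finset.range n, |b ij|) ?_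
    filter_upwards [ae_restrict_mem hSm] with z hz
    have hx := hE.isConfig hT hL (Ico_subset_Icc_self hz.1)
    have hg1 := floor_grid hT hp hz.1
    have hg2 := floor_grid (l := 2 * Y) (by positivity) hn (z := z.2 + Y)
      ⟨by linarith [hz.2.1], by linarith [hz.2.2]⟩
    rw [Real.norm_eq_abs, abs_abs]
    refine (abs_sub _ _).trans (add_le_add ?_ (hbij _ ?_))
    · rw [particleDensity_eq, abs_of_pos (hx.density_pos hc _)]
      exact hx.density_le (hR z.1 (Ico_subset_Icc_self hz.1)) _
    · simp only [gridIndex, Finset.mem_product, Finset.mem_range]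
      exact ⟨hg1.1, hg2.1⟩
  have hdc := continuousOn_dissipation hφ hE hT hL hq
  have hdi : IntegrableOn (fun t => dissipation φ c N (fun k => x k t)) (Ico 0 T) :=
    (hdc.integrableOn_Icc).mono_set Ico_subset_Icc_self
  have hIntp := hInt
  rw [Measure.volume_eq_prod] at hIntp ⊢
  rw [setIntegral_prod _ hIntp]
  have hleft : IntegrableOn (fun t => ∫ y in Ico (-Y) Y,
      |particleDensity c N x (t, y) - b (gridIndex T Y p n (t, y))|) (Ico 0 T) := by
    have h1 := hIntp
    rw [IntegrableOn, ← Measure.prod_restrict] at h1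
    exact h1.integral_prod_left
  calc _ ≤ ∫ t in Ico 0 T, (2 * Y * (ε + θ) +
        D * (2 * l) * (c + dissipation φ c N (fun k => x k t))) := by
        refine setIntegral_mono_on hleft ?_ measurableSet_Ico fun t ht => ?_
        · exact (integrable_const _).add
            (((integrable_const _).add hdi).const_mul _)
        · refine le_trans ?_ (hslice t ht)
          refine integral_mono_of_nonneg (Eventually.of_forall fun y => abs_nonneg _) ?_ ?_
          · exact (integrable_const _).add ((integrable_finsetSum _ fun k _ =>
              hind _ _).const_mul D)
          · filter_upwards [ae_restrict_mem measurableSet_Ico] with y hy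
            exact hpt t ht y hy
    _ = 2 * Y * T * (ε + θ) + D * (2 * l) * (c * T +
          ∫ t in 0..T, dissipation φ c N (fun k => x k t)) := by
        have hcd : IntegrableOn (fun t => c + dissipation φ c N (fun k => x k t)) (Ico 0 T) :=
          (integrable_const c).add hdi
        rw [integral_add (integrable_const _) (hcd.const_mul _), integral_const_mul (D * (2 * l)),
          integral_add (integrable_const _) hdi,
          intervalIntegral.integral_of_le hT.le,
          ← integral_Ico_eq_integral_Ioc (f := fun t => dissipation φ c N (fun k => x k t))]
        simp only [integral_const, smul_eq_mul, MeasurableSet.univ, measureReal_restrict_apply,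
          univ_inter, Real.volume_real_Ico]
        rw [max_eq_left (by linarith)]
        ring
    _ ≤ _ := by gcongr

/-- Propagation of the first moment. -/
theorem moment_le (hk : SlopeBound (deriv K) B C) (hφ : AdmissibleDiffusion W φ)
    (hE : IsParticleEvolution K φ T L q N x) (hT : 0 < T) (hL : 0 < L) (hq : IsDatum q m M)
    {Q : ℝ} (hQ : ∫ t in 0..T, dissipation φ (cellMass q L) N (fun k => x k t) ≤ Q)
    (hmom : Integrable fun y => |y| * q y) {t : ℝ} (ht : t ∈ Icc 0 T) :
    ∫ y in (-(L / 2))..(L / 2), configDensity (cellMass q L) N (fun k => x k t) y * |y| ≤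
      (∫ y, |y| * q y) + T * (m ^ 2 * B + m) + Q + 4 * (m / N * L) := by
  have hc := hq.cellMass_pos hL
  have hcm := hq.cellMass_le hL
  have hB := hk.bound_nonneg
  have h0 : (0 : ℝ) ∈ Icc 0 T := ⟨le_rfl, hT.le⟩
  have hx := hE.isConfig hT hL ht
  have hx0 := hE.isConfig hT hL h0
  have hN := hx0.natCast_pos
  have hm : 0 < m := hc.trans_le hcm
  have hg : ∀ u ∈ Icc (-(L / 2)) (L / 2), ∀ v ∈ Icc (-(L / 2)) (L / 2),
      |(|u| - |v|)| ≤ 1 * |u - v| := fun u _ v _ => by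
    rw [one_mul]; exact abs_abs_sub_abs_le u v
  have hb : |(-(L / 2))| = |L / 2| := abs_neg _
  -- The function `|y|` is `1`-Lipschitz with equal values at `±L/2`, so it is admissible on the
  -- torus. Four quadrature errors add up: two from the transport, one from returning to the
  -- particles at time zero, one from the datum.
  have h1 := (abs_le.1 (hx.abs_integral_sub_le hx0 hc (g := fun y => |y|) hg hb)).2
  have h2 := (abs_le.1 (hx0.abs_quadrature_le hc (abs_comp_torusRep_sub_le (g := fun y => |y|)
    hL hg hb) (continuous_comp_torusRep hL hg hb) (periodic_comp_torusRep hL fun y => |y|))).1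
  rw [integral_mul_comp_torusRep hL _ fun y => |y|] at h2
  have h3 := (abs_le.1 (hE.abs_initial_quadrature_le hT hL hq (g := fun y => |y|) hg hb)).2
  have h4 := hE.sum_abs_displacement_le hk hφ hT hL hq hQ le_rfl ht.1 ht.2 one_pos
  have h5 : ∫ y in (-(L / 2))..(L / 2), q y * |y| ≤ ∫ y, |y| * q y := by
    rw [intervalIntegral.integral_of_le (by linarith)]
    simp_rw [mul_comm (q _)]
    exact setIntegral_le_integral hmom (hq.pos.mono fun y hy => mul_nonneg (abs_nonneg _) hy.le)
  have h6 : (t - 0) * (m ^ 2 * B + m * 1) ≤ T * (m ^ 2 * B + m) := by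
    rw [mul_one, sub_zero]
    have := ht.2
    gcongr
  have h7 : cellMass q L / N * L ≤ m / N * L := by gcongr
  linarith

end IsParticleEvolution

end AggDiff

end

noncomputable section

namespace AggDiff

/-! ### Convergence in `L¹` -/

section Abstract

variable {α : Type*} [MeasurableSpace α] {μ : Measure α}

theorem eLpNorm_one_eq_ofReal {f : α → ℝ} (hf : Integrable f μ) :
    eLpNorm f 1 μ = ENNReal.ofReal (∫ z, |f z| ∂μ) := by
  rw [eLpNorm_one_eq_lintegral_enorm, ← ofReal_integral_norm_eq_lintegral_enorm hf]
  rfl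

theorem tendsto_eLpNorm_one_iff {ι : Type*} {l : Filter ι} {u : ι → α → ℝ} {v : α → ℝ}
    (hu : ∀ n, Integrable (u n) μ) (hv : Integrable v μ) :
    Tendsto (fun n => eLpNorm (fun z => u n z - v z) 1 μ) l (𝓝 0) ↔
      Tendsto (fun n => ∫ z, |u n z - v z| ∂μ) l (𝓝 0) := by
  have h : ∀ n, eLpNorm (fun z => u n z - v z) 1 μ =
      ENNReal.ofReal (∫ z, |u n z - v z| ∂μ) := fun n => eLpNorm_one_eq_ofReal ((hu n).sub hv)
  simp_rw [h]
  constructor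
  · intro H
    have := (ENNReal.tendsto_toReal ENNReal.zero_ne_top).comp H
    simpa [Function.comp_def, ENNReal.toReal_ofReal,
      integral_nonneg (fun _ => abs_nonneg _)] using this
  · intro H
    simpa using ENNReal.tendsto_ofReal H

theorem integral_abs_sub_le {u v w : α → ℝ} (hu : Integrable u μ) (hv : Integrable v μ)
    (hw : Integrable w μ) :
    ∫ z, |u z - w z| ∂μ ≤ (∫ z, |u z - v z| ∂μ) + ∫ z, |v z - w z| ∂μ := by
  rw [← integral_add (f := fun z => |u z - v z|) (g := fun z => |v z - w z|)
    (hu.sub hv).abs (hv.sub hw).abs]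
  exact integral_mono (hu.sub hw).abs ((hu.sub hv).abs.add (hv.sub hw).abs)
    fun z => abs_sub_le _ _ _

/-- A sequence in `L¹` that is eventually close to finite sets has a convergent subsequence. -/
theorem exists_subseq_tendsto_integral {u : ℕ → α → ℝ} (hu : ∀ n, Integrable (u n) μ)
    (h : ∀ ε > 0, ∃ F : Set (α → ℝ), F.Finite ∧ (∀ f ∈ F, Integrable f μ) ∧
      ∀ᶠ n in atTop, ∃ f ∈ F, ∫ z, |u n z - f z| ∂μ ≤ ε) :
    ∃ (s : ℕ → ℕ) (v : α → ℝ), StrictMono s ∧ Integrable v μ ∧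
      Tendsto (fun n => ∫ z, |u (s n) z - v z| ∂μ) atTop (𝓝 0) := by
  classical
  let U : ℕ → α →₁[μ] ℝ := fun n => (hu n).toL1 (u n)
  have hdist : ∀ {f g : α → ℝ} (hf : Integrable f μ) (hg : Integrable g μ),
      dist (hf.toL1 f) (hg.toL1 g) = ∫ z, |f z - g z| ∂μ := fun {f g} hf hg => by
    rw [dist_eq_norm, ← Integrable.toL1_sub, L1.norm_eq_integral_norm]
    refine integral_congr_ae ?_
    filter_upwards [(hf.sub hg).coeFn_toL1] with z hz
    rw [hz, Real.norm_eq_abs]; rfl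
  have htb : TotallyBounded (range U) := by
    refine Metric.totallyBounded_iff.2 fun ε hε => ?_
    obtain ⟨F, hF, hFi, hev⟩ := h (ε / 2) (half_pos hε)
    obtain ⟨n₀, hn₀⟩ := eventually_atTop.1 hev
    let G : (α → ℝ) → α →₁[μ] ℝ := fun f => if hf : Integrable f μ then hf.toL1 f else 0
    -- The finitely many terms before the net becomes effective are added to the net.
    refine ⟨G '' F ∪ U '' (Iio n₀), (hF.image _).union ((finite_Iio n₀).image _), ?_⟩
    rintro _ ⟨n, rfl⟩
    rw [mem_iUnion₂]
    by_cases hn : n < n₀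
    · exact ⟨U n, Or.inr ⟨n, hn, rfl⟩, Metric.mem_ball_self hε⟩
    · obtain ⟨f, hf, hle⟩ := hn₀ n (not_lt.1 hn)
      refine ⟨G f, Or.inl ⟨f, hf, rfl⟩, ?_⟩
      have hG : G f = (hFi f hf).toL1 f := dif_pos (hFi f hf)
      rw [Metric.mem_ball, hG, hdist (hu n) (hFi f hf)]
      linarith
  obtain ⟨V, -, s, hs, hV⟩ := (htb.closure.isCompact_of_isClosed
    isClosed_closure).tendsto_subseq (x := U) fun n => subset_closure (mem_range_self n)
  refine ⟨s, V, hs, L1.integrable_coeFn V, ?_⟩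
  rw [tendsto_iff_dist_tendsto_zero] at hV
  refine hV.congr fun n => ?_
  have := hdist (hu (s n)) (L1.integrable_coeFn V)
  rwa [Integrable.toL1_coeFn] at this

/-- Step functions on a fixed finite partition with bounded values form a precompact set. -/
theorem exists_finite_step_net {S : Set α} (hS : MeasurableSet S) (hμS : μ S ≠ ⊤)
    {idx : α → ℕ × ℕ} (hidx : Measurable idx) {p n : ℕ}
    (hSi : ∀ z ∈ S, (idx z).1 < p ∧ (idx z).2 < n) (R : ℝ) {ε : ℝ} (hε : 0 < ε) :
    ∃ F : Set (α → ℝ), F.Finite ∧ (∀ f ∈ F, Integrable f μ) ∧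
      (∀ f ∈ F, ∀ z ∉ S, f z = 0) ∧
      ∀ b : ℕ × ℕ → ℝ, (∀ i < p, ∀ j < n, |b (i, j)| ≤ R) →
        ∃ f ∈ F, ∫ z in S, |b (idx z) - f z| ∂μ ≤ ε := by
  classical
  set A := μ.real S
  have hA : 0 ≤ A := measureReal_nonneg
  let δ := ε / (A + 1)
  have hδ : 0 < δ := by positivity
  -- A bounded set of values on finitely many grid cells is precompact in the sup norm, and `δ` is
  -- chosen so that sup distance `δ` on `S` costs at most `ε` after integration.
  obtain ⟨G, hG, hcov⟩ := Metric.totallyBounded_iff.1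
    (isCompact_closedBall (0 : Fin p × Fin n → ℝ) |R|).totallyBounded δ hδ
  let E : (Fin p × Fin n → ℝ) → ℕ × ℕ → ℝ := fun g ij =>
    if h : ij.1 < p ∧ ij.2 < n then g (⟨ij.1, h.1⟩, ⟨ij.2, h.2⟩) else 0
  have hEm : ∀ g, Measurable fun z => E g (idx z) := fun g =>
    (measurable_of_countable (E g)).comp hidx
  have hEint : ∀ g, IntegrableOn (fun z => E g (idx z)) S μ := fun g => by
    have hfin : IsFiniteMeasure (μ.restrict S) :=
      ⟨by rw [Measure.restrict_apply_univ]; exact hμS.lt_top⟩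
    refine Integrable.of_bound (hEm g).aestronglyMeasurable ‖g‖ (Eventually.of_forall fun z => ?_)
    simp only [E]
    split_ifs
    · exact norm_le_pi_norm g _
    · simp
  refine ⟨(fun g => S.indicator fun z => E g (idx z)) '' G, hG.image _, ?_, ?_, ?_⟩
  · rintro _ ⟨g, -, rfl⟩
    exact (integrable_indicator_iff hS).2 (hEint g)
  · rintro _ ⟨g, -, rfl⟩ z hz
    exact indicator_of_notMem hz _
  · intro b hb
    let b' : Fin p × Fin n → ℝ := fun ij => b (ij.1, ij.2)
    have hb' : b' ∈ Metric.closedBall 0 |R| := by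
      rw [mem_closedBall_zero_iff, pi_norm_le_iff_of_nonneg (abs_nonneg R)]
      exact fun ij => (hb _ ij.1.2 _ ij.2.2).trans (le_abs_self R)
    obtain ⟨g, hg, hlt⟩ := mem_iUnion₂.1 (hcov hb')
    refine ⟨_, ⟨g, hg, rfl⟩, ?_⟩
    have hpt : ∀ z ∈ S, |b (idx z) - S.indicator (fun z => E g (idx z)) z| ≤ δ := fun z hz => by
      rw [indicator_of_mem hz]
      have h := hSi z hz
      simp only [E, dif_pos h]
      have h2 := (dist_pi_lt_iff hδ).1 (Metric.mem_ball.1 hlt) (⟨_, h.1⟩, ⟨_, h.2⟩)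
      exact h2.le
    calc _ ≤ ∫ _z in S, δ ∂μ := by
          refine integral_mono_of_nonneg (Eventually.of_forall fun z => abs_nonneg _)
            (integrableOn_const hμS) ?_
          filter_upwards [ae_restrict_mem hS] with z hz using hpt z hz
      _ = A * δ := by simp [A]
      _ ≤ ε := by
          simp only [δ]
          rw [mul_div_assoc', div_le_iff₀ (by positivity)]
          nlinarith

end Abstract

theorem exists_nat_div_le (a : ℝ) {b : ℝ} (hb : 0 < b) : ∃ n : ℕ, 0 < n ∧ a / n ≤ b := by
  obtain ⟨n, hn⟩ := exists_nat_gt (max 0 (a / b))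
  have h0 : (0 : ℝ) < n := (le_max_left _ _).trans_lt hn
  refine ⟨n, by exact_mod_cast h0, ?_⟩
  rw [div_le_iff₀ h0]
  have := ((le_max_right _ _).trans_lt hn)
  rw [div_lt_iff₀ hb] at this
  linarith

/-- The inverse of a strictly increasing continuous function on a compact interval is uniformly
continuous, in linearized form. -/
theorem exists_abs_sub_le_of_strictMonoOn {φ : ℝ → ℝ} {R : ℝ} (hφ : StrictMonoOn φ (Icc 0 R))
    (hc : ContinuousOn φ (Icc 0 R)) {ε : ℝ} (hε : 0 < ε) :
    ∃ D, 0 ≤ D ∧ ∀ r ∈ Icc 0 R, ∀ s ∈ Icc 0 R, |r - s| ≤ ε + D * |φ r - φ s| := by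
  -- On the compact set of pairs at distance at least `ε`, `|φ r - φ s|` has a positive minimum `d`
  -- by strict monotonicity; then `|R|/d` serves as `D`.
  let P : Set (ℝ × ℝ) := (Icc 0 R ×ˢ Icc 0 R) ∩ {z | ε ≤ |z.1 - z.2|}
  have hP : IsCompact P := (isCompact_Icc.prod isCompact_Icc).inter_right
    (isClosed_le continuous_const (by fun_prop))
  rcases P.eq_empty_or_nonempty with h | hne
  · refine ⟨0, le_rfl, fun r hr s hs => ?_⟩
    by_contra hcon
    push Not at hcon
    have : (r, s) ∈ P := ⟨⟨hr, hs⟩, by simp only [mem_ofPred_eq]; linarith⟩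
    rw [h] at this
    exact this
  · have hcont : ContinuousOn (fun z : ℝ × ℝ => |φ z.1 - φ z.2|) P :=
      ((hc.comp continuousOn_fst fun z hz => hz.1.1).sub
        (hc.comp continuousOn_snd fun z hz => hz.1.2)).abs
    obtain ⟨z₀, hz₀, hmin⟩ := hP.exists_isMinOn hne hcont
    set d := |φ z₀.1 - φ z₀.2| with hd
    have hd0 : 0 < d := by
      rw [hd, abs_pos, sub_ne_zero]
      intro heq
      have := hφ.injOn hz₀.1.1 hz₀.1.2 heq
      have h2 : ε ≤ |z₀.1 - z₀.2| := hz₀.2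
      rw [this, sub_self, abs_zero] at h2
      linarith
    refine ⟨|R| / d, by positivity, fun r hr s hs => ?_⟩
    by_cases hrs : ε ≤ |r - s|
    · have h1 : d ≤ |φ r - φ s| := hmin (show (r, s) ∈ P from ⟨⟨hr, hs⟩, hrs⟩)
      have h2 : |r - s| ≤ |R| := by
        have := le_abs_self R
        rw [abs_le]; constructor <;> linarith [hr.1, hr.2, hs.1, hs.2]
      have h3 : |R| / d * d ≤ |R| / d * |φ r - φ s| := by gcongr
      rw [div_mul_cancel₀ _ hd0.ne'] at h3
      linarith
    · push Not at hrs
      have : 0 ≤ |R| / d * |φ r - φ s| := by positivity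
      linarith

end AggDiff

end

/-! ### Compactness of the particle densities in `L¹`. -/

noncomputable section

namespace AggDiff

/-- The restriction of a function on space-time to the fundamental domain of the torus, extended
by zero. -/
def stripCut (L : ℝ) (u : ℝ × ℝ → ℝ) : ℝ × ℝ → ℝ :=
  (univ ×ˢ Ico (-(L / 2)) (L / 2)).indicator u

theorem restrict_stripMeasure (T a b : ℝ) :
    (stripMeasure T).restrict (univ ×ˢ Ico a b) = volume.restrict (Icc 0 T ×ˢ Ico a b) := by
  rw [stripMeasure, Measure.restrict_restrict (MeasurableSet.univ.prod measurableSet_Ico)]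
  congr 1
  ext z; simp [and_comm]

theorem integrable_stripCut_iff {T L : ℝ} {u : ℝ × ℝ → ℝ} :
    Integrable (stripCut L u) (stripMeasure T) ↔ Integrable u (torusStripMeasure T L) := by
  rw [stripCut, integrable_indicator_iff (MeasurableSet.univ.prod measurableSet_Ico),
    IntegrableOn, restrict_stripMeasure]
  rfl

theorem integral_stripCut (T L : ℝ) (u : ℝ × ℝ → ℝ) :
    ∫ z, stripCut L u z ∂(stripMeasure T) = ∫ z, u z ∂(torusStripMeasure T L) := by
  rw [stripCut, integral_indicator (MeasurableSet.univ.prod measurableSet_Ico),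
    restrict_stripMeasure]
  rfl

theorem ae_stripMeasure_mem (T : ℝ) : ∀ᵐ z ∂(stripMeasure T), z.1 ∈ Icc 0 T := by
  filter_upwards [ae_restrict_mem (measurableSet_Icc.prod MeasurableSet.univ)] with z hz using hz.1

namespace IsParticleEvolution

variable {K W φ q : ℝ → ℝ} {T L B C m M R : ℝ} {N : ℕ} {x : ℤ → ℝ → ℝ}

theorem particleDensity_pos (hE : IsParticleEvolution K φ T L q N x) (hT : 0 < T) (hL : 0 < L)
    {c : ℝ} (hc : 0 < c) {z : ℝ × ℝ} (hz : z.1 ∈ Icc 0 T) : 0 < particleDensity c N x z :=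
  (hE.isConfig hT hL hz).density_pos hc _

theorem particleDensity_le (hE : IsParticleEvolution K φ T L q N x) (hT : 0 < T) (hL : 0 < L)
    {c : ℝ} (hR : ∀ t ∈ Icc 0 T, ∀ k, configCell c N (fun k => x k t) k ≤ R) {z : ℝ × ℝ}
    (hz : z.1 ∈ Icc 0 T) : particleDensity c N x z ≤ R :=
  (hE.isConfig hT hL hz).density_le (hR z.1 hz) _

theorem integrableOn_particleDensity_mul (hE : IsParticleEvolution K φ T L q N x) (hT : 0 < T)
    (hL : 0 < L) {c : ℝ} (hc : 0 < c)
    (hR : ∀ t ∈ Icc 0 T, ∀ k, configCell c N (fun k => x k t) k ≤ R) (a b : ℝ) {g : ℝ → ℝ}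
    (hg : Continuous g) :
    IntegrableOn (fun z => particleDensity c N x z * g z.2) (Icc 0 T ×ˢ Ico a b) := by
  have hS : MeasurableSet (Icc 0 T ×ˢ Ico a b) := measurableSet_Icc.prod measurableSet_Ico
  have hfin : IsFiniteMeasure (volume.restrict (Icc 0 T ×ˢ Ico a b)) := by
    refine ⟨?_⟩
    rw [Measure.restrict_apply_univ, Measure.volume_eq_prod, Measure.prod_prod]
    exact ENNReal.mul_lt_top measure_Icc_lt_top measure_Ico_lt_top
  obtain ⟨A, hA⟩ := (isCompact_Icc (a := a) (b := b)).exists_bound_of_continuousOn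
    hg.continuousOn
  refine Integrable.of_bound ((hE.aestronglyMeasurable hT hL c hS fun z hz => hz.1).mul
    (hg.comp continuous_snd).aestronglyMeasurable) (R * A) ?_
  filter_upwards [ae_restrict_mem hS] with z hz
  have h1 := hE.particleDensity_pos hT hL hc hz.1
  have h2 := hE.particleDensity_le hT hL hR hz.1
  rw [norm_mul, Real.norm_eq_abs, abs_of_pos h1]
  exact mul_le_mul h2 (hA _ (Ico_subset_Icc_self hz.2)) (norm_nonneg _) (h1.le.trans h2)

theorem integrableOn_particleDensity (hE : IsParticleEvolution K φ T L q N x) (hT : 0 < T)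
    (hL : 0 < L) {c : ℝ} (hc : 0 < c)
    (hR : ∀ t ∈ Icc 0 T, ∀ k, configCell c N (fun k => x k t) k ≤ R) (a b : ℝ) :
    IntegrableOn (particleDensity c N x) (Icc 0 T ×ˢ Ico a b) := by
  simpa using hE.integrableOn_particleDensity_mul hT hL hc hR a b (g := fun _ => 1)
    continuous_const

end IsParticleEvolution

section Compactness

variable {K W φ : ℝ → ℝ} {T B C m M : ℝ}

/-- Particle densities are uniformly close to finitely many step functions on bounded sets. -/
theorem exists_grid_net (hk : SlopeBound (deriv K) B C) (hφ : AdmissibleDiffusion W φ)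
    (hT : 0 < T) (hm : 0 ≤ m) (hM : 0 < M) {Y : ℝ} (hY : 0 < Y) {ε : ℝ} (hε : 0 < ε) :
    ∃ F : Set (ℝ × ℝ → ℝ), F.Finite ∧ (∀ f ∈ F, Integrable f) ∧
      (∀ f ∈ F, ∀ z ∉ Ico 0 T ×ˢ Ico (-Y) Y, f z = 0) ∧ ∃ δ > 0,
      ∀ (L : ℝ) (q : ℝ → ℝ) (N : ℕ) (x : ℤ → ℝ → ℝ), 0 < L → Y ≤ L / 2 → L / N ≤ δ →
        IsDatum q m M → IsParticleEvolution K φ T L q N x →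
        ∃ f ∈ F, ∫ z in Icc 0 T ×ˢ Ico (-Y) Y, |particleDensity (cellMass q L) N x z - f z| ≤ ε := by
  obtain ⟨R, Q, hR0, hQ0, hRQ⟩ := exists_evolution_bounds hk hφ T m M hm hM
  have hB := hk.bound_nonneg
  -- Order of the choices: `θ` from `ε`, then `D` from `θ`, the number `n` of spatial cells from
  -- `D`, the Young parameter `a` from the mass of the hat of half width `Y/n`, the number `p` of
  -- time slabs from `a`, and the ratio `L/N` from the mass of the hat as well. The factor `16`
  -- makes `2YT(θ + θ)` equal to `ε/4`.
  set θ := ε / (16 * Y * T) with hθdef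
  have hθ : 0 < θ := by positivity
  obtain ⟨D, hD0, hD⟩ := exists_abs_sub_le_of_strictMonoOn (R := R)
    (hφ.strictMono.mono Icc_subset_Ici_self) (hφ.contDiffOn.continuousOn.mono Icc_subset_Ici_self)
    hθ
  obtain ⟨n, hn, hn'⟩ := exists_nat_div_le (D * (4 * Y) * (m * T + Q)) (show 0 < ε / 4 by positivity)
  have hnp : (0 : ℝ) < n := by exact_mod_cast hn
  have hZ := hatMass_pos (η := Y / n) (by positivity)
  set Z := hatMass (Y / n)
  have hZθ : 0 < Z * θ / 3 := by positivity
  obtain ⟨a, ha, ha'⟩ := exists_nat_div_le Q hZθ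
  have hap : (0 : ℝ) < a := by exact_mod_cast ha
  obtain ⟨p, hp, hp'⟩ := exists_nat_div_le (T * (m ^ 2 * B + m * a)) hZθ
  have hSm : MeasurableSet (Ico 0 T ×ˢ Ico (-Y) Y) := measurableSet_Ico.prod measurableSet_Ico
  have hSfin : volume (Ico 0 T ×ˢ Ico (-Y) Y) ≠ ⊤ := by
    rw [Measure.volume_eq_prod, Measure.prod_prod]
    exact (ENNReal.mul_lt_top measure_Ico_lt_top measure_Ico_lt_top).ne
  obtain ⟨F, hF, hFi, hF0, hFb⟩ := exists_finite_step_net (μ := volume) hSm hSfin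
    (measurable_gridIndex T Y p n) (p := p) (n := n) (fun z hz => ⟨(floor_grid hT hp hz.1).1,
      (floor_grid (l := 2 * Y) (by positivity) hn (z := z.2 + Y)
        ⟨by linarith [hz.2.1], by linarith [hz.2.2]⟩).1⟩) R (half_pos hε)
  refine ⟨F, hF, hFi, hF0, Z * θ / (6 * (m + 1)), by positivity,
    fun L q N x hL hYL hLN hq hE => ?_⟩
  obtain ⟨hR, hQ⟩ := hRQ T L q N x hT le_rfl hL hq hE
  have hbound : Z⁻¹ * (T / p * (m ^ 2 * B + m * a) + Q / a + 2 * (m / N * L)) ≤ θ := by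
    rw [inv_mul_le_iff₀ hZ]
    have h1 : T / p * (m ^ 2 * B + m * a) = T * (m ^ 2 * B + m * a) / p := by ring
    have h2 : m / N * L = m * (L / N) := by ring
    have h3 : m * (L / N) ≤ m * (Z * θ / (6 * (m + 1))) := by gcongr
    have h4 : m * (Z * θ / (6 * (m + 1))) ≤ Z * θ / 6 := by
      rw [mul_div_assoc', div_le_div_iff₀ (by positivity) (by positivity)]
      nlinarith [mul_pos hZ hθ]
    rw [h1, h2]
    linarith
  obtain ⟨b, hb, hbi⟩ := hE.integral_abs_sub_step_le hk hφ hT hL hq hR hQ hD hD0 hY hYL hn hp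
    hap hbound
  obtain ⟨f, hf, hfi⟩ := hFb b hb
  refine ⟨f, hf, ?_⟩
  have hae : (Icc 0 T ×ˢ Ico (-Y) Y : Set (ℝ × ℝ)) =ᵐ[volume] (Ico 0 T ×ˢ Ico (-Y) Y) :=
    Measure.set_prod_ae_eq Ico_ae_eq_Icc.symm EventuallyEq.rfl
  rw [setIntegral_congr_set hae]
  have hc := hq.cellMass_pos hL
  have hu := (hE.integrableOn_particleDensity hT hL hc hR (-Y) Y).mono_set
    (prod_mono_left Ico_subset_Icc_self)
  have hbint : IntegrableOn (fun z => b (gridIndex T Y p n z)) (Ico 0 T ×ˢ Ico (-Y) Y) := by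
    have hfin : IsFiniteMeasure (volume.restrict (Ico 0 T ×ˢ Ico (-Y) Y)) :=
      ⟨by rw [Measure.restrict_apply_univ]; exact hSfin.lt_top⟩
    refine Integrable.of_bound
      ((measurable_of_countable b).comp (measurable_gridIndex T Y p n)).aestronglyMeasurable R ?_
    filter_upwards [ae_restrict_mem hSm] with z hz
    exact hb _ (floor_grid hT hp hz.1).1 _ (floor_grid (l := 2 * Y) (by positivity) hn
      (z := z.2 + Y) ⟨by linarith [hz.2.1], by linarith [hz.2.2]⟩).1
  refine (integral_abs_sub_le hu hbint (hFi f hf).integrableOn).trans ?_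
  have e1 : 2 * Y * T * (θ + θ) = ε / 4 := by
    rw [hθdef]; field_simp; ring
  have e2 : D * (2 * (2 * Y / n)) * (m * T + Q) = D * (4 * Y) * (m * T + Q) / n := by ring
  rw [e1, e2] at hbi
  linarith

/-- Particle densities, cut to the fundamental domain, are uniformly close to finitely many
functions on the whole strip. -/
theorem exists_line_net (hk : SlopeBound (deriv K) B C) (hφ : AdmissibleDiffusion W φ)
    (hT : 0 < T) (hm : 0 ≤ m) (hM : 0 < M) (A : ℝ) {ε : ℝ} (hε : 0 < ε) :
    ∃ F : Set (ℝ × ℝ → ℝ), F.Finite ∧ (∀ f ∈ F, Integrable f (stripMeasure T)) ∧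
      ∃ δ > 0, ∃ Λ : ℝ,
      ∀ (L : ℝ) (q : ℝ → ℝ) (N : ℕ) (x : ℤ → ℝ → ℝ), 0 < L → Λ ≤ L → L / N ≤ δ →
        IsDatum q m M → Integrable (fun y => |y| * q y) → ∫ y, |y| * q y ≤ A →
        IsParticleEvolution K φ T L q N x →
        ∃ f ∈ F, ∫ z, |stripCut L (particleDensity (cellMass q L) N x) z - f z| ∂(stripMeasure T)
          ≤ ε := by
  obtain ⟨R, Q, hR0, hQ0, hRQ⟩ := exists_evolution_bounds hk hφ T m M hm hM
  have hB := hk.bound_nonneg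
  set H := A + T * (m ^ 2 * B + m) + Q + 4 * m with hH
  -- The first moment, integrated in time, is at most `T H`, so the mass beyond distance `Y`
  -- contributes at most `T H / Y ≤ ε/2`.
  obtain ⟨Y', hY', hYε⟩ := exists_nat_div_le (T * H) (half_pos hε)
  have hY : (0 : ℝ) < Y' := by exact_mod_cast hY'
  set Y := (Y' : ℝ)
  obtain ⟨F, hF, hFi, hF0, δ, hδ, hnet⟩ := exists_grid_net hk hφ hT hm hM hY (half_pos hε)
  refine ⟨F, hF, fun f hf => (hFi f hf).mono_measure Measure.restrict_le_self, min δ 1, by positivity,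
    2 * Y, fun L q N x hL hYL hLN hq hmom hA hE => ?_⟩
  obtain ⟨f, hf, hfi⟩ := hnet L q N x hL (by linarith) (hLN.trans (min_le_left _ _)) hq hE
  refine ⟨f, hf, ?_⟩
  obtain ⟨hR, hQ⟩ := hRQ T L q N x hT le_rfl hL hq hE
  have hc := hq.cellMass_pos hL
  set u := particleDensity (cellMass q L) N x with hu
  have hui : ∀ a b, IntegrableOn u (Icc 0 T ×ˢ Ico a b) :=
    hE.integrableOn_particleDensity hT hL hc hR
  have hmi := hE.integrableOn_particleDensity_mul hT hL hc hR (-(L / 2)) (L / 2) continuous_abs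
  have hmoment : ∫ z in Icc 0 T ×ˢ Ico (-(L / 2)) (L / 2), u z * |z.2| ≤ T * H := by
    rw [Measure.volume_eq_prod] at hmi ⊢
    rw [setIntegral_prod _ hmi]
    have h1 : ∀ t ∈ Icc 0 T, ∫ y in Ico (-(L / 2)) (L / 2), u (t, y) * |y| ≤ H := fun t ht => by
      have := hE.moment_le hk hφ hT hL hq hQ hmom ht
      rw [intervalIntegral.integral_of_le (by linarith), ← integral_Ico_eq_integral_Ioc] at this
      refine (this.trans ?_)
      have h2 : m / N * L = m * (L / N) := by ring
      have h3 : m * (L / N) ≤ m * 1 := by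
        gcongr; exact hLN.trans (min_le_right _ _)
      rw [h2]
      linarith
    have h2 : IntegrableOn (fun t => ∫ y in Ico (-(L / 2)) (L / 2), u (t, y) * |y|) (Icc 0 T) := by
      rw [IntegrableOn, ← Measure.prod_restrict] at hmi
      exact hmi.integral_prod_left
    calc _ ≤ ∫ _t in Icc 0 T, H := setIntegral_mono_on h2 (integrable_const _) measurableSet_Icc h1
      _ = T * H := by simp [hT.le]
  have hrest : ∫ z, stripCut L (fun z => u z * |z.2|) z ∂(stripMeasure T) ≤ T * H := by
    rw [integral_stripCut]; exact hmoment
  have hIm : Integrable (stripCut L (fun z => u z * |z.2|)) (stripMeasure T) :=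
    integrable_stripCut_iff.2 hmi
  have hS : MeasurableSet (univ ×ˢ Ico (-Y) Y : Set (ℝ × ℝ)) :=
    MeasurableSet.univ.prod measurableSet_Ico
  have hI1 : Integrable ((univ ×ˢ Ico (-Y) Y).indicator fun z => |u z - f z|) (stripMeasure T) := by
    rw [integrable_indicator_iff hS, IntegrableOn, restrict_stripMeasure]
    exact ((hui _ _).sub (hFi f hf).integrableOn).abs
  calc ∫ z, |stripCut L u z - f z| ∂(stripMeasure T)
      ≤ ∫ z, ((univ ×ˢ Ico (-Y) Y).indicator (fun z => |u z - f z|) z +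
          1 / Y * stripCut L (fun z => u z * |z.2|) z) ∂(stripMeasure T) := by
        refine integral_mono_of_nonneg (Eventually.of_forall fun z => abs_nonneg _)
          (hI1.add (hIm.const_mul _)) ?_
        filter_upwards [ae_stripMeasure_mem T] with z hz
        have hpos := hE.particleDensity_pos hT hL hc hz
        rw [← hu] at hpos
        by_cases h1 : z.2 ∈ Ico (-Y) Y
        · have h2 : z.2 ∈ Ico (-(L / 2)) (L / 2) :=
            ⟨by linarith [h1.1], by linarith [h1.2]⟩
          rw [stripCut, stripCut, indicator_of_mem (mk_mem_prod (mem_univ _) h2),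
            indicator_of_mem (mk_mem_prod (mem_univ _) h1),
            indicator_of_mem (mk_mem_prod (mem_univ _) h2)]
          have : 0 ≤ 1 / Y * (u z * |z.2|) := by positivity
          linarith
        · rw [hF0 f hf z fun h => h1 h.2, sub_zero,
            indicator_of_notMem (fun h => h1 h.2), zero_add]
          by_cases h2 : z.2 ∈ Ico (-(L / 2)) (L / 2)
          · rw [stripCut, stripCut, indicator_of_mem (mk_mem_prod (mem_univ _) h2),
              indicator_of_mem (mk_mem_prod (mem_univ _) h2), abs_of_pos hpos]
            have h3 : Y ≤ |z.2| := by
              by_contra hcon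
              have := abs_lt.1 (not_le.1 hcon)
              exact h1 ⟨this.1.le, this.2⟩
            rw [one_div, inv_mul_eq_div, le_div_iff₀ hY]
            gcongr
          · rw [stripCut, stripCut, indicator_of_notMem (fun h => h2 h.2),
              indicator_of_notMem (fun h => h2 h.2)]
            simp
    _ = (∫ z in Icc 0 T ×ˢ Ico (-Y) Y, |u z - f z|) +
        1 / Y * ∫ z, stripCut L (fun z => u z * |z.2|) z ∂(stripMeasure T) := by
        rw [integral_add hI1 (hIm.const_mul _), integral_const_mul, integral_indicator hS,
          restrict_stripMeasure]
    _ ≤ ε / 2 + 1 / Y * (T * H) := by gcongr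
    _ ≤ ε := by
        have : 1 / Y * (T * H) = T * H / Y := by ring
        rw [this]; linarith

/-- Compactness of the particle approximations on a fixed torus. -/
theorem exists_subseq_torus (hk : SlopeBound (deriv K) B C) (hφ : AdmissibleDiffusion W φ)
    (hT : 0 < T) {L : ℝ} (hL : 0 < L) (hm : 0 ≤ m) (hM : 0 < M) {q : ℝ → ℝ} (hq : IsDatum q m M)
    {N : ℕ → ℕ} (hN : Tendsto N atTop atTop) {x : ℕ → ℤ → ℝ → ℝ}
    (hE : ∀ n, IsParticleEvolution K φ T L q (N n) (x n)) :
    ∃ (s : ℕ → ℕ) (ρ : ℝ × ℝ → ℝ), StrictMono s ∧ Integrable ρ (torusStripMeasure T L) ∧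
      Tendsto (fun n => ∫ z, |particleDensity (cellMass q L) (N (s n)) (x (s n)) z - ρ z|
        ∂(torusStripMeasure T L)) atTop (𝓝 0) := by
  obtain ⟨R, Q, hR0, hQ0, hRQ⟩ := exists_evolution_bounds hk hφ T m M hm hM
  have hc := hq.cellMass_pos hL
  refine exists_subseq_tendsto_integral
    (u := fun n => particleDensity (cellMass q L) (N n) (x n)) (fun n => ?_) fun ε hε => ?_
  · exact (hE n).integrableOn_particleDensity hT hL hc
      (hRQ T L q _ _ hT le_rfl hL hq (hE n)).1 _ _
  -- With `Y = L/2` the window is the whole fundamental domain, so no moment is needed on a fixed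
  -- torus.
  · obtain ⟨F, hF, hFi, hF0, δ, hδ, hnet⟩ := exists_grid_net hk hφ hT hm hM (half_pos hL) hε
    refine ⟨F, hF, fun f hf => (hFi f hf).mono_measure Measure.restrict_le_self, ?_⟩
    have h1 : Tendsto (fun n => L / (N n : ℝ)) atTop (𝓝 0) :=
      (tendsto_const_div_atTop_nhds_zero_nat L).comp hN
    filter_upwards [h1.eventually (gt_mem_nhds hδ)] with n hn
    exact hnet L q (N n) (x n) hL le_rfl hn.le hq (hE n)

/-- Compactness of the particle approximations on tori of increasing length. -/
theorem exists_subseq_line (hk : SlopeBound (deriv K) B C) (hφ : AdmissibleDiffusion W φ)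
    (hT : 0 < T) (hm : 0 ≤ m) (hM : 0 < M) {L : ℕ → ℝ} (hL : ∀ n, 0 < L n)
    (hLt : Tendsto L atTop atTop) {N : ℕ → ℕ}
    (hLN : Tendsto (fun n => L n / N n) atTop (𝓝 0)) {q : ℕ → ℝ → ℝ} (hq : ∀ n, IsDatum (q n) m M)
    (hmom : ∀ n, Integrable fun y => |y| * q n y) {A : ℝ} (hA : ∀ n, ∫ y, |y| * q n y ≤ A)
    {x : ℕ → ℤ → ℝ → ℝ} (hE : ∀ n, IsParticleEvolution K φ T (L n) (q n) (N n) (x n)) :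
    ∃ (s : ℕ → ℕ) (ρ : ℝ × ℝ → ℝ), StrictMono s ∧ Integrable ρ (stripMeasure T) ∧
      Tendsto (fun n => ∫ z, |stripCut (L (s n)) (particleDensity (cellMass (q (s n)) (L (s n)))
        (N (s n)) (x (s n))) z - ρ z| ∂(stripMeasure T)) atTop (𝓝 0) := by
  obtain ⟨R, Q, hR0, hQ0, hRQ⟩ := exists_evolution_bounds hk hφ T m M hm hM
  refine exists_subseq_tendsto_integral
    (u := fun n => stripCut (L n) (particleDensity (cellMass (q n) (L n)) (N n) (x n)))
    (fun n => ?_) fun ε hε => ?_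
  · exact integrable_stripCut_iff.2 ((hE n).integrableOn_particleDensity hT (hL n)
      ((hq n).cellMass_pos (hL n)) (hRQ T _ _ _ _ hT le_rfl (hL n) (hq n) (hE n)).1 _ _)
  · obtain ⟨F, hF, hFi, δ, hδ, Λ, hnet⟩ := exists_line_net hk hφ hT hm hM A hε
    refine ⟨F, hF, hFi, ?_⟩
    filter_upwards [hLN.eventually (gt_mem_nhds hδ), hLt.eventually_ge_atTop Λ] with n hn hΛ
    exact hnet (L n) (q n) (N n) (x n) (hL n) hΛ hn.le (hq n) (hmom n) (hA n) (hE n)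

end Compactness

end AggDiff

end

noncomputable section

namespace AggDiff

/-! ### The interaction kernel on the torus -/

section Kernel

variable {K : ℝ → ℝ} {L B C : ℝ}

theorem deriv_torusRep_mem_torusSlope (hk : SlopeBound (deriv K) B C) (L z : ℝ) :
    deriv K (torusRep L z) ∈ torusSlope K L z :=
  ⟨fun _ => rfl, fun h => by rw [h, hk.odd, abs_neg]⟩

theorem measurable_deriv_torusRep (K : ℝ → ℝ) (L x : ℝ) :
    Measurable fun y => deriv K (torusRep L (x - y)) :=
  (measurable_deriv K).comp ((measurable_torusRep L).comp (measurable_const.sub measurable_id))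

theorem intervalIntegrable_deriv_torusRep (hk : SlopeBound (deriv K) B C) (L x a b : ℝ) :
    IntervalIntegrable (fun y => deriv K (torusRep L (x - y))) volume a b := by
  refine (intervalIntegrable_const (c := B)).mono_fun
    (measurable_deriv_torusRep K L x).aestronglyMeasurable (Eventually.of_forall fun y => ?_)
  rw [Real.norm_eq_abs]
  exact (hk.bound _).trans (le_abs_self _)

namespace IsConfig

variable {N : ℕ} {c : ℝ} {x : ℤ → ℝ} (hx : IsConfig N L x)
include hx

/-- The interaction force on a particle is close to the force exerted by the density. -/
theorem abs_interaction_sub_integral_le (hk : SlopeBound (deriv K) B C) (hc : 0 < c)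
    {κ : ℤ → ℤ → ℝ} (hκ : ∀ k j, κ k j ∈ torusSlope K L (x k - x j))
    (hκp : ∀ k j, κ k (j + N) = κ k j) (k : ℤ) :
    |c / N * ∑ j ∈ Finset.Ico (0 : ℤ) N, κ k j -
      ∫ y in (-(L / 2))..(L / 2), configDensity c N x y * deriv K (torusRep L (x k - y))| ≤
      c / N * (C * L + 4 * B) := by
  have hL := hx.length_pos
  have hN := hx.natCast_pos
  have hB := hk.bound_nonneg
  let h : ℝ → ℝ := fun y => deriv K (torusRep L (x k - y))
  have hhp : Function.Periodic h L := fun y => by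
    simp only [h]
    have := torusRep_sub_mul hL (x k - y) 1
    rw [← this]; congr 2; push_cast; ring
  have hhi : ∀ a b, IntervalIntegrable h volume a b :=
    intervalIntegrable_deriv_torusRep hk L (x k)
  rw [hx.integral_comp_density (c := c) (fun r => r) hhi hhp, Finset.mul_sum,
    ← Finset.sum_sub_distrib]
  let F : ℤ → ℝ := fun j => c / N * κ k j - configCell c N x j * ∫ y in (x j)..(x (j + 1)), h y
  have hF : ∀ j, F (j + N) = F j := fun j => by
    simp only [F, hκp]
    rw [hx.cell_integral_periodic (fun r => r) hhp]
  change |∑ j ∈ Finset.Ico (0 : ℤ) N, F j| ≤ _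
  rw [← sum_Ico_int_shift hF (k - N + 1)]
  obtain ⟨p, hp⟩ := hx.exists_mem_cell (x k - L / 2)
  -- As a function of the source point, the force on `x_k` jumps at `x_k`, the left end of cell `k`,
  -- and at the antipode, in cell `p`. These two cells cost `2B` each.
  let bad : Finset ℤ := {k, p}
  have hterm : ∀ j ∈ Finset.Ico (k - N + 1) (k - N + 1 + N), |F j| ≤
      c / N * (C * (x (j + 1) - x j) + if j ∈ bad then 2 * B else 0) := by
    intro j hj
    simp only [Finset.mem_Ico] at hj
    have hg := hx.gap_pos j
    have e : F j = configCell c N x j * ∫ y in (x j)..(x (j + 1)), (κ k j - h y) := by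
      rw [intervalIntegral.integral_sub (by simp) (hhi _ _)]
      simp only [F, intervalIntegral.integral_const, smul_eq_mul]
      rw [← hx.cell_mul_gap j]; ring
    have hpt : ∀ y ∈ Ioo (x j) (x (j + 1)), |κ k j - h y| ≤
        C * (x (j + 1) - x j) + if j ∈ bad then 2 * B else 0 := by
      intro y hy
      have hm := deriv_torusRep_mem_torusSlope hk L (x k - y)
      split_ifs with hb
      · have h1 := abs_sub (κ k j) (h y)
        have h2 := abs_le_of_mem_torusSlope hk (hκ k j)
        have h3 : |h y| ≤ B := hk.bound _
        have := mul_nonneg hk.lip_nonneg hg.le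
        linarith
      · simp only [bad, Finset.mem_insert, Finset.mem_singleton, not_or] at hb
        have h1 : x (j + 1) ≤ x k := hx.strictMono.monotone (by omega)
        have h2 : x k < x j + L := by
          rw [← hx.periodic]; exact hx.strictMono (by omega)
        have hout : x (j + 1) ≤ x k - L / 2 ∨ x k - L / 2 < x j := by
          rcases lt_or_ge j p with h | h
          · left; exact (hx.strictMono.monotone (by omega : j + 1 ≤ p)).trans hp.1
          · right
            exact hp.2.trans_le (hx.strictMono.monotone (by omega))
        have := torusSlope_sub_le hk hL (hκ k j) hm (by
          rcases hout with h | h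
          · right; refine ⟨?_, ?_, ?_, ?_⟩ <;> linarith [hy.1, hy.2]
          · left; refine ⟨?_, ?_, ?_, ?_⟩ <;> linarith [hy.1, hy.2])
        rw [show x k - x j - (x k - y) = y - x j by ring,
          abs_of_pos (show 0 < y - x j by linarith [hy.1])] at this
        rw [add_zero]
        refine this.trans (mul_le_mul_of_nonneg_left ?_ hk.lip_nonneg)
        linarith [hy.2]
    have hint := intervalIntegral.norm_integral_le_of_norm_le_const_ae (a := x j) (b := x (j + 1))
      (f := fun y => κ k j - h y)
      (C := C * (x (j + 1) - x j) + if j ∈ bad then 2 * B else 0) (by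
        filter_upwards [Measure.ae_ne volume (x (j + 1))] with y hy hy2
        rw [uIoc_of_le (hx.lt j).le] at hy2
        exact hpt y ⟨hy2.1, lt_of_le_of_ne hy2.2 hy⟩)
    rw [abs_of_pos hg, Real.norm_eq_abs] at hint
    rw [e, abs_mul, abs_of_pos (hx.cell_pos hc j)]
    refine (mul_le_mul_of_nonneg_left hint (hx.cell_pos hc j).le).trans (le_of_eq ?_)
    rw [← hx.cell_mul_gap j]; ring
  refine (Finset.abs_sum_le_sum_abs _ _).trans ((Finset.sum_le_sum hterm).trans ?_)
  rw [← Finset.mul_sum, Finset.sum_add_distrib, ← Finset.mul_sum,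
    sum_Ico_int_shift (f := fun j => x (j + 1) - x j) (fun j => hx.gap_periodic j), hx.sum_gap]
  have h2 : ∑ j ∈ Finset.Ico (k - N + 1) (k - N + 1 + N), (if j ∈ bad then 2 * B else 0) ≤
      4 * B := by
    rw [← Finset.sum_filter, Finset.sum_const, nsmul_eq_mul]
    have hcard : (((Finset.Ico (k - N + 1) (k - N + 1 + N)).filter (· ∈ bad)).card : ℝ) ≤ 2 := by
      have h3 : ((Finset.Ico (k - N + 1) (k - N + 1 + N)).filter (· ∈ bad)).card ≤ bad.card :=
        Finset.card_le_card fun j hj => (Finset.mem_filter.1 hj).2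
      have h4 : bad.card ≤ 2 := Finset.card_le_two
      exact_mod_cast h3.trans h4
    nlinarith
  gcongr

/-- Discrete integration by parts for the diffusion. -/
theorem sum_mul_force_eq (hc : 0 < c) (φ : ℝ → ℝ) {G G' : ℝ → ℝ}
    (hG : ∀ y, HasDerivAt G (G' y) y) (hG' : Continuous G') (hGp : Function.Periodic G L)
    (hGp' : Function.Periodic G' L) :
    c / N * ∑ k ∈ Finset.Ico (0 : ℤ) N, G (x k) * configForce φ c N x k =
      -∫ y in (-(L / 2))..(L / 2), φ (configDensity c N x y) * G' y := by
  rw [hx.integral_comp_density φ (fun a b => hG'.intervalIntegrable a b) hGp', Finset.mul_sum]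
  have h1 : ∀ k, c / N * (G (x k) * configForce φ c N x k) =
      G (x k) * φ (configCell c N x k) - G (x k) * φ (configCell c N x (k - 1)) := fun k => by
    rw [← mul_sub, hx.sub_eq_force hc]; ring
  -- The integral of `G'` over a cell is a difference of values at particles, so the diffusion
  -- contributes no consistency error at all.
  have h2 : ∀ k, ∫ y in (x k)..(x (k + 1)), G' y = G (x (k + 1)) - G (x k) := fun k =>
    intervalIntegral.integral_eq_sub_of_hasDerivAt (fun y _ => hG y)
      (hG'.intervalIntegrable _ _)
  have h3 := sum_Ico_int_add_one (N := N)
    (f := fun k => G (x k) * φ (configCell c N x (k - 1))) fun k => by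
      have := hx.cell_periodic (c := c) (k - 1)
      rw [show k - 1 + N = k + N - 1 by ring] at this
      rw [hx.periodic, hGp, this]
  simp only [add_sub_cancel_right] at h3
  simp_rw [h1, h2]
  rw [Finset.sum_sub_distrib, ← h3, ← Finset.sum_sub_distrib, ← Finset.sum_neg_distrib]
  exact Finset.sum_congr rfl fun k _ => by ring

end IsConfig

end Kernel

/-! ### Compactly supported functions on the torus -/

section Local

variable {L r : ℝ}

/-- Near `z` one translation by `mL` represents the torus coordinate for every function supported in
`[-r, r]`: where the representative switches to another period, both arguments are outside the
support. Derivatives on the torus thus reduce to derivatives on the line. -/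
theorem eventually_comp_torusRep_eq (hL : 0 < L) (hr : r < L / 2) (z : ℝ) :
    ∃ m : ℤ, torusRep L z = z - m * L ∧ ∀ᶠ y in 𝓝 z, ∀ g : ℝ → ℝ, (∀ y, r < |y| → g y = 0) →
      g (torusRep L y) = g (y - m * L) := by
  obtain ⟨m, hm⟩ := exists_torusRep_eq L z
  refine ⟨m, hm, ?_⟩
  have hz := torusRep_mem hL z
  rw [hm] at hz
  have hopen : IsOpen {y : ℝ | |y - m * L| < L - r} :=
    isOpen_lt (by fun_prop) continuous_const
  filter_upwards [hopen.mem_nhds (show |z - m * L| < L - r by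
    have := abs_le.2 ⟨hz.1, hz.2.le⟩; linarith)] with y hy g hg
  obtain ⟨n, hn⟩ := exists_torusRep_eq L y
  have hn2 := torusRep_mem hL y
  by_cases hmn : n = m
  · rw [hn, hmn]
  · have h1 : L ≤ |(n - m : ℝ) * L| := by
      rw [abs_mul, abs_of_pos hL]
      have : (1 : ℝ) ≤ |(n - m : ℝ)| := by
        exact_mod_cast Int.one_le_abs (sub_ne_zero.2 hmn)
      nlinarith
    have e : (n - m : ℝ) * L = (y - m * L) - (y - n * L) := by ring
    have h2 := abs_sub (y - m * L) (y - n * L)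
    rw [← e] at h2
    rw [hn] at hn2 ⊢
    have h3 := abs_le.2 ⟨hn2.1, hn2.2.le⟩
    have hy' : |y - m * L| < L - r := hy
    rw [hg _ (by linarith), hg _ (by linarith)]

theorem hasDerivAt_comp_torusRep (hL : 0 < L) (hr : r < L / 2) {g g' : ℝ → ℝ}
    (hg : ∀ y, HasDerivAt g (g' y) y) (h0 : ∀ y, r < |y| → g y = 0) (z : ℝ) :
    HasDerivAt (fun y => g (torusRep L y)) (g' (torusRep L z)) z := by
  obtain ⟨m, hm, hev⟩ := eventually_comp_torusRep_eq hL hr z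
  rw [hm]
  have h := (hg (z - m * L)).comp z ((hasDerivAt_id z).sub_const (m * L))
  rw [mul_one] at h
  exact h.congr_of_eventuallyEq (hev.mono fun y hy => hy g h0)

theorem continuous_comp_torusRep_of_support (hL : 0 < L) (hr : r < L / 2) {g : ℝ → ℝ}
    (hg : Continuous g) (h0 : ∀ y, r < |y| → g y = 0) :
    Continuous fun y => g (torusRep L y) := by
  refine continuous_iff_continuousAt.2 fun z => ?_
  obtain ⟨m, hm, hev⟩ := eventually_comp_torusRep_eq hL hr z
  have h : ContinuousAt (fun y => g (y - m * L)) z := by fun_prop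
  exact h.congr (hev.mono fun y hy => (hy g h0).symm)

/-- The derivative along a moving point on the torus. -/
theorem hasDerivAt_comp_torusRep_path (hL : 0 < L) (hr : r < L / 2) {ψ : ℝ × ℝ → ℝ} {a b : ℝ}
    {x : ℝ → ℝ} {v t : ℝ} (hx : HasDerivAt x v t) (h0 : ∀ p : ℝ × ℝ, r < |p.2| → ψ p = 0)
    (hψ : HasFDerivAt ψ (a • ContinuousLinearMap.fst ℝ ℝ ℝ + b • ContinuousLinearMap.snd ℝ ℝ ℝ)
      (t, torusRep L (x t))) :
    HasDerivAt (fun s => ψ (s, torusRep L (x s))) (a + b * v) t := by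
  obtain ⟨m, hm, hev⟩ := eventually_comp_torusRep_eq hL hr (x t)
  rw [hm] at hψ
  have h := hψ.comp_hasDerivAt t ((hasDerivAt_id t).prodMk (hx.sub_const (m * L)))
  have h' : HasDerivAt (fun s => ψ (s, x s - m * L)) (a + b * v) t := by
    refine h.congr_deriv ?_
    simp
  refine h'.congr_of_eventuallyEq ?_
  filter_upwards [hx.continuousAt.eventually hev] with s hs
  exact hs (fun y => ψ (s, y)) fun y hy => h0 (s, y) hy

end Local

end AggDiff

end

noncomputable section

namespace AggDiff

/-! ### Test functions -/

/-- A test function with its derivatives, their bounds, and the width of its support in space. -/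
structure IsTestFunction (T : ℝ) (ψ ψt ψx ψxx : ℝ × ℝ → ℝ) (A r : ℝ) : Prop where
  width_nonneg : 0 ≤ r
  hasFDerivAt : ∀ p, HasFDerivAt ψ
    (ψt p • ContinuousLinearMap.fst ℝ ℝ ℝ + ψx p • ContinuousLinearMap.snd ℝ ℝ ℝ) p
  hasDerivAt : ∀ t y, HasDerivAt (fun y => ψx (t, y)) (ψxx (t, y)) y
  continuous_t : Continuous ψt
  continuous_x : Continuous ψx
  continuous_xx : Continuous ψxx
  bound_t : ∀ p, |ψt p| ≤ A
  bound_x : ∀ p, |ψx p| ≤ A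
  bound_xx : ∀ p, |ψxx p| ≤ A
  lip : ∀ s t y z, |ψ (s, y) - ψ (t, z)| ≤ A * (|s - t| + |y - z|)
  lip_t : ∀ t y z, |ψt (t, y) - ψt (t, z)| ≤ A * |y - z|
  lip_x : ∀ t y z, |ψx (t, y) - ψx (t, z)| ≤ A * |y - z|
  support : ∀ p : ℝ × ℝ, r < |p.2| → ψ p = 0
  support_t : ∀ p : ℝ × ℝ, r < |p.2| → ψt p = 0
  support_x : ∀ p : ℝ × ℝ, r < |p.2| → ψx p = 0
  support_xx : ∀ p : ℝ × ℝ, r < |p.2| → ψxx p = 0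
  final : ∀ y, ψ (T, y) = 0

namespace IsTestFunction

variable {T A r : ℝ} {ψ ψt ψx ψxx : ℝ × ℝ → ℝ} (h : IsTestFunction T ψ ψt ψx ψxx A r)
include h

theorem bound_nonneg : 0 ≤ A := (abs_nonneg _).trans (h.bound_t 0)

theorem deriv_t (p : ℝ × ℝ) : deriv (fun s => ψ (s, p.2)) p.1 = ψt p := by
  have h1 : HasFDerivAt ψ _ (p.1, p.2) := h.hasFDerivAt p
  have := h1.comp_hasDerivAt p.1 ((hasDerivAt_id p.1).prodMk (hasDerivAt_const p.1 p.2))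
  have h2 : HasDerivAt (fun s => ψ (s, p.2)) (ψt p) p.1 := this.congr_deriv (by simp)
  exact h2.deriv

theorem hasDerivAt_x (t y : ℝ) : HasDerivAt (fun y => ψ (t, y)) (ψx (t, y)) y := by
  have := (h.hasFDerivAt (t, y)).comp_hasDerivAt y ((hasDerivAt_const y t).prodMk (hasDerivAt_id y))
  exact this.congr_deriv (by simp)

theorem deriv_x (p : ℝ × ℝ) : deriv (fun y => ψ (p.1, y)) p.2 = ψx p :=
  (h.hasDerivAt_x p.1 p.2).deriv

theorem iteratedDeriv_x (p : ℝ × ℝ) : iteratedDeriv 2 (fun y => ψ (p.1, y)) p.2 = ψxx p := by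
  rw [iteratedDeriv_succ, iteratedDeriv_one]
  have : deriv (fun y => ψ (p.1, y)) = fun y => ψx (p.1, y) :=
    funext fun y => (h.hasDerivAt_x p.1 y).deriv
  rw [this]
  exact (h.hasDerivAt p.1 p.2).deriv

end IsTestFunction

theorem contDiff_fderiv_apply {ψ : ℝ × ℝ → ℝ} (h : ContDiff ℝ ∞ ψ) (v : ℝ × ℝ) :
    ContDiff ℝ ∞ fun p => fderiv ℝ ψ p v :=
  (h.fderiv_right (by norm_cast)).clm_apply contDiff_const

theorem hasFDerivAt_of_contDiff {ψ : ℝ × ℝ → ℝ} (h : ContDiff ℝ ∞ ψ) (p : ℝ × ℝ) :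
    HasFDerivAt ψ (fderiv ℝ ψ p (1, 0) • ContinuousLinearMap.fst ℝ ℝ ℝ +
      fderiv ℝ ψ p (0, 1) • ContinuousLinearMap.snd ℝ ℝ ℝ) p := by
  have h1 := (h.differentiable (by simp) p).hasFDerivAt
  have h2 : fderiv ℝ ψ p = fderiv ℝ ψ p (1, 0) • ContinuousLinearMap.fst ℝ ℝ ℝ +
      fderiv ℝ ψ p (0, 1) • ContinuousLinearMap.snd ℝ ℝ ℝ := by
    ext <;> simp
  rw [← h2]; exact h1

theorem exists_bounds_of_hasCompactSupport {χ : ℝ × ℝ → ℝ} (h : ContDiff ℝ ∞ χ)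
    (hc : HasCompactSupport χ) : ∃ A r : ℝ, 0 ≤ A ∧ 0 ≤ r ∧ (∀ p, |χ p| ≤ A) ∧
      (∀ s t y z, |χ (s, y) - χ (t, z)| ≤ A * (|s - t| + |y - z|)) ∧
      ∀ p : ℝ × ℝ, r < |p.2| → χ p = 0 := by
  obtain ⟨A₁, hA₁⟩ := hc.exists_bound_of_continuous h.continuous
  obtain ⟨A₂, hA₂⟩ := h.lipschitzWith_of_hasCompactSupport hc (by simp)
  obtain ⟨r, hr⟩ := hc.isBounded.subset_closedBall (0 : ℝ × ℝ)
  refine ⟨max A₁ A₂, max r 0, A₂.2.trans (le_max_right _ _), le_max_right _ _,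
    fun p => (hA₁ p).trans (le_max_left _ _), fun s t y z => ?_, fun p hp => ?_⟩
  · have h1 := hA₂.dist_le_mul (s, y) (t, z)
    rw [Real.dist_eq] at h1
    refine h1.trans (mul_le_mul (le_max_right _ _) ?_ dist_nonneg
      (A₂.2.trans (le_max_right _ _)))
    rw [Prod.dist_eq, Real.dist_eq, Real.dist_eq]
    exact max_le (le_add_of_nonneg_right (abs_nonneg _)) (le_add_of_nonneg_left (abs_nonneg _))
  · by_contra hcon
    have h1 := hr (subset_tsupport _ hcon)
    rw [mem_closedBall_zero_iff] at h1
    have h2 := norm_snd_le p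
    rw [Real.norm_eq_abs] at h2
    linarith [le_max_left r 0]

theorem exists_isTestFunction {T : ℝ} {ψ : ℝ × ℝ → ℝ} (h : ContDiff ℝ ∞ ψ)
    (hc : HasCompactSupport ψ) (hT : tsupport ψ ⊆ Iio T ×ˢ univ) :
    ∃ (ψt ψx ψxx : ℝ × ℝ → ℝ) (A r : ℝ), IsTestFunction T ψ ψt ψx ψxx A r := by
  have ht := contDiff_fderiv_apply h (1, 0)
  have hx := contDiff_fderiv_apply h (0, 1)
  have hxx := contDiff_fderiv_apply hx (0, 1)
  have hct := hc.fderiv_apply ℝ ((1, 0) : ℝ × ℝ)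
  have hcx := hc.fderiv_apply ℝ ((0, 1) : ℝ × ℝ)
  have hcxx := hcx.fderiv_apply ℝ ((0, 1) : ℝ × ℝ)
  obtain ⟨A₁, r₁, hA₁, hr₁, b₁, l₁, s₁⟩ := exists_bounds_of_hasCompactSupport h hc
  obtain ⟨A₂, r₂, hA₂, hr₂, b₂, l₂, s₂⟩ := exists_bounds_of_hasCompactSupport ht hct
  obtain ⟨A₃, r₃, hA₃, hr₃, b₃, l₃, s₃⟩ := exists_bounds_of_hasCompactSupport hx hcx
  obtain ⟨A₄, r₄, hA₄, hr₄, b₄, l₄, s₄⟩ := exists_bounds_of_hasCompactSupport hxx hcxx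
  refine ⟨_, _, _, A₁ + A₂ + A₃ + A₄, r₁ + r₂ + r₃ + r₄, by positivity,
    hasFDerivAt_of_contDiff h, fun t y => ?_, ht.continuous, hx.continuous, hxx.continuous,
    fun p => (b₂ p).trans (by linarith), fun p => (b₃ p).trans (by linarith),
    fun p => (b₄ p).trans (by linarith), fun s t y z => (l₁ s t y z).trans (by gcongr; linarith),
    fun t y z => (l₂ t t y z).trans ?_, fun t y z => (l₃ t t y z).trans ?_,
    fun p hp => s₁ p (by linarith), fun p hp => s₂ p (by linarith),
    fun p hp => s₃ p (by linarith), fun p hp => s₄ p (by linarith), fun y => ?_⟩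
  · have := (hasFDerivAt_of_contDiff hx (t, y)).comp_hasDerivAt y
      ((hasDerivAt_const y t).prodMk (hasDerivAt_id y))
    exact this.congr_deriv (by simp)
  · rw [sub_self, abs_zero, zero_add]; gcongr; linarith
  · rw [sub_self, abs_zero, zero_add]; gcongr; linarith
  · by_contra hcon
    have : (T, y) ∈ Iio T ×ˢ (univ : Set ℝ) := hT (subset_tsupport _ hcon)
    exact lt_irrefl T this.1

/-! ### The force of a density on the line -/

section Force

variable {k : ℝ → ℝ} {B C R : ℝ} {w : ℝ → ℝ}

theorem integrable_slope_mul (hk : SlopeBound k B C) (hkm : Measurable k) (hw : Integrable w)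
    (x : ℝ) : Integrable fun y => k (x - y) * w y := by
  refine hw.bdd_mul (c := B) (hkm.comp (measurable_const.sub measurable_id)).aestronglyMeasurable
    (Eventually.of_forall fun y => ?_)
  exact hk.bound _

theorem abs_force_le (hk : SlopeBound k B C) (hw : Integrable w) (x : ℝ) :
    |∫ y, k (x - y) * w y| ≤ B * ∫ y, |w y| := by
  rw [← Real.norm_eq_abs, ← integral_const_mul]
  refine norm_integral_le_of_norm_le (hw.abs.const_mul B) (Eventually.of_forall fun y => ?_)
  rw [Real.norm_eq_abs, abs_mul]
  exact mul_le_mul_of_nonneg_right (hk.bound _) (abs_nonneg _)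

/-- If `y` is outside `[x, x']`, both arguments of `k` have the same sign and `k` is Lipschitz;
inside, the jump of `k` costs `2B` against a density of at most `R`. The force of a bounded density
is therefore Lipschitz although the kernel jumps. -/
theorem abs_force_sub_le (hk : SlopeBound k B C) (hkm : Measurable k) (hw : Integrable w)
    (hR : ∀ y, |w y| ≤ R) (x x' : ℝ) :
    |(∫ y, k (x - y) * w y) - ∫ y, k (x' - y) * w y| ≤
      (C * (∫ y, |w y|) + 2 * B * R) * |x - x'| := by
  wlog hxx : x ≤ x' generalizing x x'
  · rw [abs_sub_comm, abs_sub_comm x]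
    exact this x' x (le_of_not_ge hxx)
  have hB := hk.bound_nonneg
  rw [← integral_sub (integrable_slope_mul hk hkm hw x) (integrable_slope_mul hk hkm hw x'),
    abs_sub_comm x, abs_of_nonneg (sub_nonneg.2 hxx)]
  have hi : Integrable ((Icc x x').indicator fun _ : ℝ => 2 * B * R) :=
    (integrable_indicator_iff measurableSet_Icc).2 (integrableOn_const (by simp))
  calc _ ≤ ∫ y, (C * (x' - x) * |w y| + (Icc x x').indicator (fun _ => 2 * B * R) y) := by
        rw [← Real.norm_eq_abs]
        refine norm_integral_le_of_norm_le ((hw.abs.const_mul _).add hi)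
          (Eventually.of_forall fun y => ?_)
        rw [Real.norm_eq_abs, ← sub_mul, abs_mul]
        by_cases hy : y ∈ Icc x x'
        · rw [indicator_of_mem hy]
          have h1 := hk.sub_le (x - y) (x' - y)
          have h2 : |k (x - y) - k (x' - y)| * |w y| ≤ 2 * B * R :=
            mul_le_mul h1 (hR y) (abs_nonneg _) (by positivity)
          have h3 : 0 ≤ C * (x' - x) * |w y| :=
            mul_nonneg (mul_nonneg hk.lip_nonneg (sub_nonneg.2 hxx)) (abs_nonneg _)
          linarith
        · rw [indicator_of_notMem hy, add_zero]
          refine mul_le_mul_of_nonneg_right ?_ (abs_nonneg _)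
          have e : |x - y - (x' - y)| = x' - x := by
            rw [show x - y - (x' - y) = -(x' - x) by ring, abs_neg,
              abs_of_nonneg (sub_nonneg.2 hxx)]
          rw [← e]
          rcases lt_or_ge y x with h | h
          · exact hk.lip _ _ (by linarith) (by linarith)
          · have : x' < y := by
              by_contra hcon; exact hy ⟨h, not_lt.1 hcon⟩
            exact hk.lip_neg (by linarith) (by linarith)
    _ = _ := by
        rw [integral_add (hw.abs.const_mul _) hi, integral_const_mul,
          integral_indicator measurableSet_Icc]
        simp only [integral_const, smul_eq_mul, MeasurableSet.univ, measureReal_restrict_apply,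
          univ_inter, Real.volume_real_Icc]
        rw [max_eq_left (sub_nonneg.2 hxx)]; ring

end Force

/-! ### Consistency at a fixed time -/

namespace IsConfig

variable {K : ℝ → ℝ} {L B C R H A r c : ℝ} {N : ℕ} {x : ℤ → ℝ} (hx : IsConfig N L x)
include hx

/-- For `|z| ≤ r` the torus and the line give the same slope unless `|y| ≥ L/2 - r`, and the first
moment bounds the mass there. -/
theorem abs_torus_force_sub_le (hk : SlopeBound (deriv K) B C) (hc : 0 < c)
    (hR : ∀ k, configCell c N x k ≤ R) (hrL : r < L / 2)
    (hH : ∫ y in (-(L / 2))..(L / 2), configDensity c N x y * |y| ≤ H) {z : ℝ} (hz : |z| ≤ r) :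
    |(∫ y in (-(L / 2))..(L / 2), configDensity c N x y * deriv K (torusRep L (z - y))) -
      ∫ y, deriv K (z - y) * (Ico (-(L / 2)) (L / 2)).indicator (configDensity c N x) y| ≤
      2 * B * H / (L / 2 - r) := by
  have hL := hx.length_pos
  have hB := hk.bound_nonneg
  have e : ∫ y, deriv K (z - y) * (Ico (-(L / 2)) (L / 2)).indicator (configDensity c N x) y =
      ∫ y in (-(L / 2))..(L / 2), configDensity c N x y * deriv K (z - y) := by
    rw [intervalIntegral.integral_of_le (by linarith), ← integral_Ico_eq_integral_Ioc,
      ← integral_indicator measurableSet_Ico]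
    refine integral_congr_ae (Eventually.of_forall fun y => ?_)
    by_cases hy : y ∈ Ico (-(L / 2)) (L / 2)
    · simp only [indicator_of_mem hy]; ring
    · simp only [indicator_of_notMem hy]; ring
  have hdens : IntervalIntegrable (configDensity c N x) volume (-(L / 2)) (L / 2) := by
    simpa using hx.intervalIntegrable_mul_density hc hR (G := fun _ => 1) continuous_const
      (-(L / 2)) (L / 2)
  have hi1 : IntervalIntegrable (fun y => configDensity c N x y * deriv K (torusRep L (z - y)))
      volume (-(L / 2)) (L / 2) := by
    rw [intervalIntegrable_iff] at hdens ⊢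
    exact hdens.mul_bdd (c := B) (measurable_deriv_torusRep K L z).aestronglyMeasurable
      (Eventually.of_forall fun y => hk.bound _)
  have hi2 : IntervalIntegrable (fun y => configDensity c N x y * deriv K (z - y))
      volume (-(L / 2)) (L / 2) := by
    rw [intervalIntegrable_iff] at hdens ⊢
    exact hdens.mul_bdd (c := B) ((measurable_deriv K).comp
      (measurable_const.sub measurable_id)).aestronglyMeasurable
      (Eventually.of_forall fun y => hk.bound _)
  have hi3 := hx.intervalIntegrable_mul_density hc hR continuous_abs (-(L / 2)) (L / 2)
  have hd : 0 < L / 2 - r := by linarith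
  rw [e, ← intervalIntegral.integral_sub hi1 hi2]
  calc _ ≤ ∫ y in (-(L / 2))..(L / 2), 2 * B / (L / 2 - r) * (configDensity c N x y * |y|) := by
        rw [← Real.norm_eq_abs]
        refine intervalIntegral.norm_integral_le_of_norm_le (by linarith)
          (Eventually.of_forall fun y hy => ?_) (hi3.const_mul _)
        rw [Real.norm_eq_abs]
        have hpos := hx.density_pos hc y
        rw [← mul_sub, abs_mul, abs_of_pos hpos]
        by_cases hyr : |y| < L / 2 - r
        · rw [abs_lt] at hyr
          rw [abs_le] at hz
          rw [torusRep_eq_self hL ⟨by linarith, by linarith⟩, sub_self, abs_zero, mul_zero]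
          positivity
        · have h1 := hk.sub_le (torusRep L (z - y)) (z - y)
          have h2 : 1 ≤ |y| / (L / 2 - r) := (one_le_div hd).2 (not_lt.1 hyr)
          calc _ ≤ configDensity c N x y * (2 * B * (|y| / (L / 2 - r))) := by
                refine mul_le_mul_of_nonneg_left (h1.trans ?_) hpos.le
                exact le_mul_of_one_le_right (by positivity) h2
            _ = _ := by ring
    _ ≤ 2 * B / (L / 2 - r) * H := by
        rw [intervalIntegral.integral_const_mul]; gcongr
    _ = _ := by ring

theorem integrable_indicator_density (hc : 0 < c) (hR : ∀ k, configCell c N x k ≤ R) :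
    Integrable ((Ico (-(L / 2)) (L / 2)).indicator (configDensity c N x)) := by
  have hL := hx.length_pos
  have h := hx.intervalIntegrable_mul_density hc hR (G := fun _ => 1) continuous_const
      (-(L / 2)) (L / 2)
  simp only [mul_one] at h
  rw [intervalIntegrable_iff_integrableOn_Ico_of_le (by linarith)] at h
  exact (integrable_indicator_iff measurableSet_Ico).2 h

theorem integral_abs_indicator_density (hc : 0 < c) :
    ∫ y, |(Ico (-(L / 2)) (L / 2)).indicator (configDensity c N x) y| = c := by
  have hL := hx.length_pos
  have : ∀ y, |(Ico (-(L / 2)) (L / 2)).indicator (configDensity c N x) y| =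
      (Ico (-(L / 2)) (L / 2)).indicator (configDensity c N x) y := fun y =>
    abs_of_nonneg (indicator_nonneg (fun y _ => (hx.density_pos hc y).le) y)
  simp_rw [this]
  rw [integral_indicator measurableSet_Ico, integral_Ico_eq_integral_Ioc,
    ← intervalIntegral.integral_of_le (by linarith), hx.integral_density]

/-- The weak form of the equation at a fixed time, with an error due to the discretization and an
error due to the finite length of the torus. -/
theorem abs_velocity_sub_weak_le (hk : SlopeBound (deriv K) B C) (hc : 0 < c)
    (hR0 : 0 ≤ R) (hR : ∀ k, configCell c N x k ≤ R) (hr : 0 ≤ r) (hrL : r < L / 2)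
    (hH : ∫ y in (-(L / 2))..(L / 2), configDensity c N x y * |y| ≤ H)
    {κ : ℤ → ℤ → ℝ} (hκ : ∀ k j, κ k j ∈ torusSlope K L (x k - x j))
    (hκp : ∀ k j, κ k (j + N) = κ k j) (φ : ℝ → ℝ) {T t : ℝ} {ψ ψt ψx ψxx : ℝ × ℝ → ℝ}
    (hψ : IsTestFunction T ψ ψt ψx ψxx A r) {U : ℝ → ℝ} (hU : U = fun z =>
      ∫ y, deriv K (z - y) * (Ico (-(L / 2)) (L / 2)).indicator (configDensity c N x) y)
    (hφi : IntervalIntegrable (fun y => φ (configDensity c N x y) * ψxx (t, y)) volume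
      (-(L / 2)) (L / 2)) :
    |c / N * (∑ k ∈ Finset.Ico (0 : ℤ) N, (ψt (t, torusRep L (x k)) +
        ψx (t, torusRep L (x k)) * (-(c / N) * (∑ j ∈ Finset.Ico (0 : ℤ) N, κ k j) -
          configForce φ c N x k))) -
      ∫ y in (-(L / 2))..(L / 2), (configDensity c N x y * ψt (t, y) -
        configDensity c N x y * U y * ψx (t, y) + φ (configDensity c N x y) * ψxx (t, y))| ≤
      A * (c / N * L) + A * c * (c / N * (C * L + 4 * B) + 2 * B * H / (L / 2 - r)) +
        A * (B * c + C * c + 2 * B * R) * (c / N * L) := by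
  have hL := hx.length_pos
  have hN := hx.natCast_pos
  have hB := hk.bound_nonneg
  have hC := hk.lip_nonneg
  have hA := hψ.bound_nonneg
  have hwi := hx.integrable_indicator_density hc hR
  have hw1 := hx.integral_abs_indicator_density hc
  have hwR : ∀ y, |(Ico (-(L / 2)) (L / 2)).indicator (configDensity c N x) y| ≤ R := fun y => by
    by_cases hy : y ∈ Ico (-(L / 2)) (L / 2)
    · rw [indicator_of_mem hy, abs_of_pos (hx.density_pos hc y)]
      exact hx.density_le hR y
    · rw [indicator_of_notMem hy, abs_zero]; exact hR0
  have hUb : ∀ z, |U z| ≤ B * c := fun z => by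
    have := abs_force_le hk hwi z
    rw [hw1] at this
    rw [hU]; exact this
  have hUl : ∀ z z', |U z - U z'| ≤ (C * c + 2 * B * R) * |z - z'| := fun z z' => by
    have := abs_force_sub_le hk (measurable_deriv K) hwi hwR z z'
    rw [hw1] at this
    rw [hU]; exact this
  have habs : |L / 2| = L / 2 := abs_of_pos (by linarith)
  have hbd : ∀ g : ℝ → ℝ, (∀ y, r < |y| → g y = 0) → g (-(L / 2)) = g (L / 2) := fun g hg => by
    rw [hg _ (by rw [abs_neg, habs]; exact hrL), hg _ (by rw [habs]; exact hrL)]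
  -- the time derivative
  have hbt := hbd (fun y => ψt (t, y)) fun y hy => hψ.support_t (t, y) hy
  have q1 := hx.abs_quadrature_le hc (G := fun y => ψt (t, torusRep L y)) (A := A)
    (abs_comp_torusRep_sub_le (g := fun y => ψt (t, y)) hL (fun u _ v _ => hψ.lip_t t u v) hbt)
    (continuous_comp_torusRep (g := fun y => ψt (t, y)) hL (fun u _ v _ => hψ.lip_t t u v) hbt)
    (periodic_comp_torusRep hL fun y => ψt (t, y))
  rw [integral_mul_comp_torusRep hL _ fun y => ψt (t, y)] at q1
  -- the interaction
  let P : ℝ → ℝ := fun y => U y * ψx (t, y)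
  have hPl : ∀ u ∈ Icc (-(L / 2)) (L / 2), ∀ v ∈ Icc (-(L / 2)) (L / 2),
      |P u - P v| ≤ A * (B * c + C * c + 2 * B * R) * |u - v| := fun u _ v _ => by
    have e : P u - P v = U u * (ψx (t, u) - ψx (t, v)) + (U u - U v) * ψx (t, v) := by
      simp only [P]; ring
    rw [e]
    refine (abs_add_le _ _).trans ?_
    rw [abs_mul, abs_mul]
    have h1 : |U u| * |ψx (t, u) - ψx (t, v)| ≤ (B * c) * (A * |u - v|) :=
      mul_le_mul (hUb u) (hψ.lip_x t u v) (abs_nonneg _) (by positivity)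
    have h2 : |U u - U v| * |ψx (t, v)| ≤ ((C * c + 2 * B * R) * |u - v|) * A :=
      mul_le_mul (hUl u v) (hψ.bound_x _) (abs_nonneg _) (by positivity)
    linarith
  have hP0 := hbd P fun y hy => by simp only [P]; rw [hψ.support_x (t, y) hy, mul_zero]
  have q2 := hx.abs_quadrature_le hc (abs_comp_torusRep_sub_le hL hPl hP0)
    (continuous_comp_torusRep hL hPl hP0) (periodic_comp_torusRep hL P)
  rw [integral_mul_comp_torusRep hL _ P] at q2
  -- Only particles represented in `[-r, r]` count. For these the discrete force is compared with
  -- the force of the density on the torus, and that one with the force on the line.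
  have q3 : |c / N * (∑ k ∈ Finset.Ico (0 : ℤ) N, ψx (t, torusRep L (x k)) *
      (c / N * ∑ j ∈ Finset.Ico (0 : ℤ) N, κ k j)) -
      c / N * ∑ k ∈ Finset.Ico (0 : ℤ) N, P (torusRep L (x k))| ≤
      A * c * (c / N * (C * L + 4 * B) + 2 * B * H / (L / 2 - r)) := by
    have hH0 : 0 ≤ H := by
      refine le_trans ?_ hH
      exact intervalIntegral.integral_nonneg (by linarith) fun y _ =>
        mul_nonneg (hx.density_pos hc y).le (abs_nonneg _)
    have hd : 0 < L / 2 - r := by linarith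
    have hterm : ∀ k ∈ Finset.Ico (0 : ℤ) N, |ψx (t, torusRep L (x k)) *
        (c / N * ∑ j ∈ Finset.Ico (0 : ℤ) N, κ k j) - P (torusRep L (x k))| ≤
        A * (c / N * (C * L + 4 * B) + 2 * B * H / (L / 2 - r)) := by
      intro k _
      have e : ψx (t, torusRep L (x k)) * (c / N * ∑ j ∈ Finset.Ico (0 : ℤ) N, κ k j) -
          P (torusRep L (x k)) = ψx (t, torusRep L (x k)) *
          (c / N * (∑ j ∈ Finset.Ico (0 : ℤ) N, κ k j) - U (torusRep L (x k))) := by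
        simp only [P]; ring
      rw [e, abs_mul]
      by_cases hk' : r < |torusRep L (x k)|
      · rw [hψ.support_x (t, torusRep L (x k)) hk', abs_zero, zero_mul]
        positivity
      · push Not at hk'
        refine mul_le_mul (hψ.bound_x _) ?_ (abs_nonneg _) hA
        have i1 := hx.abs_interaction_sub_integral_le hk hc hκ hκp k
        have i2 := hx.abs_torus_force_sub_le hk hc hR hrL hH hk'
        have i3 : ∫ y in (-(L / 2))..(L / 2), configDensity c N x y *
              deriv K (torusRep L (x k - y)) =
            ∫ y in (-(L / 2))..(L / 2), configDensity c N x y *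
              deriv K (torusRep L (torusRep L (x k) - y)) := by
          obtain ⟨m, hm⟩ := exists_torusRep_eq L (x k)
          refine intervalIntegral.integral_congr fun y _ => ?_
          rw [hm, show x k - m * L - y = x k - y - m * L by ring, torusRep_sub_mul hL]
        rw [i3] at i1
        rw [hU]
        exact (abs_sub_le _ _ _).trans (add_le_add i1 i2)
    rw [← mul_sub, ← Finset.sum_sub_distrib, abs_mul, abs_of_pos (by positivity)]
    calc _ ≤ c / N * ∑ _k ∈ Finset.Ico (0 : ℤ) N,
          A * (c / N * (C * L + 4 * B) + 2 * B * H / (L / 2 - r)) := by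
          refine mul_le_mul_of_nonneg_left ?_ (by positivity)
          exact (Finset.abs_sum_le_sum_abs _ _).trans (Finset.sum_le_sum hterm)
      _ = _ := by rw [sum_Ico_int_const]; field_simp
  -- the diffusion
  have q4 := hx.sum_mul_force_eq hc φ (G := fun y => ψx (t, torusRep L y))
    (G' := fun y => ψxx (t, torusRep L y))
    (hasDerivAt_comp_torusRep (g := fun y => ψx (t, y)) (g' := fun y => ψxx (t, y)) hL hrL
      (hψ.hasDerivAt t) fun y hy => hψ.support_x (t, y) hy)
    (continuous_comp_torusRep_of_support (g := fun y => ψxx (t, y)) hL hrL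
      (hψ.continuous_xx.comp (by fun_prop)) fun y hy => hψ.support_xx (t, y) hy)
    (periodic_comp_torusRep hL fun y => ψx (t, y)) (periodic_comp_torusRep hL fun y => ψxx (t, y))
  rw [integral_mul_comp_torusRep hL _ fun y => ψxx (t, y)] at q4
  have hUc : Continuous U := by
    have : LipschitzWith (C * c + 2 * B * R).toNNReal U := LipschitzWith.of_dist_le_mul
      fun y z => by
        rw [Real.dist_eq, Real.dist_eq, Real.coe_toNNReal _ (by positivity)]
        exact hUl y z
    exact this.continuous
  have j1 := hx.intervalIntegrable_mul_density hc hR (G := fun y => ψt (t, y))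
    (hψ.continuous_t.comp (by fun_prop)) (-(L / 2)) (L / 2)
  have j2 := hx.intervalIntegrable_mul_density hc hR (G := P)
    (hUc.mul (hψ.continuous_x.comp (by fun_prop))) (-(L / 2)) (L / 2)
  have e1 : ∫ y in (-(L / 2))..(L / 2), (configDensity c N x y * ψt (t, y) -
        configDensity c N x y * U y * ψx (t, y) + φ (configDensity c N x y) * ψxx (t, y)) =
      (∫ y in (-(L / 2))..(L / 2), configDensity c N x y * ψt (t, y)) -
      (∫ y in (-(L / 2))..(L / 2), configDensity c N x y * P y) +
      ∫ y in (-(L / 2))..(L / 2), φ (configDensity c N x y) * ψxx (t, y) := by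
    rw [← intervalIntegral.integral_sub j1 j2, ← intervalIntegral.integral_add (j1.sub j2) hφi]
    refine intervalIntegral.integral_congr fun y _ => ?_
    simp only [P]; ring
  have e2 : c / N * (∑ k ∈ Finset.Ico (0 : ℤ) N, (ψt (t, torusRep L (x k)) +
        ψx (t, torusRep L (x k)) * (-(c / N) * (∑ j ∈ Finset.Ico (0 : ℤ) N, κ k j) -
          configForce φ c N x k))) =
      c / N * (∑ k ∈ Finset.Ico (0 : ℤ) N, ψt (t, torusRep L (x k))) -
      c / N * (∑ k ∈ Finset.Ico (0 : ℤ) N, ψx (t, torusRep L (x k)) *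
        (c / N * ∑ j ∈ Finset.Ico (0 : ℤ) N, κ k j)) -
      c / N * ∑ k ∈ Finset.Ico (0 : ℤ) N, ψx (t, torusRep L (x k)) * configForce φ c N x k := by
    rw [← mul_sub, ← mul_sub, ← Finset.sum_sub_distrib, ← Finset.sum_sub_distrib]
    congr 1
    exact Finset.sum_congr rfl fun k _ => by ring
  rw [e1, e2, q4]
  rw [abs_le] at q1 q2 q3 ⊢
  constructor <;> nlinarith [q1.1, q1.2, q2.1, q2.2, q3.1, q3.2]

end IsConfig

end AggDiff

end

noncomputable section

namespace AggDiff

/-! ### The weak formulation as a functional on `L¹` -/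

theorem stripMeasure_eq_prod (T : ℝ) :
    stripMeasure T = ((volume : Measure ℝ).restrict (Icc 0 T)).prod volume := by
  rw [stripMeasure, Measure.volume_eq_prod, ← Measure.prod_restrict, Measure.restrict_univ]

theorem ae_stripMeasure_of_ae {T : ℝ} {P : ℝ → Prop}
    (h : ∀ᵐ t ∂((volume : Measure ℝ).restrict (Icc 0 T)), P t) :
    ∀ᵐ p ∂(stripMeasure T), P p.1 := by
  rw [stripMeasure_eq_prod]
  exact Measure.quasiMeasurePreserving_fst.ae h

/-- The interaction force of a density on space-time. -/
def lineForce (k : ℝ → ℝ) (w : ℝ × ℝ → ℝ) (p : ℝ × ℝ) : ℝ := ∫ y, k (p.2 - y) * w (p.1, y)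

/-- The integrand in the weak formulation of the equation. -/
def weakIntegrand (k φ : ℝ → ℝ) (ψt ψx ψxx : ℝ × ℝ → ℝ) (w : ℝ × ℝ → ℝ) (p : ℝ × ℝ) : ℝ :=
  w p * ψt p - w p * lineForce k w p * ψx p + φ (w p) * ψxx p

section Weak

variable {k : ℝ → ℝ} {T B C R A r : ℝ} {w v : ℝ × ℝ → ℝ} {ψ ψt ψx ψxx : ℝ × ℝ → ℝ}

theorem ae_integrable_slice (hw : Integrable w (stripMeasure T)) :
    ∀ᵐ t ∂((volume : Measure ℝ).restrict (Icc 0 T)), Integrable fun y => w (t, y) := by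
  rw [stripMeasure_eq_prod] at hw
  exact hw.prod_right_ae

/-- The integral with parameter is measurable for a strongly measurable representative of `w`, and
for almost every time the slices agree almost everywhere, which leaves the force unchanged. -/
theorem aestronglyMeasurable_lineForce (hkm : Measurable k) (hw : Integrable w (stripMeasure T)) :
    AEStronglyMeasurable (lineForce k w) (stripMeasure T) := by
  have h := hw.aestronglyMeasurable
  have hm := h.stronglyMeasurable_mk
  have he := h.ae_eq_mk
  set w' := h.mk w
  rw [stripMeasure_eq_prod] at he
  refine ⟨lineForce k w', ?_, ?_⟩
  · refine StronglyMeasurable.integral_prod_right (f := fun (p : ℝ × ℝ) y =>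
      k (p.2 - y) * w' (p.1, y)) (Measurable.stronglyMeasurable ?_)
    exact (hkm.comp (measurable_fst.snd.sub measurable_snd)).mul
      (hm.measurable.comp (measurable_fst.fst.prodMk measurable_snd))
  · filter_upwards [ae_stripMeasure_of_ae (Measure.ae_ae_of_ae_prod he)] with p hp
    refine integral_congr_ae ?_
    filter_upwards [hp] with y hy
    rw [hy]

theorem ae_abs_lineForce_le (hk : SlopeBound k B C) (hw : Integrable w (stripMeasure T)) :
    ∀ᵐ p ∂(stripMeasure T), |lineForce k w p| ≤ B * ∫ y, |w (p.1, y)| := by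
  filter_upwards [ae_stripMeasure_of_ae (ae_integrable_slice hw)] with p hp
  exact abs_force_le hk hp p.2

theorem ae_lineForce_sub (hk : SlopeBound k B C) (hkm : Measurable k)
    (hw : Integrable w (stripMeasure T)) (hv : Integrable v (stripMeasure T)) :
    ∀ᵐ p ∂(stripMeasure T), lineForce k w p - lineForce k v p =
      lineForce k (fun z => w z - v z) p := by
  filter_upwards [ae_stripMeasure_of_ae (ae_integrable_slice hw),
    ae_stripMeasure_of_ae (ae_integrable_slice hv)] with p hp hp'
  simp only [lineForce]
  rw [← integral_sub (integrable_slope_mul hk hkm hp p.2) (integrable_slope_mul hk hkm hp' p.2)]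
  exact integral_congr_ae (Eventually.of_forall fun y => by ring)

/-- This product majorizes the interaction term. The force does not decay in space in a controlled
way, so integrability in space comes from the support of the test function alone. -/
theorem integrable_slice_mul_indicator (hw : Integrable w (stripMeasure T)) (r : ℝ) :
    Integrable (fun p : ℝ × ℝ => (∫ y, |w (p.1, y)|) *
      (Icc (-r) r).indicator (fun _ => (1 : ℝ)) p.2) (stripMeasure T) := by
  rw [stripMeasure_eq_prod] at hw ⊢
  exact hw.abs.integral_prod_left.mul_prod
    ((integrable_indicator_iff measurableSet_Icc).2 (integrableOn_const (by simp)))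

theorem integral_slice_mul_indicator (hw : Integrable w (stripMeasure T)) (hr : 0 ≤ r) :
    ∫ p, (∫ y, |w (p.1, y)|) * (Icc (-r) r).indicator (fun _ => (1 : ℝ)) p.2 ∂(stripMeasure T) =
      (∫ p, |w p| ∂(stripMeasure T)) * (2 * r) := by
  rw [stripMeasure_eq_prod] at hw ⊢
  rw [integral_prod_mul (fun t => ∫ y, |w (t, y)|) ((Icc (-r) r).indicator fun _ => (1 : ℝ)),
    integral_prod _ hw.abs, integral_indicator measurableSet_Icc]
  simp only [integral_const, smul_eq_mul, MeasurableSet.univ, measureReal_restrict_apply,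
    univ_inter, Real.volume_real_Icc]
  rw [max_eq_left (by linarith)]; ring

variable {W φ : ℝ → ℝ}

theorem aestronglyMeasurable_comp_diffusion (hφ : AdmissibleDiffusion W φ)
    (hw : AEStronglyMeasurable w (stripMeasure T)) (h0 : ∀ᵐ p ∂(stripMeasure T), 0 ≤ w p) :
    AEStronglyMeasurable (fun p => φ (w p)) (stripMeasure T) := by
  have hc : Continuous fun r => φ (max 0 r) :=
    hφ.contDiffOn.continuousOn.comp_continuous (by fun_prop) fun r => mem_Ici.2 (le_max_left _ _)
  refine (hc.comp_aestronglyMeasurable hw).congr ?_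
  filter_upwards [h0] with p hp
  rw [max_eq_right hp]

theorem abs_le_indicator (hψ : IsTestFunction T ψ ψt ψx ψxx A r) (p : ℝ × ℝ) :
    |ψx p| ≤ A * (Icc (-r) r).indicator (fun _ => (1 : ℝ)) p.2 := by
  by_cases hp : p.2 ∈ Icc (-r) r
  · rw [indicator_of_mem hp, mul_one]; exact hψ.bound_x p
  · rw [indicator_of_notMem hp, mul_zero, hψ.support_x p, abs_zero]
    by_contra hcon
    exact hp (abs_le.1 (not_lt.1 hcon))

theorem integrable_weakIntegrand (hk : SlopeBound k B C) (hkm : Measurable k)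
    (hφ : AdmissibleDiffusion W φ) (hψ : IsTestFunction T ψ ψt ψx ψxx A r)
    (hw : Integrable w (stripMeasure T)) (h0 : ∀ᵐ p ∂(stripMeasure T), 0 ≤ w p)
    (hR : ∀ᵐ p ∂(stripMeasure T), w p ≤ R) :
    Integrable (weakIntegrand k φ ψt ψx ψxx w) (stripMeasure T) := by
  obtain ⟨Λ, hΛ, hlip⟩ := hφ.exists_lipschitz R
  have hB := hk.bound_nonneg
  refine (Integrable.sub ?_ ?_).add ?_
  · exact hw.mul_bdd (c := A) hψ.continuous_t.aestronglyMeasurable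
      (Eventually.of_forall hψ.bound_t)
  · refine ((integrable_slice_mul_indicator hw r).const_mul (R * B * A)).mono'
      ((hw.aestronglyMeasurable.mul (aestronglyMeasurable_lineForce hkm hw)).mul
        hψ.continuous_x.aestronglyMeasurable) ?_
    filter_upwards [h0, hR, ae_abs_lineForce_le hk hw] with p h1 h2 h3
    rw [Real.norm_eq_abs, abs_mul, abs_mul, abs_of_nonneg h1]
    have hg : 0 ≤ ∫ y, |w (p.1, y)| := integral_nonneg fun y => abs_nonneg _
    calc _ ≤ R * (B * ∫ y, |w (p.1, y)|) * (A * (Icc (-r) r).indicator (fun _ => (1 : ℝ)) p.2) := by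
          refine mul_le_mul ?_ (abs_le_indicator hψ p) (abs_nonneg _)
            (mul_nonneg (h1.trans h2) (by positivity))
          exact mul_le_mul h2 h3 (abs_nonneg _) (h1.trans h2)
      _ = _ := by ring
  · refine Integrable.mul_bdd (c := A) ?_ hψ.continuous_xx.aestronglyMeasurable
      (Eventually.of_forall hψ.bound_xx)
    refine (hw.const_mul Λ).mono' (aestronglyMeasurable_comp_diffusion hφ
      hw.aestronglyMeasurable h0) ?_
    filter_upwards [h0, hR] with p h1 h2
    have := hlip (w p) ⟨h1, h2⟩ 0 ⟨le_rfl, h1.trans h2⟩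
    rwa [hφ.zero, sub_zero, sub_zero, abs_of_nonneg h1] at this

/-- Stability of the weak formulation in `L¹`. -/
theorem abs_integral_weakIntegrand_sub_le (hk : SlopeBound k B C) (hkm : Measurable k)
    (hφ : AdmissibleDiffusion W φ) (hψ : IsTestFunction T ψ ψt ψx ψxx A r) {Λ m : ℝ}
    (hlip : ∀ a ∈ Icc 0 R, ∀ b ∈ Icc 0 R, |φ a - φ b| ≤ Λ * |a - b|)
    (hw : Integrable w (stripMeasure T)) (h0 : ∀ᵐ p ∂(stripMeasure T), 0 ≤ w p)
    (hR : ∀ᵐ p ∂(stripMeasure T), w p ≤ R)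
    (hv : Integrable v (stripMeasure T)) (h0' : ∀ᵐ p ∂(stripMeasure T), 0 ≤ v p)
    (hR' : ∀ᵐ p ∂(stripMeasure T), v p ≤ R)
    (hm : ∀ᵐ p ∂(stripMeasure T), ∫ y, |v (p.1, y)| ≤ m) :
    |(∫ p, weakIntegrand k φ ψt ψx ψxx w p ∂(stripMeasure T)) -
      ∫ p, weakIntegrand k φ ψt ψx ψxx v p ∂(stripMeasure T)| ≤
      (A + A * B * m + A * Λ + A * R * B * (2 * r)) * ∫ p, |w p - v p| ∂(stripMeasure T) := by
  have hB := hk.bound_nonneg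
  have hA := hψ.bound_nonneg
  have hd := hw.sub hv
  have hd' : Integrable (fun p => w p - v p) (stripMeasure T) := hd
  rw [← integral_sub (integrable_weakIntegrand hk hkm hφ hψ hw h0 hR)
    (integrable_weakIntegrand hk hkm hφ hψ hv h0' hR'), ← Real.norm_eq_abs]
  calc _ ≤ ∫ p, ((A + A * B * m + A * Λ) * |w p - v p| + A * R * B *
        ((∫ y, |w (p.1, y) - v (p.1, y)|) * (Icc (-r) r).indicator (fun _ => (1 : ℝ)) p.2))
          ∂(stripMeasure T) := by
        refine norm_integral_le_of_norm_le ((hd'.abs.const_mul _).add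
          ((integrable_slice_mul_indicator hd' r).const_mul _)) ?_
        filter_upwards [h0, hR, h0', hR', hm, ae_abs_lineForce_le hk hv, ae_abs_lineForce_le hk hd',
          ae_lineForce_sub hk hkm hw hv] with p a1 a2 a3 a4 a5 a6 a7 a8
        set d := |w p - v p|
        set I := (Icc (-r) r).indicator (fun _ => (1 : ℝ)) p.2
        set D := ∫ y, |w (p.1, y) - v (p.1, y)|
        have hD : 0 ≤ D := integral_nonneg fun y => abs_nonneg _
        have hd0 : 0 ≤ d := abs_nonneg _
        -- The quadratic term is split so that the force of `v` is bounded by the mass of its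
        -- slices, while the force of the difference is multiplied by the bounded function `w`.
        have e : weakIntegrand k φ ψt ψx ψxx w p - weakIntegrand k φ ψt ψx ψxx v p =
            (w p - v p) * ψt p - (w p - v p) * lineForce k v p * ψx p -
            w p * lineForce k (fun z => w z - v z) p * ψx p + (φ (w p) - φ (v p)) * ψxx p := by
          rw [← a8]; unfold weakIntegrand; ring
        have b1 : |(w p - v p) * ψt p| ≤ d * A := by
          rw [abs_mul]; exact mul_le_mul_of_nonneg_left (hψ.bound_t p) hd0
        have b2 : |(w p - v p) * lineForce k v p * ψx p| ≤ d * (B * m) * A := by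
          rw [abs_mul, abs_mul]
          refine mul_le_mul ?_ (hψ.bound_x p) (abs_nonneg _) ?_
          · exact mul_le_mul_of_nonneg_left (a6.trans (mul_le_mul_of_nonneg_left a5 hB)) hd0
          · exact mul_nonneg hd0 ((abs_nonneg _).trans
              (a6.trans (mul_le_mul_of_nonneg_left a5 hB)))
        have b3 : |w p * lineForce k (fun z => w z - v z) p * ψx p| ≤ R * (B * D) * (A * I) := by
          rw [abs_mul, abs_mul, abs_of_nonneg a1]
          refine mul_le_mul ?_ (abs_le_indicator hψ p) (abs_nonneg _)
            (mul_nonneg (a1.trans a2) (by positivity))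
          exact mul_le_mul a2 a7 (abs_nonneg _) (a1.trans a2)
        have b4 : |(φ (w p) - φ (v p)) * ψxx p| ≤ (Λ * d) * A := by
          rw [abs_mul]
          have := hlip _ ⟨a1, a2⟩ _ ⟨a3, a4⟩
          exact mul_le_mul this (hψ.bound_xx p) (abs_nonneg _) ((abs_nonneg _).trans this)
        rw [e, Real.norm_eq_abs]
        refine (abs_add_le _ _).trans ?_
        have c1 := abs_sub ((w p - v p) * ψt p - (w p - v p) * lineForce k v p * ψx p)
          (w p * lineForce k (fun z => w z - v z) p * ψx p)
        have c2 := abs_sub ((w p - v p) * ψt p) ((w p - v p) * lineForce k v p * ψx p)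
        have e2 : (A + A * B * m + A * Λ) * d + A * R * B * (D * I) =
            d * A + d * (B * m) * A + R * (B * D) * (A * I) + Λ * d * A := by ring
        rw [e2]
        linarith
    _ = _ := by
        rw [integral_add (hd'.abs.const_mul _)
          ((integrable_slice_mul_indicator hd' r).const_mul _), integral_const_mul,
          integral_const_mul, integral_slice_mul_indicator hd' hψ.width_nonneg]
        ring

end Weak

end AggDiff

end

/-! ### Particle densities as approximate weak solutions. -/

noncomputable section

namespace AggDiff

theorem stripCut_apply (L : ℝ) (u : ℝ × ℝ → ℝ) (t y : ℝ) :
    stripCut L u (t, y) = (Ico (-(L / 2)) (L / 2)).indicator (fun y => u (t, y)) y := by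
  by_cases hy : y ∈ Ico (-(L / 2)) (L / 2)
  · rw [stripCut, indicator_of_mem hy, indicator_of_mem (mk_mem_prod (mem_univ _) hy)]
  · rw [stripCut, indicator_of_notMem hy, indicator_of_notMem fun h => hy h.2]

namespace IsParticleEvolution

variable {K W φ q : ℝ → ℝ} {T L B C m M R H A r : ℝ} {N : ℕ} {x : ℤ → ℝ → ℝ}

theorem integrable_stripCut (hE : IsParticleEvolution K φ T L q N x) (hT : 0 < T) (hL : 0 < L)
    {c : ℝ} (hc : 0 < c) (hR : ∀ t ∈ Icc 0 T, ∀ k, configCell c N (fun k => x k t) k ≤ R) :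
    Integrable (stripCut L (particleDensity c N x)) (stripMeasure T) :=
  integrable_stripCut_iff.2 (hE.integrableOn_particleDensity hT hL hc hR _ _)

theorem stripCut_nonneg (hE : IsParticleEvolution K φ T L q N x) (hT : 0 < T) (hL : 0 < L)
    {c : ℝ} (hc : 0 < c) :
    ∀ᵐ p ∂(stripMeasure T), 0 ≤ stripCut L (particleDensity c N x) p := by
  filter_upwards [ae_stripMeasure_mem T] with p hp
  exact indicator_apply_nonneg fun _ => (hE.particleDensity_pos hT hL hc hp).le

theorem stripCut_le (hE : IsParticleEvolution K φ T L q N x) (hT : 0 < T) (hL : 0 < L)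
    {c : ℝ} (hR0 : 0 ≤ R) (hR : ∀ t ∈ Icc 0 T, ∀ k, configCell c N (fun k => x k t) k ≤ R) :
    ∀ᵐ p ∂(stripMeasure T), stripCut L (particleDensity c N x) p ≤ R := by
  filter_upwards [ae_stripMeasure_mem T] with p hp
  exact indicator_apply_le' (fun _ => hE.particleDensity_le hT hL hR hp) fun _ => hR0

theorem integral_abs_stripCut (hE : IsParticleEvolution K φ T L q N x) (hT : 0 < T) (hL : 0 < L)
    {c : ℝ} (hc : 0 < c) {t : ℝ} (ht : t ∈ Icc 0 T) :
    ∫ y, |stripCut L (particleDensity c N x) (t, y)| = c := by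
  simp_rw [stripCut_apply]
  exact (hE.isConfig hT hL ht).integral_abs_indicator_density hc

/-- Particle densities are approximate weak solutions. -/
theorem abs_weak_le (hk : SlopeBound (deriv K) B C) (hφ : AdmissibleDiffusion W φ)
    (hE : IsParticleEvolution K φ T L q N x) (hT : 0 < T) (hL : 0 < L) (hq : IsDatum q m M)
    (hR0 : 0 ≤ R) (hR : ∀ t ∈ Icc 0 T, ∀ k, configCell (cellMass q L) N (fun k => x k t) k ≤ R)
    (hH : ∀ t ∈ Icc 0 T, ∫ y in (-(L / 2))..(L / 2),
      configDensity (cellMass q L) N (fun k => x k t) y * |y| ≤ H)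
    {ψ ψt ψx ψxx : ℝ × ℝ → ℝ} (hψ : IsTestFunction T ψ ψt ψx ψxx A r) (hrL : r < L / 2) :
    |(∫ p, weakIntegrand (deriv K) φ ψt ψx ψxx
        (stripCut L (particleDensity (cellMass q L) N x)) p ∂(stripMeasure T)) +
      ∫ y, q y * ψ (0, y)| ≤
    T * (A * (cellMass q L / N * L) + A * cellMass q L * (cellMass q L / N * (C * L + 4 * B) +
      2 * B * H / (L / 2 - r)) + A * (B * cellMass q L + C * cellMass q L + 2 * B * R) *
      (cellMass q L / N * L)) + A * (cellMass q L / N * L) := by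
  have hc := hq.cellMass_pos hL
  have hN := (hE.isConfig hT hL (t := 0) ⟨le_rfl, hT.le⟩).natCast_pos
  have hA := hψ.bound_nonneg
  set c := cellMass q L with hcdef
  set v := stripCut L (particleDensity c N x) with hv
  set Err := A * (c / N * L) + A * c * (c / N * (C * L + 4 * B) +
      2 * B * H / (L / 2 - r)) + A * (B * c + C * c + 2 * B * R) * (c / N * L)
  have hvi := hE.integrable_stripCut hT hL hc hR
  have hwi := integrable_weakIntegrand hk (measurable_deriv K) hφ hψ hvi
    (hE.stripCut_nonneg hT hL hc) (hE.stripCut_le hT hL hR0 hR)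
  rw [← hv] at hwi
  have habs : |L / 2| = L / 2 := abs_of_pos (by linarith)
  have hbd : ∀ g : ℝ → ℝ, (∀ y, r < |y| → g y = 0) → g (-(L / 2)) = g (L / 2) := fun g hg => by
    rw [hg _ (by rw [abs_neg, habs]; exact hrL), hg _ (by rw [habs]; exact hrL)]
  have hlipx : ∀ t y z, |ψ (t, torusRep L y) - ψ (t, torusRep L z)| ≤ A * |y - z| := fun t =>
    abs_comp_torusRep_sub_le (g := fun y => ψ (t, y)) hL (fun u _ v _ => by
      have := hψ.lip t t u v
      rwa [sub_self, abs_zero, zero_add] at this) (hbd (fun y => ψ (t, y))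
        fun y hy => hψ.support (t, y) hy)
  -- the time slices of the weak formulation
  let J : ℝ → ℝ := fun t => ∫ y, weakIntegrand (deriv K) φ ψt ψx ψxx v (t, y)
  have hwi' := hwi
  rw [stripMeasure_eq_prod] at hwi'
  have hJint : IntegrableOn J (Icc 0 T) := hwi'.integral_prod_left
  have hJ : ∫ p, weakIntegrand (deriv K) φ ψt ψx ψxx v p ∂(stripMeasure T) =
      ∫ t in 0..T, J t := by
    rw [stripMeasure_eq_prod, integral_prod _ hwi', intervalIntegral.integral_of_le hT.le,
      ← integral_Icc_eq_integral_Ioc]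
  -- the empirical integral of the test function
  let S : ℝ → ℝ := fun t => c / N * ∑ k ∈ Finset.Ico (0 : ℤ) N, ψ (t, torusRep L (x k t))
  have hSac : AbsolutelyContinuousOnInterval S 0 T := by
    have hid : AbsolutelyContinuousOnInterval (fun t : ℝ => t) 0 T := by
      have : LipschitzOnWith 1 (fun t : ℝ => t) (uIcc 0 T) := LipschitzWith.id.lipschitzOnWith
      exact this.absolutelyContinuousOnInterval
    -- Time itself joins the particles, under the index `none`, because `ψ` also depends on it
    -- explicitly.
    let f : Option ℤ → ℝ → ℝ := fun o t => o.elim t fun k => x k t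
    refine absolutelyContinuous_of_le_sum (s := Finset.insertNone (Finset.Ico (0 : ℤ) N)) (f := f)
      (fun o _ => ?_) (A * c + A * (c / N)) fun t _ u _ => ?_
    · cases o with
      | none => exact hid
      | some k => exact hE.absolutelyContinuous k
    · rw [Finset.sum_insertNone]
      simp only [f, Option.elim]
      have h1 : |S t - S u| ≤ c / N * ∑ k ∈ Finset.Ico (0 : ℤ) N,
          (A * |t - u| + A * |x k t - x k u|) := by
        simp only [S]
        rw [← mul_sub, ← Finset.sum_sub_distrib, abs_mul, abs_of_pos (by positivity)]
        refine mul_le_mul_of_nonneg_left ?_ (by positivity)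
        refine (Finset.abs_sum_le_sum_abs _ _).trans (Finset.sum_le_sum fun k _ => ?_)
        refine (abs_sub_le _ (ψ (u, torusRep L (x k t))) _).trans (add_le_add ?_ (hlipx _ _ _))
        have := hψ.lip t u (torusRep L (x k t)) (torusRep L (x k t))
        rwa [sub_self, abs_zero, add_zero] at this
      refine h1.trans ?_
      rw [Finset.sum_add_distrib, sum_Ico_int_const, ← Finset.mul_sum]
      have h2 : 0 ≤ ∑ k ∈ Finset.Ico (0 : ℤ) N, |x k t - x k u| :=
        Finset.sum_nonneg fun _ _ => abs_nonneg _
      have h3 : 0 ≤ A * c * ∑ k ∈ Finset.Ico (0 : ℤ) N, |x k t - x k u| := by positivity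
      have h4 : 0 ≤ A * (c / N) * |t - u| := by positivity
      have e : c / N * (N * (A * |t - u|) + A * ∑ k ∈ Finset.Ico (0 : ℤ) N, |x k t - x k u|) =
          A * c * |t - u| + A * (c / N) * ∑ k ∈ Finset.Ico (0 : ℤ) N, |x k t - x k u| := by
        field_simp
      rw [e]
      linarith
  -- As `ψ` vanishes at time `T`, integrating the derivative of `S` leaves `-S 0`, which is the
  -- initial term up to a quadrature error.
  have hST : S T = 0 := by
    simp only [S, hψ.final, Finset.sum_const_zero, mul_zero]
  have hderiv : ∀ᵐ t ∂((volume : Measure ℝ).restrict (Icc 0 T)), |deriv S t - J t| ≤ Err := by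
    filter_upwards [hE.ae_velocity hT hL] with t ht
    obtain ⟨htT, κ, h1, h2, h3, h4⟩ := ht
    have htI := Ioo_subset_Icc_self htT
    have hx := hE.isConfig hT hL htI
    have hd : HasDerivAt S (c / N * ∑ k ∈ Finset.Ico (0 : ℤ) N, (ψt (t, torusRep L (x k t)) +
        ψx (t, torusRep L (x k t)) * (-(c / N) * (∑ j ∈ Finset.Ico (0 : ℤ) N, κ k j) -
          configForce φ c N (fun k => x k t) k))) t := by
      refine HasDerivAt.const_mul _ (HasDerivAt.fun_sum fun k _ => ?_)
      exact hasDerivAt_comp_torusRep_path hL hrL (h4 k) hψ.support (hψ.hasFDerivAt _)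
    rw [hd.deriv]
    have hφi : IntervalIntegrable (fun y => φ (configDensity c N (fun k => x k t) y) * ψxx (t, y))
        volume (-(L / 2)) (L / 2) := by
      have hcont : Continuous fun r => φ (max 0 r) :=
        hφ.contDiffOn.continuousOn.comp_continuous (by fun_prop) fun r => mem_Ici.2 (le_max_left _ _)
      have hmeas : Measurable fun y => φ (configDensity c N (fun k => x k t) y) := by
        have := hcont.measurable.comp (hx.measurable_density (c := c))
        convert this using 2 with y
        rw [Function.comp_apply, max_eq_right (hx.density_pos hc y).le]
      refine (intervalIntegrable_const (c := φ R) |>.mono_fun hmeas.aestronglyMeasurable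
        (Eventually.of_forall fun y => ?_)).mul_continuousOn
        (hψ.continuous_xx.comp (by fun_prop : Continuous fun y : ℝ => (t, y))).continuousOn
      have hp := (hx.density_pos hc y).le
      beta_reduce
      rw [Real.norm_of_nonneg (hφ.nonneg hp), Real.norm_of_nonneg (hφ.nonneg hR0)]
      exact hφ.mono hp (hx.density_le (hR t htI) y)
    have hmain := hx.abs_velocity_sub_weak_le hk hc hR0 (hR t htI) hψ.width_nonneg hrL (hH t htI)
      h1 h3 φ (t := t) hψ rfl hφi
    have hJt : J t = ∫ y in (-(L / 2))..(L / 2), (configDensity c N (fun k => x k t) y * ψt (t, y) -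
        configDensity c N (fun k => x k t) y * (∫ z, deriv K (y - z) *
          (Ico (-(L / 2)) (L / 2)).indicator (configDensity c N (fun k => x k t)) z) * ψx (t, y) +
          φ (configDensity c N (fun k => x k t) y) * ψxx (t, y)) := by
      simp only [J]
      rw [intervalIntegral.integral_of_le (by linarith), ← integral_Ico_eq_integral_Ioc,
        ← integral_indicator measurableSet_Ico]
      refine integral_congr_ae (Eventually.of_forall fun y => ?_)
      have hforce : lineForce (deriv K) v (t, y) = ∫ z, deriv K (y - z) *
          (Ico (-(L / 2)) (L / 2)).indicator (configDensity c N (fun k => x k t)) z := by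
        simp only [lineForce, hv, stripCut_apply]
        rfl
      by_cases hy : y ∈ Ico (-(L / 2)) (L / 2)
      · simp only [weakIntegrand]
        rw [hforce, hv, stripCut_apply, indicator_of_mem hy, indicator_of_mem hy]
        rfl
      · simp only [weakIntegrand]
        rw [hv, stripCut_apply, indicator_of_notMem hy, indicator_of_notMem hy, hφ.zero]
        ring
    rw [hJt]
    exact hmain
  have hI1 := hSac.intervalIntegrable_deriv
  have hI2 : IntervalIntegrable J volume 0 T := by
    rw [intervalIntegrable_iff_integrableOn_Icc_of_le hT.le]; exact hJint
  have hdiff : |(S T - S 0) - ∫ t in 0..T, J t| ≤ T * Err := by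
    rw [← hSac.integral_deriv_eq_sub, ← intervalIntegral.integral_sub hI1 hI2]
    have h1 := intervalIntegral.norm_integral_le_of_norm_le (a := 0) (b := T)
      (f := fun t => deriv S t - J t) (g := fun _ => Err) hT.le (by
        rw [ae_restrict_iff' measurableSet_Icc] at hderiv
        filter_upwards [hderiv] with t ht hmem
        exact ht (Ioc_subset_Icc_self hmem)) intervalIntegrable_const
    simpa using h1
  have hinit := hE.abs_initial_quadrature_le hT hL hq (g := fun y => ψ (0, y)) (A := A)
    (fun u _ v _ => by
      have := hψ.lip 0 0 u v
      rwa [sub_self, abs_zero, zero_add] at this)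
    (hbd (fun y => ψ (0, y)) fun y hy => hψ.support (0, y) hy)
  have hq0 : ∫ y in (-(L / 2))..(L / 2), q y * ψ (0, y) = ∫ y, q y * ψ (0, y) := by
    refine intervalIntegral.integral_eq_integral_of_support_subset fun y hy => ?_
    have : |y| ≤ r := by
      by_contra hcon
      exact hy (by simp only; rw [hψ.support (0, y) (not_le.1 hcon), mul_zero])
    have := abs_le.1 this
    constructor <;> linarith
  rw [hq0] at hinit
  rw [hST, zero_sub] at hdiff
  rw [hJ]
  have hS0 : S 0 = c / N * ∑ k ∈ Finset.Ico (0 : ℤ) N, ψ (0, torusRep L (x k 0)) := rfl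
  rw [← hcdef, ← hS0] at hinit
  rw [abs_le] at hdiff hinit ⊢
  constructor <;> linarith [hdiff.1, hdiff.2, hinit.1, hinit.2]

end IsParticleEvolution

end AggDiff

end

/-! ### Passage to the limit in the weak formulation. -/

noncomputable section

namespace AggDiff

theorem ae_mem_Icc_of_tendsto_integral {α : Type*} [MeasurableSpace α] {μ : Measure α}
    {u : ℕ → α → ℝ} {v : α → ℝ} {a b : ℝ} (hu : ∀ n, Integrable (u n) μ) (hv : Integrable v μ)
    (h : Tendsto (fun n => ∫ z, |u n z - v z| ∂μ) atTop (𝓝 0))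
    (hab : ∀ n, ∀ᵐ z ∂μ, u n z ∈ Icc a b) : ∀ᵐ z ∂μ, v z ∈ Icc a b := by
  have h1 := tendstoInMeasure_of_tendsto_eLpNorm (p := 1) one_ne_zero
    (fun n => (hu n).aestronglyMeasurable) hv.aestronglyMeasurable
    ((tendsto_eLpNorm_one_iff hu hv).2 h)
  obtain ⟨s, -, hs⟩ := h1.exists_seq_tendsto_ae
  filter_upwards [hs, ae_all_iff.2 hab] with z hz hz'
  exact isClosed_Icc.mem_of_tendsto hz (Eventually.of_forall fun n => hz' (s n))

section Limit

variable {K W φ : ℝ → ℝ} {T B C m M : ℝ}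

/-- The error in the weak formulation, in terms of the ratio `e` of the length to the number of
particles and of the error `X` due to the finite length. -/
theorem consistency_error_le {A B C R T c m N L e X : ℝ} (hA : 0 ≤ A) (hB : 0 ≤ B) (hC : 0 ≤ C)
    (hR : 0 ≤ R) (hT : 0 ≤ T) (hc : 0 ≤ c) (hcm : c ≤ m) (hN : 0 < N) (hL : 1 ≤ L)
    (he : L / N = e) (hX : 0 ≤ X) :
    T * (A * (c / N * L) + A * c * (c / N * (C * L + 4 * B) + X) +
      A * (B * c + C * c + 2 * B * R) * (c / N * L)) + A * (c / N * L) ≤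
    T * (A * (m * e) + A * m * ((C + 4 * B) * (m * e) + X) +
      A * (B * m + C * m + 2 * B * R) * (m * e)) + A * (m * e) := by
  have he0 : 0 ≤ e := by rw [← he]; positivity
  have h1 : c / N * L = c * e := by rw [← he]; ring
  have h2 : c / N ≤ c * e := by
    rw [← h1]; exact le_mul_of_one_le_right (by positivity) hL
  have h3 : c / N * (C * L + 4 * B) ≤ (C + 4 * B) * (c * e) := by
    have : c / N * (C * L + 4 * B) = C * (c / N * L) + 4 * B * (c / N) := by ring
    rw [this, h1]
    have := mul_le_mul_of_nonneg_left h2 (show 0 ≤ 4 * B by positivity)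
    linarith
  rw [h1]
  have hm : 0 ≤ m := hc.trans hcm
  have h4 := h3.trans (mul_le_mul_of_nonneg_left (mul_le_mul_of_nonneg_right hcm he0)
    (show 0 ≤ C + 4 * B by positivity))
  have h5 : 0 ≤ c / N * (C * L + 4 * B) := by positivity
  generalize c / N * (C * L + 4 * B) = Z at h4 h5
  gcongr

/-- Limits of particle approximations on tori of increasing length are weak solutions. -/
theorem isWeakSolution_of_tendsto (hk : SlopeBound (deriv K) B C) (hφ : AdmissibleDiffusion W φ)
    (hT : 0 < T) (hm : 0 ≤ m) (hM : 0 < M) {L : ℕ → ℝ} (hL : ∀ n, 0 < L n)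
    (hLt : Tendsto L atTop atTop) {N : ℕ → ℕ}
    (hLN : Tendsto (fun n => L n / N n) atTop (𝓝 0)) {q : ℕ → ℝ → ℝ} (hq : ∀ n, IsDatum (q n) m M)
    (hmom : ∀ n, Integrable fun y => |y| * q n y) {D : ℝ} (hD : ∀ n, ∫ y, |y| * q n y ≤ D)
    {x : ℕ → ℤ → ℝ → ℝ} (hE : ∀ n, IsParticleEvolution K φ T (L n) (q n) (N n) (x n))
    {q₀ : ℝ → ℝ} (hq₀ : Integrable q₀) (hq₀t : Tendsto (fun n => ∫ y, |q n y - q₀ y|) atTop (𝓝 0))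
    {ρ : ℝ × ℝ → ℝ} (hρ : Integrable ρ (stripMeasure T))
    (hρt : Tendsto (fun n => ∫ z, |stripCut (L n) (particleDensity (cellMass (q n) (L n)) (N n)
      (x n)) z - ρ z| ∂(stripMeasure T)) atTop (𝓝 0)) :
    IsWeakSolution K φ T q₀ ρ := by
  obtain ⟨R, Q, hR0, hQ0, hRQ⟩ := exists_evolution_bounds hk hφ T m M hm hM
  have hB := hk.bound_nonneg
  have hC := hk.lip_nonneg
  have hc := fun n => (hq n).cellMass_pos (hL n)
  have hcm := fun n => (hq n).cellMass_le (hL n)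
  have hR := fun n => (hRQ T (L n) (q n) (N n) (x n) hT le_rfl (hL n) (hq n) (hE n)).1
  have hQ := fun n => (hRQ T (L n) (q n) (N n) (x n) hT le_rfl (hL n) (hq n) (hE n)).2
  set v : ℕ → ℝ × ℝ → ℝ := fun n =>
    stripCut (L n) (particleDensity (cellMass (q n) (L n)) (N n) (x n))
  have hvi : ∀ n, Integrable (v n) (stripMeasure T) := fun n =>
    (hE n).integrable_stripCut hT (hL n) (hc n) (hR n)
  have hv0 : ∀ n, ∀ᵐ p ∂(stripMeasure T), 0 ≤ v n p := fun n =>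
    (hE n).stripCut_nonneg hT (hL n) (hc n)
  have hvR : ∀ n, ∀ᵐ p ∂(stripMeasure T), v n p ≤ R := fun n =>
    (hE n).stripCut_le hT (hL n) hR0.le (hR n)
  have hvm : ∀ n, ∀ᵐ p ∂(stripMeasure T), ∫ y, |v n (p.1, y)| ≤ m := fun n => by
    filter_upwards [ae_stripMeasure_mem T] with p hp
    exact ((hE n).integral_abs_stripCut hT (hL n) (hc n) hp).le.trans (hcm n)
  have hρ01 : ∀ᵐ p ∂(stripMeasure T), ρ p ∈ Icc 0 R :=
    ae_mem_Icc_of_tendsto_integral hvi hρ hρt fun n => by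
      filter_upwards [hv0 n, hvR n] with p h1 h2 using ⟨h1, h2⟩
  have hρ0 := hρ01.mono fun p hp => hp.1
  have hρR := hρ01.mono fun p hp => hp.2
  refine ⟨hρ, memLp_top_of_bound hρ.aestronglyMeasurable R ?_, hρ0, fun ψ hψs hψc hψT => ?_⟩
  · filter_upwards [hρ01] with p hp
    rw [Real.norm_of_nonneg hp.1]; exact hp.2
  obtain ⟨ψt, ψx, ψxx, A, r, hψ⟩ := exists_isTestFunction hψs hψc hψT
  obtain ⟨Λ, hΛ, hlip⟩ := hφ.exists_lipschitz R
  have hA := hψ.bound_nonneg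
  have e1 : ∫ p, (ρ p * deriv (fun s => ψ (s, p.2)) p.1
        - ρ p * (∫ y, deriv K (p.2 - y) * ρ (p.1, y)) * deriv (fun x => ψ (p.1, x)) p.2
        + φ (ρ p) * iteratedDeriv 2 (fun x => ψ (p.1, x)) p.2) ∂(stripMeasure T) =
      ∫ p, weakIntegrand (deriv K) φ ψt ψx ψxx ρ p ∂(stripMeasure T) := by
    refine integral_congr_ae (Eventually.of_forall fun p => ?_)
    beta_reduce
    rw [hψ.deriv_t, hψ.deriv_x, hψ.iteratedDeriv_x]
    rfl
  rw [e1]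
  set H := D + T * (m ^ 2 * B + m) + Q + 4 * m with hH
  -- The test function vanishes at time `T` and is `A`-Lipschitz in time.
  have hψ0 : ∀ y, |ψ (0, y)| ≤ A * T := fun y => by
    have := hψ.lip 0 T y y
    rwa [hψ.final, sub_zero, sub_self, abs_zero, add_zero, zero_sub, abs_neg, abs_of_pos hT] at this
  have hψ0m : AEStronglyMeasurable (fun y => ψ (0, y)) volume :=
    (hψs.continuous.comp (by fun_prop : Continuous fun y : ℝ => ((0 : ℝ), y))).aestronglyMeasurable
  let e : ℕ → ℝ := fun n => L n / N n
  let X : ℕ → ℝ := fun n => 2 * B * H / (L n / 2 - r)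
  -- Three errors: the `L¹` stability of the weak form, the consistency of the particles, and the
  -- change of the initial datum. The quantity they bound does not depend on `n`, hence it is zero.
  let bound : ℕ → ℝ := fun n =>
    (A + A * B * m + A * Λ + A * R * B * (2 * r)) * (∫ z, |v n z - ρ z| ∂(stripMeasure T)) +
    (T * (A * (m * e n) + A * m * ((C + 4 * B) * (m * e n) + X n) +
      A * (B * m + C * m + 2 * B * R) * (m * e n)) + A * (m * e n)) +
    A * T * ∫ y, |q n y - q₀ y|
  have hX : Tendsto X atTop (𝓝 0) := by
    refine Tendsto.div_atTop (a := 2 * B * H) tendsto_const_nhds ?_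
    exact tendsto_atTop_add_const_right _ _ (hLt.atTop_div_const (by norm_num))
  have hbound : Tendsto bound atTop (𝓝 0) := by
    have he : Tendsto (fun n => m * e n) atTop (𝓝 0) := by simpa using hLN.const_mul m
    have := ((hρt.const_mul (A + A * B * m + A * Λ + A * R * B * (2 * r))).add
      (((((he.const_mul A).add (((he.const_mul (C + 4 * B)).add hX).const_mul (A * m))).add
        (he.const_mul (A * (B * m + C * m + 2 * B * R)))).const_mul T).add
        (he.const_mul A))).add (hq₀t.const_mul (A * T))
    simpa using this
  have hle : ∀ᶠ n in atTop, |(∫ p, weakIntegrand (deriv K) φ ψt ψx ψxx ρ p ∂(stripMeasure T)) +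
      ∫ y, q₀ y * ψ (0, y)| ≤ bound n := by
    filter_upwards [hLt.eventually_gt_atTop (2 * r), hLt.eventually_ge_atTop 1,
      hLN.eventually (ge_mem_nhds (show (0 : ℝ) < 1 by norm_num))] with n hn1 hn2 hn3
    have hNpos := ((hE n).isConfig hT (hL n) (t := 0) ⟨le_rfl, hT.le⟩).natCast_pos
    have hHn : ∀ t ∈ Icc 0 T, ∫ y in (-(L n / 2))..(L n / 2),
        configDensity (cellMass (q n) (L n)) (N n) (fun k => x n k t) y * |y| ≤ H := fun t ht => by
      have h1 := (hE n).moment_le hk hφ hT (hL n) (hq n) (hQ n) (hmom n) ht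
      have h2 : m / N n * L n = m * (L n / N n) := by ring
      have h3 := mul_le_mul_of_nonneg_left hn3 hm
      rw [h2] at h1
      have h4 := hD n
      linarith
    have hH0 : 0 ≤ H := by
      refine le_trans ?_ (hHn 0 ⟨le_rfl, hT.le⟩)
      exact intervalIntegral.integral_nonneg (by linarith [hL n]) fun y _ => mul_nonneg
        (((hE n).isConfig hT (hL n) (t := 0) ⟨le_rfl, hT.le⟩).density_pos (hc n) y).le (abs_nonneg _)
    have hXn : 0 ≤ X n := div_nonneg (by positivity) (by linarith)
    have s1 := abs_integral_weakIntegrand_sub_le hk (measurable_deriv K) hφ hψ hlip hρ hρ0 hρR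
      (hvi n) (hv0 n) (hvR n) (hvm n)
    have s2 := (hE n).abs_weak_le hk hφ hT (hL n) (hq n) hR0.le (hR n) hHn hψ (by linarith)
    have s3 := s2.trans (consistency_error_le hA hB hC hR0.le hT.le (hc n).le (hcm n) hNpos hn2
      rfl hXn)
    have s4 : |(∫ y, q₀ y * ψ (0, y)) - ∫ y, q n y * ψ (0, y)| ≤
        A * T * ∫ y, |q n y - q₀ y| := by
      have i1 := hq₀.mul_bdd hψ0m (Eventually.of_forall hψ0)
      have i2 := (hq n).integrable.mul_bdd hψ0m (Eventually.of_forall hψ0)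
      rw [← integral_sub i1 i2, ← integral_const_mul, ← Real.norm_eq_abs]
      refine norm_integral_le_of_norm_le (((hq n).integrable.sub hq₀).abs.const_mul _)
        (Eventually.of_forall fun y => ?_)
      rw [Real.norm_eq_abs, ← sub_mul, abs_mul, abs_sub_comm, mul_comm]
      exact mul_le_mul_of_nonneg_right (hψ0 y) (abs_nonneg _)
    have s5 : ∫ z, |ρ z - v n z| ∂(stripMeasure T) = ∫ z, |v n z - ρ z| ∂(stripMeasure T) := by
      simp_rw [abs_sub_comm]
    rw [s5] at s1
    simp only [bound]
    rw [abs_le] at s1 s3 s4 ⊢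
    constructor <;> linarith [s1.1, s1.2, s3.1, s3.2, s4.1, s4.2]
  exact abs_nonpos_iff.1 (ge_of_tendsto hbound hle)

end Limit

end AggDiff

end

/-! ### Scheme limits and diagonal sequences. -/

noncomputable section

namespace AggDiff

theorem integral_abs_stripCut_sub (T L : ℝ) (u v : ℝ × ℝ → ℝ) :
    ∫ z, |stripCut L u z - stripCut L v z| ∂(stripMeasure T) =
      ∫ z, |u z - v z| ∂(torusStripMeasure T L) := by
  rw [← integral_stripCut]
  refine integral_congr_ae (Eventually.of_forall fun z => ?_)
  by_cases hz : z ∈ (univ ×ˢ Ico (-(L / 2)) (L / 2) : Set (ℝ × ℝ))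
  · simp only [stripCut, indicator_of_mem hz]
  · simp only [stripCut, indicator_of_notMem hz, sub_zero, abs_zero]

section Scheme

variable {K W φ q : ℝ → ℝ} {T L B C m M : ℝ}

theorem IsTorusLimit.exists_near (hk : SlopeBound (deriv K) B C) (hφ : AdmissibleDiffusion W φ)
    (hT : 0 < T) (hL : 0 < L) (hm : 0 ≤ m) (hM : 0 < M) (hq : IsDatum q m M) {ρL : ℝ × ℝ → ℝ}
    (h : IsTorusLimit K φ T L q ρL) {ε : ℝ} (hε : 0 < ε) :
    ∃ (N : ℕ) (x : ℤ → ℝ → ℝ), IsParticleEvolution K φ T L q N x ∧ L / N ≤ ε ∧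
      ∫ z, |particleDensity (cellMass q L) N x z - ρL z| ∂(torusStripMeasure T L) ≤ ε := by
  obtain ⟨hi, N, x, hN, hE, ht⟩ := h
  obtain ⟨R, Q, -, -, hRQ⟩ := exists_evolution_bounds hk hφ T m M hm hM
  replace ht := (tendsto_eLpNorm_one_iff (μ := torusStripMeasure T L)
    (fun n => (hE n).integrableOn_particleDensity hT hL
    (hq.cellMass_pos hL) (hRQ T L q _ _ hT le_rfl hL hq (hE n)).1 _ _) hi).1 ht
  have h1 : Tendsto (fun n => L / (N n : ℝ)) atTop (𝓝 0) :=
    (tendsto_const_div_atTop_nhds_zero_nat L).comp hN.tendsto_atTop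
  obtain ⟨n, hn1, hn2⟩ := ((h1.eventually (ge_mem_nhds hε)).and
    (ht.eventually (ge_mem_nhds hε))).exists
  exact ⟨N n, x n, hE n, hn1, hn2⟩

/-- The two nested limits collapse: a large `L` is chosen first, then `N` large enough for this `L`,
with `L/N` small too. From here on every scheme limit is represented by particle evolutions. -/
theorem IsSchemeLimit.exists_near (hk : SlopeBound (deriv K) B C) (hφ : AdmissibleDiffusion W φ)
    (hT : 0 < T) (hm : 0 ≤ m) (hM : 0 < M) (hq : IsDatum q m M) {ρ : ℝ × ℝ → ℝ}
    (h : IsSchemeLimit K φ T q ρ) {ε : ℝ} (hε : 0 < ε) (Λ : ℝ) :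
    ∃ (L : ℝ) (N : ℕ) (x : ℤ → ℝ → ℝ), 0 < L ∧ Λ ≤ L ∧ IsParticleEvolution K φ T L q N x ∧
      L / N ≤ ε ∧
      ∫ z, |stripCut L (particleDensity (cellMass q L) N x) z - ρ z| ∂(stripMeasure T) ≤ ε := by
  obtain ⟨hi, L, ρL, hL, hLt, hlim, ht⟩ := h
  obtain ⟨R, Q, -, -, hRQ⟩ := exists_evolution_bounds hk hφ T m M hm hM
  have hcut : ∀ n, Integrable (stripCut (L n) (ρL n)) (stripMeasure T) := fun n =>
    integrable_stripCut_iff.2 (hlim n).1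
  have ht' : Tendsto (fun n => ∫ z, |stripCut (L n) (ρL n) z - ρ z| ∂(stripMeasure T)) atTop
      (𝓝 0) := (tendsto_eLpNorm_one_iff hcut hi).1 ht
  obtain ⟨n, hn1, hn2⟩ := ((hLt.eventually_ge_atTop Λ).and
    (ht'.eventually (ge_mem_nhds (half_pos hε)))).exists
  obtain ⟨N, x, hE, hN, hx⟩ := (hlim n).exists_near hk hφ hT (hL n) hm hM hq (half_pos hε)
  refine ⟨L n, N, x, hL n, hn1, hE, hN.trans (half_le_self hε.le), ?_⟩
  have h1 := integral_abs_sub_le (hE.integrable_stripCut hT (hL n) (hq.cellMass_pos (hL n))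
    (hRQ T _ q _ _ hT le_rfl (hL n) hq hE).1) (hcut n) hi
  rw [integral_abs_stripCut_sub] at h1
  linarith

theorem exists_isTorusLimit (hk : SlopeBound (deriv K) B C) (hφ : AdmissibleDiffusion W φ)
    (hT : 0 < T) (hL : 0 < L) (hm : 0 ≤ m) (hM : 0 < M) (hq : IsDatum q m M) :
    ∃ ρL, IsTorusLimit K φ T L q ρL := by
  choose x hE using fun n : ℕ => exists_particleEvolution hk hφ hT hL hq (Nat.succ_pos n)
  obtain ⟨R, Q, -, -, hRQ⟩ := exists_evolution_bounds hk hφ T m M hm hM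
  obtain ⟨s, ρ, hs, hρ, ht⟩ := exists_subseq_torus hk hφ hT hL hm hM hq
    (tendsto_add_atTop_nat 1) hE
  refine ⟨ρ, hρ, fun n => s n + 1, fun n => x (s n), fun a b h => Nat.succ_lt_succ (hs h),
    fun n => hE (s n), ?_⟩
  exact (tendsto_eLpNorm_one_iff (fun n => (hE (s n)).integrableOn_particleDensity hT hL
    (hq.cellMass_pos hL) (hRQ T L q _ _ hT le_rfl hL hq (hE _)).1 _ _) hρ).2 ht

/-- Limits on each torus are available, but their convergence as `L → ∞` is not shown directly:
particle evolutions at distance `1/(n+1)` from them satisfy the compactness result on the line, and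
the torus limits follow. -/
theorem exists_isSchemeLimit (hk : SlopeBound (deriv K) B C) (hφ : AdmissibleDiffusion W φ)
    (hT : 0 < T) (hm : 0 ≤ m) (hM : 0 < M) (hq : IsDatum q m M)
    (hmom : Integrable fun y => |y| * q y) : ∃ ρ, IsSchemeLimit K φ T q ρ := by
  let L : ℕ → ℝ := fun n => n + 1
  have hL : ∀ n, 0 < L n := fun n => by positivity
  have hLt : Tendsto L atTop atTop :=
    tendsto_atTop_add_const_right _ _ tendsto_natCast_atTop_atTop
  obtain ⟨R, Q, -, -, hRQ⟩ := exists_evolution_bounds hk hφ T m M hm hM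
  choose ρL hρL using fun n => exists_isTorusLimit hk hφ hT (hL n) hm hM hq
  choose N x hE hN hx using fun n : ℕ => (hρL n).exists_near hk hφ hT (hL n) hm hM hq
    (ε := 1 / ((n : ℝ) + 1)) (by positivity)
  have hε : Tendsto (fun n : ℕ => 1 / ((n : ℝ) + 1)) atTop (𝓝 0) :=
    tendsto_one_div_add_atTop_nhds_zero_nat
  have hLN : Tendsto (fun n => L n / N n) atTop (𝓝 0) :=
    squeeze_zero (fun n => div_nonneg (hL n).le (Nat.cast_nonneg _)) hN hε
  obtain ⟨s, ρ, hs, hρ, ht⟩ := exists_subseq_line hk hφ hT hm hM hL hLt hLN (fun _ => hq)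
    (fun _ => hmom) (A := ∫ y, |y| * q y) (fun _ => le_rfl) hE
  have hcut : ∀ n, Integrable (stripCut (L n) (ρL n)) (stripMeasure T) := fun n =>
    integrable_stripCut_iff.2 (hρL n).1
  refine ⟨ρ, hρ, fun n => L (s n), fun n => ρL (s n), fun n => hL _,
    hLt.comp hs.tendsto_atTop, fun n => hρL _, ?_⟩
  refine (tendsto_eLpNorm_one_iff (u := fun n => stripCut (L (s n)) (ρL (s n)))
    (fun n => hcut _) hρ).2 ?_
  have hsum := (hε.comp hs.tendsto_atTop).add ht
  rw [add_zero] at hsum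
  refine squeeze_zero (fun n => integral_nonneg fun z => abs_nonneg _) (fun n => ?_) hsum
  refine (integral_abs_sub_le (hcut (s n)) ((hE (s n)).integrable_stripCut hT (hL (s n))
    (hq.cellMass_pos (hL (s n))) (hRQ T _ q _ _ hT le_rfl (hL _) hq (hE _)).1) hρ).trans ?_
  refine add_le_add ?_ le_rfl
  rw [integral_abs_stripCut_sub]
  simp_rw [abs_sub_comm (ρL (s n) _)]
  exact hx (s n)

theorem IsSchemeLimit.isWeakSolution (hk : SlopeBound (deriv K) B C)
    (hφ : AdmissibleDiffusion W φ) (hT : 0 < T) (hm : 0 ≤ m) (hM : 0 < M) (hq : IsDatum q m M)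
    (hmom : Integrable fun y => |y| * q y) {ρ : ℝ × ℝ → ℝ} (h : IsSchemeLimit K φ T q ρ) :
    IsWeakSolution K φ T q ρ := by
  choose L N x hL hΛ hE hN hx using fun n : ℕ => h.exists_near hk hφ hT hm hM hq
    (ε := 1 / ((n : ℝ) + 1)) (by positivity) n
  have hε : Tendsto (fun n : ℕ => 1 / ((n : ℝ) + 1)) atTop (𝓝 0) :=
    tendsto_one_div_add_atTop_nhds_zero_nat
  refine isWeakSolution_of_tendsto hk hφ hT hm hM hL
    (tendsto_atTop_mono hΛ tendsto_natCast_atTop_atTop)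
    (squeeze_zero (fun n => div_nonneg (hL n).le (Nat.cast_nonneg _)) hN hε) (fun _ => hq)
    (fun _ => hmom) (D := ∫ y, |y| * q y) (fun _ => le_rfl) hE hq.integrable (by simp) h.1
    (squeeze_zero (fun n => integral_nonneg fun z => abs_nonneg _) hx hε)

/-- Scheme limits from converging data converge, along a subsequence, to a weak solution. -/
theorem exists_subseq_schemeLimit (hk : SlopeBound (deriv K) B C)
    (hφ : AdmissibleDiffusion W φ) (hT : 0 < T) (hm : 0 ≤ m) (hM : 0 < M) {q : ℕ → ℝ → ℝ}
    (hq : ∀ n, IsDatum (q n) m M) (hmom : ∀ n, Integrable fun y => |y| * q n y) {A : ℝ}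
    (hA : ∀ n, ∫ y, |y| * q n y ≤ A) {q₀ : ℝ → ℝ} (hq₀ : Integrable q₀)
    (hq₀t : Tendsto (fun n => ∫ y, |q n y - q₀ y|) atTop (𝓝 0)) {ρ : ℕ → ℝ × ℝ → ℝ}
    (h : ∀ n, IsSchemeLimit K φ T (q n) (ρ n)) :
    ∃ (s : ℕ → ℕ) (ρlim : ℝ × ℝ → ℝ), StrictMono s ∧
      Tendsto (fun n => eLpNorm (fun p => ρ (s n) p - ρlim p) 1 (stripMeasure T)) atTop (𝓝 0) ∧
      IsWeakSolution K φ T q₀ ρlim := by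
  obtain ⟨R, Q, -, -, hRQ⟩ := exists_evolution_bounds hk hφ T m M hm hM
  -- Each `ρ n` is traded for one particle density at distance at most `1/(n+1)`, on a torus of
  -- length at least `n` and with `L/N ≤ 1/(n+1)`. Compactness and consistency then apply to a
  -- single sequence with varying data.
  choose L N x hL hΛ hE hN hx using fun n : ℕ => (h n).exists_near hk hφ hT hm hM (hq n)
    (ε := 1 / ((n : ℝ) + 1)) (by positivity) n
  have hε : Tendsto (fun n : ℕ => 1 / ((n : ℝ) + 1)) atTop (𝓝 0) :=
    tendsto_one_div_add_atTop_nhds_zero_nat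
  have hLt : Tendsto L atTop atTop := tendsto_atTop_mono hΛ tendsto_natCast_atTop_atTop
  have hLN : Tendsto (fun n => L n / N n) atTop (𝓝 0) :=
    squeeze_zero (fun n => div_nonneg (hL n).le (Nat.cast_nonneg _)) hN hε
  obtain ⟨s, ρlim, hs, hρ, ht⟩ := exists_subseq_line hk hφ hT hm hM hL hLt hLN hq hmom hA hE
  refine ⟨s, ρlim, hs, ?_, isWeakSolution_of_tendsto hk hφ hT hm hM (fun n => hL (s n))
    (hLt.comp hs.tendsto_atTop) (hLN.comp hs.tendsto_atTop) (fun n => hq (s n))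
    (fun n => hmom (s n)) (fun n => hA (s n)) (fun n => hE (s n)) hq₀
    (hq₀t.comp hs.tendsto_atTop) hρ ht⟩
  refine (tendsto_eLpNorm_one_iff (fun n => (h (s n)).1) hρ).2 ?_
  have hsum := (hε.comp hs.tendsto_atTop).add ht
  rw [add_zero] at hsum
  refine squeeze_zero (fun n => integral_nonneg fun z => abs_nonneg _) (fun n => ?_) hsum
  refine (integral_abs_sub_le (h (s n)).1 ((hE (s n)).integrable_stripCut hT (hL (s n))
    ((hq (s n)).cellMass_pos (hL (s n)))
    (hRQ T _ _ _ _ hT le_rfl (hL _) (hq (s n)) (hE _)).1) hρ).trans ?_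
  refine add_le_add ?_ le_rfl
  simp_rw [abs_sub_comm (ρ (s n) _)]
  exact hx (s n)

end Scheme

end AggDiff

end

/-! ### The theorem: uniform bounds for the approximating data. -/

theorem theorem4
    (K : ℝ → ℝ) (hK : AggDiff.AdmissibleKernel K)
    (W φ : ℝ → ℝ) (hφ : AggDiff.AdmissibleDiffusion W φ)
    (T : ℝ) (hT : 0 < T)
    (ρ₀ : ℝ → ℝ) (hρ₀_nonneg : ∀ᵐ x, 0 ≤ ρ₀ x)
    (hρ₀_int : Integrable ρ₀) (hρ₀_bdd : MemLp ρ₀ ∞)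
    (hρ₀_mom : Integrable (fun x => |x| * ρ₀ x))
    (r₀ : ℕ → ℝ → ℝ) (hr₀_pos : ∀ l, ∀ᵐ x, 0 < r₀ l x)
    (hr₀_int : ∀ l, Integrable (r₀ l))
    (hr₀_bdd : ∃ M : ℝ, ∀ l, ∀ᵐ x, r₀ l x ≤ M)
    (hr₀_mom : ∀ l, Integrable (fun x => |x| * r₀ l x))
    (hr₀_mom_bdd : ∃ M : ℝ, ∀ l, ∫ x, |x| * r₀ l x ≤ M)
    (hr₀_tendsto : Tendsto (fun l => eLpNorm (fun x => r₀ l x - ρ₀ x) 1 volume) atTop (𝓝 0)) :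
    (∀ l, ∃ ρ : ℝ × ℝ → ℝ, AggDiff.IsSchemeLimit K φ T (r₀ l) ρ) ∧
    ∀ ρ : ℕ → ℝ × ℝ → ℝ, (∀ l, AggDiff.IsSchemeLimit K φ T (r₀ l) (ρ l)) →
      (∀ l, AggDiff.IsWeakSolution K φ T (r₀ l) (ρ l)) ∧
      ∃ (s : ℕ → ℕ) (ρlim : ℝ × ℝ → ℝ), StrictMono s ∧
        Tendsto (fun n => eLpNorm (fun p => ρ (s n) p - ρlim p) 1 (AggDiff.stripMeasure T))
          atTop (𝓝 0) ∧
        AggDiff.IsWeakSolution K φ T ρ₀ ρlim := by 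
  obtain ⟨B, C, hk⟩ := hK.exists_slopeBound
  obtain ⟨M, hM⟩ := hr₀_bdd
  obtain ⟨A, hA⟩ := hr₀_mom_bdd
  have ht := (AggDiff.tendsto_eLpNorm_one_iff hr₀_int hρ₀_int).1 hr₀_tendsto
  obtain ⟨D, hD⟩ := ht.bddAbove_range
  -- The masses are bounded by the supremum `D` of the `L¹` distances to `ρ₀` plus the norm of `ρ₀`.
  let m : ℝ := max 0 (D + ∫ y, |ρ₀ y|)
  have hdatum : ∀ l, AggDiff.IsDatum (r₀ l) m (max M 1) := fun l =>
    { integrable := hr₀_int l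
      pos := hr₀_pos l
      le := (hM l).mono fun y hy => hy.trans (le_max_left _ _)
      mass := by
        have h1 : ∫ y, r₀ l y ≤ ∫ y, (|r₀ l y - ρ₀ y| + |ρ₀ y|) :=
          integral_mono (hr₀_int l) (((hr₀_int l).sub hρ₀_int).abs.add hρ₀_int.abs) fun y => by
            have h1 := le_abs_self (r₀ l y - ρ₀ y)
            have h2 := le_abs_self (ρ₀ y)
            simp only
            linarith
        have h2 : ∫ y, |r₀ l y - ρ₀ y| ≤ D := hD (mem_range_self l)
        have h3 : ∫ y, (|r₀ l y - ρ₀ y| + |ρ₀ y|) =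
            (∫ y, |r₀ l y - ρ₀ y|) + ∫ y, |ρ₀ y| :=
          integral_add ((hr₀_int l).sub hρ₀_int).abs hρ₀_int.abs
        rw [h3] at h1
        exact (h1.trans (by linarith)).trans (le_max_right _ _) }
  have hm : 0 ≤ m := le_max_left _ _
  have hM0 : 0 < max M 1 := lt_max_of_lt_right one_pos
  refine ⟨fun l => AggDiff.exists_isSchemeLimit hk hφ hT hm hM0 (hdatum l) (hr₀_mom l),
    fun ρ hρ => ⟨fun l => (hρ l).isWeakSolution hk hφ hT hm hM0 (hdatum l) (hr₀_mom l), ?_⟩⟩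
  exact AggDiff.exists_subseq_schemeLimit hk hφ hT hm hM0 hdatum hr₀_mom hA hρ₀_int ht hρ
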